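/- There are $m$ indivisible items and two agents $a,b$ with unknown utilities $\mu^a_i,\mu^b_i\in[0,1]$, $i=1,\dots,m$, which are additive over sets of items. An allocation is a partition $\mathcal A=(\mathcal A_a,\mathcal A_b)$ of the items; put $$\mathrm{Envy}_{a\to b}(\mathcal A)=\sum_{i\in\mathcal A_b}\mu^a_i-\sum_{i\in\mathcal A_a}\mu^a_i,\qquad \mathrm{Envy}_{b\to a}(\mathcal A)=\sum_{i\in\mathcal A_a}\mu^b_i-\sum_{i\in\mathcal A_b}\mu^b_i,$$ and let $\mathrm{Envy}(\mathcal A)$ be the maximum of the two. The allocation is envy-free if $\mathrm{Envy}(\mathcal A)\le 0$. Querying an item $i$ returns a pair of observations $y^a\sim N(\mu^a_i,\sigma^2)$, $y^b\sim N(\mu^b_i,\sigma^2)$, and all observations are independent. **Theorem.** For every fixed $\sigma>0$ there are a constant $C>0$ and a randomized polynomial-time algorithm such that, as $m\to\infty$, for all $\Delta$ with $m^{1/4}\log^2 m\le\Delta\le Cm$, the algorithm, given $m$ and $\Delta$, makes at most $\widetilde O\big(m^{2.5}/\Delta^2\big)$ queries (that is, at most $K\,\frac{m^{2.5}}{\Delta^2}\log^k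 m$ queries, where $K,k$ depend only on $\sigma$), chosen non-adaptively, i.e. all of them before any observation is made, runs in time polynomial in $m$, and, whenever $\min_{\mathcal A}\mathrm{Envy}(\mathcal A)\le-\Delta$, outputs an envy-free allocation with probability $1-o(1)$, uniformly in $\Delta$ and in the utilities. Here the algorithm is a program for a randomized real RAM (exact field operations and comparisons of real numbers at unit cost, fair coin tosses, no rounding operation, rational constants). -/

import Mathlib

open MeasureTheory ProbabilityTheory Filter Topology

namespace EnvyFree

/-! ### Fair division between two agents -/

/-- The two agents. -/
inductive Agent where
  | a
  | b
  deriving DecidableEq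

/-- The other agent. -/
def Agent.other : Agent → Agent
  | .a => .b
  | .b => .a

/-- An allocation of the items `Fin m`: a partition of the items into the bundles of the two agents,
given by the map that sends an item to the agent who receives it. -/
abbrev Allocation (m : ℕ) : Type := Fin m → Agent

/-- The envy of agent `ν` towards the other agent under the additive utilities `u`: the value (for
`ν`) of the bundle of the other agent minus the value of the bundle of `ν`. -/
noncomputable def envyOf {m : ℕ} (u : Agent → Fin m → ℝ) (A : Allocation m) (ν : Agent) : ℝ :=
  (∑ i with A i = ν.other, u ν i) - ∑ i with A i = ν, u ν i

/-- The overall envy of an allocation. -/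
noncomputable def envy {m : ℕ} (u : Agent → Fin m → ℝ) (A : Allocation m) : ℝ :=
  max (envyOf u A .a) (envyOf u A .b)

/-- No agent envies the other one. -/
def IsEnvyFree {m : ℕ} (u : Agent → Fin m → ℝ) (A : Allocation m) : Prop :=
  envy u A ≤ 0

/-- The smallest overall envy of an allocation (a minimum over finitely many allocations). -/
noncomputable def optEnvy {m : ℕ} (u : Agent → Fin m → ℝ) : ℝ :=
  ⨅ A : Allocation m, envy u A

/-! ### The model of computation: a randomized real RAM

Programs are built from assignments, coin tosses, sequencing, conditionals and while-loops. The
memory consists of arrays of natural numbers and arrays of real numbers. Field operations and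
comparisons of real numbers are exact and cost one step each up to a constant factor that depends
only on the program; there is no rounding operation, and constants in programs are natural or
rational numbers. On natural numbers only addition and truncated subtraction are available, so that
`t` steps produce only natural numbers with `O(t)` bits. -/

/-- The contents of the memory: `nat k j` is cell `j` of the `k`-th array of natural numbers,
`real k j` is cell `j` of the `k`-th array of real numbers; `pos` counts the coin tosses so far. -/
structure State where
  nat : ℕ → ℕ → ℕ
  real : ℕ → ℕ → ℝ
  pos : ℕ

/-- Expressions of type natural number; `get k e` reads cell `e` of array `k`. -/
inductive NExpr where
  | const (n : ℕ)
  | get (k : ℕ) (e : NExpr)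
  | add (e f : NExpr)
  | sub (e f : NExpr)

/-- Expressions of type real number; `get k e` reads cell `e` of array `k`. -/
inductive RExpr where
  | const (x : ℚ)
  | get (k : ℕ) (e : NExpr)
  | ofNat (e : NExpr)
  | add (e f : RExpr)
  | sub (e f : RExpr)
  | mul (e f : RExpr)
  | div (e f : RExpr)

/-- Tests. -/
inductive Test where
  | natLt (e f : NExpr)
  | realLt (e f : RExpr)
  | neg (t : Test)
  | and (t t' : Test)

/-- Programs. -/
inductive Program where
  | skip
  | setNat (k : ℕ) (idx e : NExpr)
  | setReal (k : ℕ) (idx : NExpr) (e : RExpr)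
  | toss (k : ℕ) (idx : NExpr)
  | seq (p p' : Program)
  | branch (t : Test) (p p' : Program)
  | loop (t : Test) (p : Program)

/-- The value of an expression of type natural number. -/
def NExpr.eval (s : State) : NExpr → ℕ
  | const n => n
  | get k e => s.nat k (e.eval s)
  | add e f => e.eval s + f.eval s
  | sub e f => e.eval s - f.eval s

/-- The value of an expression of type real number (division by zero gives zero). -/
noncomputable def RExpr.eval (s : State) : RExpr → ℝ
  | const x => (x : ℝ)
  | get k e => s.real k (e.eval s)
  | ofNat e => (e.eval s : ℝ)
  | add e f => e.eval s + f.eval s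
  | sub e f => e.eval s - f.eval s
  | mul e f => e.eval s * f.eval s
  | div e f => e.eval s / f.eval s

/-- The truth value of a test. -/
def Test.Holds (s : State) : Test → Prop
  | natLt e f => e.eval s < f.eval s
  | realLt e f => e.eval s < f.eval s
  | neg t => ¬ t.Holds s
  | and t t' => t.Holds s ∧ t'.Holds s

/-- Overwrite cell `j` of the `k`-th array of natural numbers. -/
def State.writeNat (s : State) (k j n : ℕ) : State :=
  { s with nat := Function.update s.nat k (Function.update (s.nat k) j n) }

/-- Overwrite cell `j` of the `k`-th array of real numbers. -/
def State.writeReal (s : State) (k j : ℕ) (x : ℝ) : State :=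
  { s with real := Function.update s.real k (Function.update (s.real k) j x) }

/-- `Exec coins p s t s'`: started in the state `s`, with the outcomes of the coin tosses given by
the sequence `coins`, the program `p` halts after exactly `t` steps in the state `s'`. Every
assignment, every coin toss and every evaluation of a test is one step. -/
inductive Exec (coins : ℕ → Bool) : Program → State → ℕ → State → Prop where
  | skip (s : State) : Exec coins .skip s 1 s
  | setNat (k : ℕ) (idx e : NExpr) (s : State) :
      Exec coins (.setNat k idx e) s 1 (s.writeNat k (idx.eval s) (e.eval s))
  | setReal (k : ℕ) (idx : NExpr) (e : RExpr) (s : State) :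
      Exec coins (.setReal k idx e) s 1 (s.writeReal k (idx.eval s) (e.eval s))
  | toss (k : ℕ) (idx : NExpr) (s : State) :
      Exec coins (.toss k idx) s 1
        { s.writeNat k (idx.eval s) (coins s.pos).toNat with pos := s.pos + 1 }
  | seq {p p' : Program} {s s' s'' : State} {t t' : ℕ} :
      Exec coins p s t s' → Exec coins p' s' t' s'' → Exec coins (.seq p p') s (t + t') s''
  | branch_true {c : Test} {p p' : Program} {s s' : State} {t : ℕ} :
      c.Holds s → Exec coins p s t s' → Exec coins (.branch c p p') s (t + 1) s'
  | branch_false {c : Test} {p p' : Program} {s s' : State} {t : ℕ} :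
      ¬ c.Holds s → Exec coins p' s t s' → Exec coins (.branch c p p') s (t + 1) s'
  | loop_true {c : Test} {p : Program} {s s' s'' : State} {t t' : ℕ} :
      c.Holds s → Exec coins p s t s' → Exec coins (.loop c p) s' t' s'' →
        Exec coins (.loop c p) s (t + t' + 1) s''
  | loop_false {c : Test} {p : Program} {s : State} :
      ¬ c.Holds s → Exec coins (.loop c p) s 1 s

/-- Given the coins, the running time and the final state are unique. -/
theorem Exec.unique {coins : ℕ → Bool} {p : Program} {s s₁ s₂ : State} {t₁ t₂ : ℕ}
    (h₁ : Exec coins p s t₁ s₁) (h₂ : Exec coins p s t₂ s₂) : t₁ = t₂ ∧ s₁ = s₂ := by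
  induction h₁ generalizing t₂ s₂ with
  | skip s => cases h₂; exact ⟨rfl, rfl⟩
  | setNat k idx e s => cases h₂; exact ⟨rfl, rfl⟩
  | setReal k idx e s => cases h₂; exact ⟨rfl, rfl⟩
  | toss k idx s => cases h₂; exact ⟨rfl, rfl⟩
  | seq _ _ ih ih' =>
    cases h₂ with
    | seq g g' =>
      obtain ⟨rfl, rfl⟩ := ih g
      obtain ⟨rfl, rfl⟩ := ih' g'
      exact ⟨rfl, rfl⟩
  | branch_true hc _ ih =>
    cases h₂ with
    | branch_true _ g => obtain ⟨rfl, rfl⟩ := ih g; exact ⟨rfl, rfl⟩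
    | branch_false hn _ => exact absurd hc hn
  | branch_false hn _ ih =>
    cases h₂ with
    | branch_true hc _ => exact absurd hc hn
    | branch_false _ g => obtain ⟨rfl, rfl⟩ := ih g; exact ⟨rfl, rfl⟩
  | loop_true hc _ _ ih ih' =>
    cases h₂ with
    | loop_true _ g g' =>
      obtain ⟨rfl, rfl⟩ := ih g
      obtain ⟨rfl, rfl⟩ := ih' g'
      exact ⟨rfl, rfl⟩
    | loop_false hn => exact absurd hc hn
  | loop_false hn =>
    cases h₂ with
    | loop_true hc _ _ => exact absurd hc hn
    | loop_false _ => exact ⟨rfl, rfl⟩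

/-! ### Non-adaptive algorithms with noisy queries -/

/-- A non-adaptive algorithm. The program `design` fixes the list of all queries before anything is
observed; the program `allocate` then computes an allocation from the answers. The second program
starts with a fresh memory and fresh coins and receives from the first one only the list of queries. -/
structure NonadaptiveAlgorithm where
  design : Program
  allocate : Program

/-- The input of `design`: the number `m` of items and the gap `Δ`; all other cells are zero. -/
def designInput (m : ℕ) (Δ : ℝ) : State where
  nat
    | 0, 0 => m
    | _, _ => 0
  real
    | 0, 0 => Δ
    | _, _ => 0
  pos := 0

/-- With the given coins and on input `(m, Δ)`, the program `design` halts after at most `T` steps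
and outputs the list `Q` of items to be queried: its length is in cell 0 of array 1, its entries are
in array 2. -/
def NonadaptiveAlgorithm.Designs (P : NonadaptiveAlgorithm) {m : ℕ} (Δ : ℝ) (coins : ℕ → Bool)
    (T : ℕ) (Q : List (Fin m)) : Prop :=
  ∃ t ≤ T, ∃ s : State, Exec coins P.design (designInput m Δ) t s ∧
    s.nat 1 0 = Q.length ∧ ∀ j : Fin Q.length, s.nat 2 j = Q.get j

/-- The input of `allocate`: the number of items, the list `Q` of queried items, and the pair of
answers `(y j a, y j b)` to the `j`-th query; all other cells are zero. -/
noncomputable def allocateInput {m : ℕ} (Q : List (Fin m)) (y : Fin Q.length → Agent → ℝ) :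
    State where
  nat
    | 0, 0 => m
    | 1, 0 => Q.length
    | 2, j => if h : j < Q.length then Q.get ⟨j, h⟩ else 0
    | _, _ => 0
  real
    | 0, j => if h : j < Q.length then y ⟨j, h⟩ .a else 0
    | 1, j => if h : j < Q.length then y ⟨j, h⟩ .b else 0
    | _, _ => 0
  pos := 0

/-- With the given coins, the list `Q` of queried items and the answers `y`, the program `allocate`
halts after at most `T` steps and outputs the allocation `A`: agent `b` receives the item `i` if cell
`i` of array 3 is zero, and agent `a` receives it otherwise. -/
def NonadaptiveAlgorithm.Allocates (P : NonadaptiveAlgorithm) {m : ℕ} (Q : List (Fin m))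
    (y : Fin Q.length → Agent → ℝ) (coins : ℕ → Bool) (T : ℕ) (A : Allocation m) : Prop :=
  ∃ t ≤ T, ∃ s : State, Exec coins P.allocate (allocateInput Q y) t s ∧
    ∀ i : Fin m, A i = if s.nat 3 i = 0 then .b else .a

/-- The law of a sequence of independent fair coin tosses. -/
noncomputable def fairCoins : Measure (ℕ → Bool) :=
  Measure.infinitePi fun _ => (PMF.uniformOfFintype Bool).toMeasure

/-- The law of independent Gaussian noise variables of mean zero and variance `σ ^ 2`, one for every
query and agent. -/
noncomputable def gaussianNoise (σ : ℝ) : Measure (ℕ × Agent → ℝ) :=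
  Measure.infinitePi fun _ => gaussianReal 0 (σ ^ 2).toNNReal

/-- Everything random in a run: the coins of `design`, the coins of `allocate`, the noise. -/
abbrev Randomness : Type := (ℕ → Bool) × (ℕ → Bool) × (ℕ × Agent → ℝ)

/-- The joint law of the coins and of the noise, which are independent. -/
noncomputable def randomness (σ : ℝ) : Measure Randomness :=
  fairCoins.prod (fairCoins.prod (gaussianNoise σ))

/-- The answers to the queries `Q`: the answer of agent `ν` to the `j`-th query is the utility of the
queried item for `ν` plus fresh noise. -/
def answers {m : ℕ} (u : Agent → Fin m → ℝ) (Q : List (Fin m)) (ξ : ℕ × Agent → ℝ) :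
    Fin Q.length → Agent → ℝ :=
  fun j ν => u ν (Q.get j) + ξ (j, ν)

/-- In the run with randomness `ω`, both programs halt within `T` steps and the output is an
envy-free allocation with respect to the true utilities `u`. -/
def NonadaptiveAlgorithm.Succeeds (P : NonadaptiveAlgorithm) {m : ℕ} (u : Agent → Fin m → ℝ)
    (Δ : ℝ) (T : ℕ) (ω : Randomness) : Prop :=
  ∃ (Q : List (Fin m)) (A : Allocation m), P.Designs Δ ω.1 T Q ∧
    P.Allocates Q (answers u Q ω.2.2) ω.2.1 T A ∧ IsEnvyFree u A

end EnvyFree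

/-! Let V_a and V_b be the advantages of the two agents, each being the value of the own bundle
minus that of the other bundle. For a weight λ in [0,1] put θ_i = λ μ^a_i − (1−λ) μ^b_i. Giving i to
`a` when θ_i > 0 maximises λ V_a + (1−λ) V_b, and the maximum is Σ|θ_i|. An allocation of envy at
most −Δ makes both advantages at least Δ, so Σ|θ_i| ≥ Δ for every λ (`le_sum_abs_weighted`).

If the sign of θ_i is guessed from the sum of q noisy answers per agent, the item contributes in
expectation about √q θ_i² (at most |θ_i|), even when θ_i is far below the noise level. By
Cauchy–Schwarz the guessed signs gain about √q Δ²/m in total, and 1/B of this if one random item is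
queried in each block of B = 2^j items. The parameters satisfy q Δ² ≈ m^{3/2} log m · B with q = 1
or B = 1. The gain on the queried items is then at least of order √m log m / √q (`margin`), and
about q m / B ≈ m^{5/2} log m / Δ² queries are made. The gain holds with high probability because a
guessed sign s satisfies E exp(−c s θ) ≤ 1/cosh(cθ) (`integral_exp_neg_sign_mul_le`,
`randomness_sum_sign_mul_weight_le`).

This controls only the weighted sum of V_a and V_b. To make both large, λ moves from 0 to 1 in m²
small steps, each of which changes the weight of one item only, so that V_a and V_b change by at
most 2 per step. At every step one of them is large, at the start it is V_b, at the end V_a; hence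
somewhere on the path both are (`exists_balanced_candidate`).

The algorithm does not see V_a and V_b. It computes all candidates of the path from the answers in
even positions and scores them with the independent answers in odd positions, with an error of order
√(m/q) up to logarithms (`randomness_sum_sign_mul_noise_le`). Items that are not queried are given
away by coin tosses, at the cost of order √m up to logarithms; they occur only if B > 1, and then q
= 1 (`randomness_sum_coinSign_le`). The constants make both errors small fractions of the gain. A
union bound over the O(m²) events (`randomness_not_typical_le`) leaves the deterministic argument
`Typical.sum_nonneg`. -/

namespace EnvyFree

/-! ### Total correctness with a time bound -/

/-- Started in the state `s`, the program `p` halts within `T` steps in a state with property `Q`. -/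
def Runs (coins : ℕ → Bool) (p : Program) (s : State) (T : ℕ) (Q : State → Prop) : Prop :=
  ∃ t ≤ T, ∃ s', Exec coins p s t s' ∧ Q s'

section Rules

variable {coins : ℕ → Bool} {p p' : Program} {s : State} {T T' : ℕ} {Q R : State → Prop}

theorem Runs.mono (h : Runs coins p s T Q) (hT : T ≤ T') (hQ : ∀ s, Q s → R s) :
    Runs coins p s T' R := by
  obtain ⟨t, ht, s', he, hs⟩ := h
  exact ⟨t, ht.trans hT, s', he, hQ _ hs⟩

theorem Runs.skip (h : Q s) : Runs coins .skip s 1 Q := ⟨1, le_rfl, s, .skip s, h⟩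

theorem Runs.setNat {k : ℕ} {idx e : NExpr} (h : Q (s.writeNat k (idx.eval s) (e.eval s))) :
    Runs coins (.setNat k idx e) s 1 Q := ⟨1, le_rfl, _, .setNat k idx e s, h⟩

theorem Runs.setReal {k : ℕ} {idx : NExpr} {e : RExpr}
    (h : Q (s.writeReal k (idx.eval s) (e.eval s))) :
    Runs coins (.setReal k idx e) s 1 Q := ⟨1, le_rfl, _, .setReal k idx e s, h⟩

theorem Runs.toss {k : ℕ} {idx : NExpr}
    (h : Q { s.writeNat k (idx.eval s) (coins s.pos).toNat with pos := s.pos + 1 }) :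
    Runs coins (.toss k idx) s 1 Q := ⟨1, le_rfl, _, .toss k idx s, h⟩

theorem Runs.seq (h : Runs coins p s T R) (h' : ∀ s', R s' → Runs coins p' s' T' Q) :
    Runs coins (.seq p p') s (T + T') Q := by
  obtain ⟨t, ht, s', he, hs⟩ := h
  obtain ⟨t', ht', s'', he', hs'⟩ := h' s' hs
  exact ⟨t + t', by omega, s'', .seq he he', hs'⟩

theorem Runs.setNat_seq {k : ℕ} {idx e : NExpr}
    (h : Runs coins p (s.writeNat k (idx.eval s) (e.eval s)) T Q) :
    Runs coins (.seq (.setNat k idx e) p) s (1 + T) Q :=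
  Runs.seq (R := (· = s.writeNat k (idx.eval s) (e.eval s))) (Runs.setNat rfl)
    (by rintro _ rfl; exact h)

theorem Runs.setReal_seq {k : ℕ} {idx : NExpr} {e : RExpr}
    (h : Runs coins p (s.writeReal k (idx.eval s) (e.eval s)) T Q) :
    Runs coins (.seq (.setReal k idx e) p) s (1 + T) Q :=
  Runs.seq (R := (· = s.writeReal k (idx.eval s) (e.eval s))) (Runs.setReal rfl)
    (by rintro _ rfl; exact h)

theorem Runs.toss_seq {k : ℕ} {idx : NExpr}
    (h : Runs coins p { s.writeNat k (idx.eval s) (coins s.pos).toNat with pos := s.pos + 1 } T Q) :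
    Runs coins (.seq (.toss k idx) p) s (1 + T) Q :=
  Runs.seq (R := (· = { s.writeNat k (idx.eval s) (coins s.pos).toNat with pos := s.pos + 1 }))
    (Runs.toss rfl) (by rintro _ rfl; exact h)

theorem Runs.branch {c : Test} (h : c.Holds s → Runs coins p s T Q)
    (h' : ¬ c.Holds s → Runs coins p' s T Q) : Runs coins (.branch c p p') s (T + 1) Q := by
  by_cases hc : c.Holds s
  · obtain ⟨t, ht, s', he, hs⟩ := h hc
    exact ⟨t + 1, by omega, s', .branch_true hc he, hs⟩
  · obtain ⟨t, ht, s', he, hs⟩ := h' hc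
    exact ⟨t + 1, by omega, s', .branch_false hc he, hs⟩

/-- A loop with an invariant that depends on the number of rounds, of which there are `N`. -/
theorem Runs.loop {c : Test} (N : ℕ) (I : ℕ → State → Prop) (h0 : I 0 s)
    (hstep : ∀ n < N, ∀ s, I n s → c.Holds s ∧ Runs coins p s T (I (n + 1)))
    (hend : ∀ s, I N s → ¬ c.Holds s) : Runs coins (.loop c p) s (N * (T + 1) + 1) (I N) := by
  suffices H : ∀ d n s, n + d = N → I n s → Runs coins (.loop c p) s (d * (T + 1) + 1) (I N) from
    H N 0 s (by omega) h0
  intro d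
  induction d with
  | zero =>
    intro n s hn hI
    obtain rfl : n = N := by omega
    exact ⟨1, by omega, s, .loop_false (hend s hI), hI⟩
  | succ d ih =>
    intro n s hn hI
    obtain ⟨hc, t, ht, s', he, hs⟩ := hstep n (by omega) s hI
    obtain ⟨t', ht', s'', he', hs'⟩ := ih (n + 1) s' (by omega) hs
    exact ⟨t + t' + 1, by rw [Nat.succ_mul]; omega, s'', .loop_true hc he he', hs'⟩

end Rules

/-- The scalar variable stored in cell 0 of the `k`-th array of natural numbers. -/
def nvar (k : ℕ) : NExpr := .get k (.const 0)

/-- The scalar variable stored in cell 0 of the `k`-th array of real numbers. -/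
def rvar (k : ℕ) : RExpr := .get k (.const 0)

/-- Assignment to a scalar variable. -/
def assign (k : ℕ) (e : NExpr) : Program := .setNat k (.const 0) e

/-- Increment a scalar variable. -/
def incr (k : ℕ) : Program := assign k (.add (nvar k) (.const 1))

/-! ### The design of the queries -/

/-- The number with the binary digits `c p, …, c (p + n - 1)`. -/
def coinNum (c : ℕ → Bool) (p : ℕ) : ℕ → ℕ
  | 0 => 0
  | n + 1 => coinNum c p n + coinNum c p n + (c (p + n)).toNat

/-- The `r`-th item of the `b`-th block of `2 ^ j` consecutive items, or the first one of the block
if the `r`-th one does not exist. -/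
def blockItem (m j b r : ℕ) : ℕ :=
  if b * 2 ^ j + r < m then b * 2 ^ j + r else b * 2 ^ j

/-- The item picked from the `b`-th block. -/
def pick (m j : ℕ) (c : ℕ → Bool) (b : ℕ) : ℕ := blockItem m j b (coinNum c (b * j) j)

/-- The number of blocks. -/
def numBlocks (m j : ℕ) : ℕ := (m + 2 ^ j - 1) / 2 ^ j

theorem lt_numBlocks {m j b : ℕ} : b < numBlocks m j ↔ b * 2 ^ j < m := by
  have h : 0 < 2 ^ j := by positivity
  unfold numBlocks
  rw [Nat.lt_iff_add_one_le, Nat.le_div_iff_mul_le h, add_mul]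
  omega

theorem pick_lt {m j b : ℕ} (c : ℕ → Bool) (hb : b < numBlocks m j) : pick m j c b < m := by
  have := lt_numBlocks.1 hb
  unfold pick blockItem
  split_ifs <;> assumption

/-- The fourth power of `Δ`. -/
def gapPow : RExpr := .mul (.mul (rvar 0) (rvar 0)) (.mul (rvar 0) (rvar 0))

/-- The cube of the number of items times the square of its binary length. -/
def sizeExpr : RExpr :=
  .mul (.mul (.ofNat (nvar 0)) (.mul (.ofNat (nvar 0)) (.ofNat (nvar 0))))
    (.mul (.ofNat (nvar 4)) (.ofNat (nvar 4)))

/-- Compute the binary length of the number of items. -/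
def lengthLoop : Program :=
  .loop (.neg (.natLt (nvar 0) (nvar 3))) (.seq (assign 3 (.add (nvar 3) (nvar 3))) (incr 4))

/-- Compute the number of repetitions. -/
def repeatLoop : Program :=
  .loop (.realLt (.mul (.mul (.ofNat (nvar 5)) (.ofNat (nvar 5))) gapPow) sizeExpr) (incr 5)

/-- Compute the size of the blocks. -/
def blockSizeLoop : Program :=
  .loop (.neg (.realLt gapPow (.mul (.mul (.ofNat (.add (nvar 6) (nvar 6)))
      (.ofNat (.add (nvar 6) (nvar 6)))) sizeExpr)))
    (.seq (assign 6 (.add (nvar 6) (nvar 6))) (incr 7))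

/-- Toss the coins for a block. -/
def tossLoop : Program :=
  .loop (.natLt (nvar 10) (nvar 7))
    (.seq (.toss 11 (.const 0))
      (.seq (assign 9 (.add (.add (nvar 9) (nvar 9)) (nvar 11))) (incr 10)))

/-- Append the queries of an item to the list. -/
def appendLoop : Program :=
  .loop (.natLt (nvar 10) (.add (nvar 5) (nvar 5)))
    (.seq (.setNat 2 (nvar 1) (nvar 12)) (.seq (incr 1) (incr 10)))

/-- Treat one block. -/
def blockBody : Program :=
  .seq (assign 9 (.const 0)) <| .seq (assign 10 (.const 0)) <| .seq tossLoop <|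
    .seq (.branch (.natLt (.add (nvar 8) (nvar 9)) (nvar 0))
      (assign 12 (.add (nvar 8) (nvar 9))) (assign 12 (nvar 8))) <|
    .seq (assign 10 (.const 0)) <| .seq appendLoop <| assign 8 (.add (nvar 8) (nvar 6))

/-- The program that fixes the queries. -/
def designProgram : Program :=
  .seq (assign 3 (.const 1)) <| .seq lengthLoop <| .seq repeatLoop <|
    .seq (assign 6 (.const 1)) <| .seq blockSizeLoop <| .loop (.natLt (nvar 8) (nvar 0)) blockBody

/-- The values of the scalar variables of `designProgram`. -/
structure DesignVars (m : ℕ) (Δ : ℝ) (len pw ℓ q B j base pos : ℕ) (s : State) : Prop where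
  m : s.nat 0 0 = m
  Δ : s.real 0 0 = Δ
  len : s.nat 1 0 = len
  pw : s.nat 3 0 = pw
  ℓ : s.nat 4 0 = ℓ
  q : s.nat 5 0 = q
  B : s.nat 6 0 = B
  j : s.nat 7 0 = j
  base : s.nat 8 0 = base
  pos : s.pos = pos

/-! ### Correctness and running time of the loops that fix the queries. -/

theorem lengthLoop_runs {m : ℕ} {Δ : ℝ} {coins : ℕ → Bool} {s : State}
    (h : DesignVars m Δ 0 1 0 0 0 0 0 0 s) :
    Runs coins lengthLoop s (m.size * 3 + 1)
      (DesignVars m Δ 0 (2 ^ m.size) m.size 0 0 0 0 0) := by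
  refine Runs.loop m.size (fun n ↦ DesignVars m Δ 0 (2 ^ n) n 0 0 0 0 0) (by simpa using h) ?_ ?_
  · intro n hn s hs
    have := Nat.lt_size.1 hn
    refine ⟨by simpa [Test.Holds, NExpr.eval, nvar, hs.m, hs.pw] using this, ?_⟩
    refine Runs.setNat_seq (Runs.setNat ?_)
    constructor <;> simp [State.writeNat, NExpr.eval, nvar, hs.m, hs.Δ, hs.len, hs.pw, hs.ℓ, hs.q,
      hs.B, hs.j, hs.base, hs.pos, pow_succ, mul_two]
  · intro s hs
    simpa [Test.Holds, NExpr.eval, nvar, hs.m, hs.pw] using Nat.lt_size_self m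

/-- Since no roots are available, squares are compared: the loop stops at the least q with q ≥
m^{3/2} ℓ / Δ². -/
theorem repeatLoop_runs {m pw ℓ : ℕ} {Δ : ℝ} {coins : ℕ → Bool} {s : State} (q : ℕ)
    (hlt : ∀ n < q, ((n : ℝ) * n) * ((Δ * Δ) * (Δ * Δ)) < (m * (m * m)) * (ℓ * ℓ))
    (hge : ¬ ((q : ℝ) * q) * ((Δ * Δ) * (Δ * Δ)) < (m * (m * m)) * (ℓ * ℓ))
    (h : DesignVars m Δ 0 pw ℓ 0 0 0 0 0 s) :
    Runs coins repeatLoop s (q * 2 + 1) (DesignVars m Δ 0 pw ℓ q 0 0 0 0) := by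
  refine Runs.loop q (fun n ↦ DesignVars m Δ 0 pw ℓ n 0 0 0 0) h ?_ ?_
  · intro n hn s hs
    refine ⟨by simpa [Test.Holds, NExpr.eval, RExpr.eval, nvar, rvar, gapPow, sizeExpr, hs.m, hs.q,
      hs.ℓ, hs.Δ] using hlt n hn, Runs.setNat ?_⟩
    constructor <;> simp [State.writeNat, NExpr.eval, nvar, hs.m, hs.Δ, hs.len, hs.pw, hs.ℓ, hs.q,
      hs.B, hs.j, hs.base, hs.pos]
  · intro s hs
    simpa [Test.Holds, NExpr.eval, RExpr.eval, nvar, rvar, gapPow, sizeExpr, hs.m, hs.q,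
      hs.ℓ, hs.Δ] using hge

/-- In squared form, j is the least number with 2^{j+1} m^{3/2} ℓ > Δ². Block sizes are powers of
two so that j fair coins give a uniform position in a block, without rejection. -/
theorem blockSizeLoop_runs {m pw ℓ q : ℕ} {Δ : ℝ} {coins : ℕ → Bool} {s : State} (j : ℕ)
    (hle : ∀ n < j, (2 ^ n + 2 ^ n) * ((2 : ℝ) ^ n + 2 ^ n) * ((m * (m * m)) * (ℓ * ℓ)) ≤
      (Δ * Δ) * (Δ * Δ))
    (hgt : (Δ * Δ) * (Δ * Δ) < (2 ^ j + 2 ^ j) * ((2 : ℝ) ^ j + 2 ^ j) * ((m * (m * m)) * (ℓ * ℓ)))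
    (h : DesignVars m Δ 0 pw ℓ q 1 0 0 0 s) :
    Runs coins blockSizeLoop s (j * 3 + 1) (DesignVars m Δ 0 pw ℓ q (2 ^ j) j 0 0) := by
  refine Runs.loop j (fun n ↦ DesignVars m Δ 0 pw ℓ q (2 ^ n) n 0 0) (by simpa using h) ?_ ?_
  · intro n hn s hs
    refine ⟨by simpa [Test.Holds, NExpr.eval, RExpr.eval, nvar, rvar, gapPow, sizeExpr, hs.m, hs.q,
      hs.ℓ, hs.Δ, hs.B] using hle n hn, Runs.setNat_seq (Runs.setNat ?_)⟩
    constructor <;> simp [State.writeNat, NExpr.eval, nvar, hs.m, hs.Δ, hs.len, hs.pw, hs.ℓ, hs.q,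
      hs.B, hs.j, hs.base, hs.pos, pow_succ, mul_two]
  · intro s hs
    simpa [Test.Holds, NExpr.eval, RExpr.eval, nvar, rvar, gapPow, sizeExpr, hs.m, hs.q,
      hs.ℓ, hs.Δ, hs.B] using hgt

theorem tossLoop_runs {m len pw ℓ q B j base pos : ℕ} {Δ : ℝ} {coins : ℕ → Bool} {f : ℕ → ℕ}
    {s : State} (h : DesignVars m Δ len pw ℓ q B j base pos s) (hf : s.nat 2 = f)
    (h9 : s.nat 9 0 = 0) (h10 : s.nat 10 0 = 0) :
    Runs coins tossLoop s (j * 4 + 1) fun s ↦ DesignVars m Δ len pw ℓ q B j base (pos + j) s ∧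
      s.nat 2 = f ∧ s.nat 9 0 = coinNum coins pos j := by
  refine (Runs.loop j (fun n s ↦ DesignVars m Δ len pw ℓ q B j base (pos + n) s ∧
      s.nat 2 = f ∧ s.nat 9 0 = coinNum coins pos n ∧ s.nat 10 0 = n)
      ⟨h, hf, h9, h10⟩ ?_ ?_).mono le_rfl fun s hs ↦ ⟨hs.1, hs.2.1, hs.2.2.1⟩
  · rintro n hn s ⟨hs, hf, h9, h10⟩
    refine ⟨by simpa [Test.Holds, NExpr.eval, nvar, hs.j, h10] using hn,
      Runs.toss_seq (Runs.setNat_seq (Runs.setNat ?_))⟩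
    refine ⟨?_, ?_⟩
    · constructor <;> simp [State.writeNat, NExpr.eval, nvar, hs.m, hs.Δ, hs.len, hs.pw, hs.ℓ, hs.q,
        hs.B, hs.j, hs.base, hs.pos, add_assoc]
    · simp [State.writeNat, NExpr.eval, nvar, hf, h9, h10, coinNum, hs.pos]
  · rintro s ⟨hs, hf, h9, h10⟩
    simp [Test.Holds, NExpr.eval, nvar, hs.j, h10]

theorem appendLoop_runs {m len pw ℓ q B j base pos item : ℕ} {Δ : ℝ} {coins : ℕ → Bool} {f : ℕ → ℕ}
    {s : State} (h : DesignVars m Δ len pw ℓ q B j base pos s)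
    (hf : ∀ l < len, s.nat 2 l = f l) (hitem : ∀ l < 2 * q, f (len + l) = item)
    (h10 : s.nat 10 0 = 0) (h12 : s.nat 12 0 = item) :
    Runs coins appendLoop s (2 * q * 4 + 1) fun s ↦
      DesignVars m Δ (len + 2 * q) pw ℓ q B j base pos s ∧ ∀ l < len + 2 * q, s.nat 2 l = f l := by
  refine (Runs.loop (2 * q) (fun n s ↦ DesignVars m Δ (len + n) pw ℓ q B j base pos s ∧
      (∀ l < len + n, s.nat 2 l = f l) ∧ s.nat 10 0 = n ∧ s.nat 12 0 = item)
      ⟨h, hf, h10, h12⟩ ?_ ?_).mono le_rfl fun s hs ↦ ⟨hs.1, hs.2.1⟩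
  · rintro n hn s ⟨hs, hf, h10, h12⟩
    refine ⟨?_, Runs.setNat_seq (Runs.setNat_seq (Runs.setNat ?_))⟩
    · simp only [Test.Holds, NExpr.eval, nvar, hs.q, h10]
      omega
    refine ⟨?_, ?_, ?_, ?_⟩
    · constructor <;> simp [State.writeNat, NExpr.eval, nvar, hs.m, hs.Δ, hs.len, hs.pw, hs.ℓ, hs.q,
        hs.B, hs.j, hs.base, hs.pos, add_assoc]
    · intro l hl
      simp only [State.writeNat, NExpr.eval, nvar, hs.len, h12]
      rcases Nat.lt_succ_iff_lt_or_eq.1 hl with hl | rfl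
      · have hl : l < len + n := hl
        simp [hl.ne, hf l hl]
      · simp [hitem n hn]
    · simp [State.writeNat, NExpr.eval, nvar, h10]
    · simp [State.writeNat, NExpr.eval, nvar, h12]
  · rintro s ⟨hs, hf, h10, h12⟩
    simp only [Test.Holds, NExpr.eval, nvar, hs.q, h10]
    omega

/-- Block b consumes exactly the coins b·j, …, (b+1)·j − 1, so different blocks use disjoint coins.
Its item is queried 2q times in a row, whence the index l / (2q). -/
theorem blockBody_runs {m pw ℓ q j b : ℕ} {Δ : ℝ} {coins : ℕ → Bool} {s : State} (hq : 0 < q)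
    (h : DesignVars m Δ (2 * q * b) pw ℓ q (2 ^ j) j (b * 2 ^ j) (b * j) s)
    (hf : ∀ l < 2 * q * b, s.nat 2 l = pick m j coins (l / (2 * q))) :
    Runs coins blockBody s (4 * j + 8 * q + 9) fun s ↦
      DesignVars m Δ (2 * q * (b + 1)) pw ℓ q (2 ^ j) j ((b + 1) * 2 ^ j) ((b + 1) * j) s ∧
      ∀ l < 2 * q * (b + 1), s.nat 2 l = pick m j coins (l / (2 * q)) := by
  suffices H : Runs coins blockBody s (1 + (1 + ((j * 4 + 1) + ((1 + 1) + (1 + ((2 * q * 4 + 1) +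
      1)))))) fun s ↦
      DesignVars m Δ (2 * q * (b + 1)) pw ℓ q (2 ^ j) j ((b + 1) * 2 ^ j) ((b + 1) * j) s ∧
      ∀ l < 2 * q * (b + 1), s.nat 2 l = pick m j coins (l / (2 * q)) from
    H.mono (by omega) fun _ h ↦ h
  refine Runs.setNat_seq (Runs.setNat_seq ?_)
  refine Runs.seq (tossLoop_runs (f := s.nat 2) (pos := b * j) (m := m) (Δ := Δ)
    (len := 2 * q * b) (pw := pw) (ℓ := ℓ) (q := q) (B := 2 ^ j) (base := b * 2 ^ j) ?_ ?_ ?_ ?_) ?_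
  · constructor <;> simp [State.writeNat, NExpr.eval, h.m, h.Δ, h.len, h.pw, h.ℓ, h.q,
        h.B, h.j, h.base, h.pos]
  · simp [State.writeNat, NExpr.eval]
  · simp [State.writeNat, NExpr.eval]
  · simp [State.writeNat, NExpr.eval]
  rintro s' ⟨h', hf', h9⟩
  rw [← hf'] at hf
  have hlen : 2 * q * (b + 1) = 2 * q * b + 2 * q := by ring
  have hpos : (b + 1) * j = b * j + j := by ring
  refine Runs.seq (R := fun s ↦ DesignVars m Δ (2 * q * b) pw ℓ q (2 ^ j) j (b * 2 ^ j)
      ((b + 1) * j) s ∧ (∀ l < 2 * q * b, s.nat 2 l = pick m j coins (l / (2 * q))) ∧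
      s.nat 12 0 = pick m j coins b) (Runs.branch ?_ ?_) ?_
  · intro hc
    refine Runs.setNat ⟨?_, ?_, ?_⟩
    · constructor <;> simp [State.writeNat, NExpr.eval, h'.m, h'.Δ, h'.len, h'.pw, h'.ℓ, h'.q,
        h'.B, h'.j, h'.base, h'.pos, hpos]
    · simpa [State.writeNat, NExpr.eval] using hf
    · simp only [Test.Holds, NExpr.eval, nvar, h'.base, h9, h'.m] at hc
      simp [State.writeNat, NExpr.eval, nvar, h'.base, h9, pick, blockItem, hc]
  · intro hc
    refine Runs.setNat ⟨?_, ?_, ?_⟩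
    · constructor <;> simp [State.writeNat, NExpr.eval, h'.m, h'.Δ, h'.len, h'.pw, h'.ℓ, h'.q,
        h'.B, h'.j, h'.base, h'.pos, hpos]
    · simpa [State.writeNat, NExpr.eval] using hf
    · simp only [Test.Holds, NExpr.eval, nvar, h'.base, h9, h'.m] at hc
      simp [State.writeNat, NExpr.eval, nvar, h'.base, pick, blockItem, hc]
  rintro s ⟨h, hf, h12⟩
  refine Runs.setNat_seq (Runs.seq (appendLoop_runs (item := pick m j coins b)
    (m := m) (Δ := Δ) (len := 2 * q * b) (pw := pw) (ℓ := ℓ) (q := q) (B := 2 ^ j)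
    (base := b * 2 ^ j) (j := j) (pos := (b + 1) * j)
    (f := fun l ↦ pick m j coins (l / (2 * q))) ?_ ?_ ?_ ?_ ?_) ?_)
  · constructor <;> simp [State.writeNat, NExpr.eval, h.m, h.Δ, h.len, h.pw, h.ℓ, h.q,
        h.B, h.j, h.base, h.pos]
  · simpa [State.writeNat, NExpr.eval] using hf
  · intro l hl
    rw [Nat.mul_add_div (by omega), Nat.div_eq_of_lt hl, add_zero]
  · simp [State.writeNat, NExpr.eval]
  · simpa [State.writeNat, NExpr.eval] using h12
  rintro s ⟨h, hf⟩
  refine Runs.setNat ⟨?_, ?_⟩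
  · constructor <;> simp [State.writeNat, NExpr.eval, nvar, h.m, h.Δ, h.len, h.pw, h.ℓ, h.q,
        h.B, h.j, h.base, h.pos]
    · ring
    · ring
  · rw [hlen]
    simpa [State.writeNat, NExpr.eval] using hf

theorem designProgram_runs {m : ℕ} {Δ : ℝ} {coins : ℕ → Bool} (q j : ℕ) (hq : 0 < q)
    (hlt : ∀ n < q, ((n : ℝ) * n) * ((Δ * Δ) * (Δ * Δ)) < (m * (m * m)) * (m.size * m.size))
    (hge : ¬ ((q : ℝ) * q) * ((Δ * Δ) * (Δ * Δ)) < (m * (m * m)) * (m.size * m.size))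
    (hle : ∀ n < j, (2 ^ n + 2 ^ n) * ((2 : ℝ) ^ n + 2 ^ n) * ((m * (m * m)) * (m.size * m.size)) ≤
      (Δ * Δ) * (Δ * Δ))
    (hgt : (Δ * Δ) * (Δ * Δ) <
      (2 ^ j + 2 ^ j) * ((2 : ℝ) ^ j + 2 ^ j) * ((m * (m * m)) * (m.size * m.size))) :
    Runs coins designProgram (designInput m Δ)
      (m.size * 3 + q * 2 + j * 3 + 6 + numBlocks m j * (4 * j + 8 * q + 10)) fun s ↦
        s.nat 1 0 = 2 * q * numBlocks m j ∧
        ∀ l < 2 * q * numBlocks m j, s.nat 2 l = pick m j coins (l / (2 * q)) := by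
  suffices H : Runs coins designProgram (designInput m Δ) (1 + ((m.size * 3 + 1) + ((q * 2 + 1) +
      (1 + ((j * 3 + 1) + (numBlocks m j * (4 * j + 8 * q + 9 + 1) + 1)))))) fun s ↦
        s.nat 1 0 = 2 * q * numBlocks m j ∧
        ∀ l < 2 * q * numBlocks m j, s.nat 2 l = pick m j coins (l / (2 * q)) from
    H.mono (le_of_eq (by ring)) fun _ h ↦ h
  refine Runs.setNat_seq (Runs.seq (lengthLoop_runs (m := m) (Δ := Δ) ?_) fun s h ↦
    Runs.seq (repeatLoop_runs q hlt hge h) fun s h ↦ Runs.setNat_seq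
    (Runs.seq (blockSizeLoop_runs (m := m) (Δ := Δ) (pw := 2 ^ m.size) (ℓ := m.size) (q := q)
      j hle hgt ?_) fun s h ↦ ?_))
  · constructor <;> simp [State.writeNat, NExpr.eval, designInput]
  · constructor <;> simp [State.writeNat, NExpr.eval, h.m, h.Δ, h.len, h.pw, h.ℓ, h.q,
        h.j, h.base, h.pos]
  refine (Runs.loop (numBlocks m j) (fun b s ↦
    DesignVars m Δ (2 * q * b) (2 ^ m.size) m.size q (2 ^ j) j (b * 2 ^ j) (b * j) s ∧
      ∀ l < 2 * q * b, s.nat 2 l = pick m j coins (l / (2 * q))) ⟨by simpa using h, by simp⟩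
      ?_ ?_).mono le_rfl fun s hs ↦ ⟨hs.1.len, hs.2⟩
  · rintro b hb s ⟨hs, hf⟩
    exact ⟨by simpa [Test.Holds, NExpr.eval, nvar, hs.m, hs.base] using lt_numBlocks.1 hb,
      blockBody_runs hq hs hf⟩
  · rintro s ⟨hs, hf⟩
    simpa [Test.Holds, NExpr.eval, nvar, hs.m, hs.base] using
      (lt_numBlocks (m := m) (j := j) (b := numBlocks m j)).not.1 (lt_irrefl _)

/-! ### Computing an allocation from the answers -/

/-- Add the current cell of the real array `l` to the scalar `k`, or subtract it. -/
def accumulate (k l : ℕ) (plus : Bool) : Program :=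
  .setReal k (.const 0) (bif plus then .add (rvar k) (.get l (nvar 10))
    else .sub (rvar k) (.get l (nvar 10)))

/-- Give every item to a random agent. -/
def randomLoop : Program :=
  .loop (.natLt (nvar 10) (nvar 0)) (.seq (.toss 3 (nvar 10)) (incr 10))

/-- Add the current answer of an agent, stored in the array `l`, to the array `k`. -/
def collect (k l : ℕ) : Program :=
  .setReal k (nvar 7) (.add (.get k (nvar 7)) (.get l (nvar 6)))

/-- Add up the answers in even and in odd positions for every item and agent. -/
def sumLoop : Program :=
  .loop (.natLt (nvar 6) (nvar 1)) <|
    .seq (.setNat 7 (.const 0) (.get 2 (nvar 6))) <| .seq (.setNat 4 (nvar 7) (.const 1)) <|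
    .seq (collect 2 0) <| .seq (collect 3 1) <| .seq (incr 6) <|
    .seq (collect 4 0) <| .seq (collect 5 1) <| incr 6

/-- The test that gives the current item to agent `a`. -/
def preferTest : Test :=
  .realLt (.mul (.ofNat (.sub (nvar 0) (nvar 11))) (.get 3 (nvar 10)))
    (.mul (.ofNat (nvar 11)) (.get 2 (nvar 10)))

/-- Compute a candidate allocation and its score. -/
def scoreLoop : Program :=
  .loop (.natLt (nvar 10) (nvar 0)) <|
    .seq (.branch (.natLt (nvar 10) (nvar 9)) (assign 11 (.add (nvar 8) (.const 1)))
      (assign 11 (nvar 8))) <|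
    .seq (.branch preferTest
      (.seq (.setNat 5 (nvar 10) (.const 1)) (.seq (accumulate 6 4 true) (accumulate 7 5 false)))
      (.seq (.setNat 5 (nvar 10) (.const 0)) (.seq (accumulate 6 4 false) (accumulate 7 5 true))))
    (incr 10)

/-- Copy the candidate allocation of the queried items to the output. -/
def copyLoop : Program :=
  .loop (.natLt (nvar 10) (nvar 0)) <|
    .seq (.branch (.natLt (.const 0) (.get 4 (nvar 10)))
      (.setNat 3 (nvar 10) (.get 5 (nvar 10))) .skip) (incr 10)

/-- Replace the best allocation so far if the current one is better. -/
def improve : Program :=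
  .branch (.and (.realLt (rvar 8) (rvar 6)) (.realLt (rvar 8) (rvar 7)))
    (.seq (.branch (.realLt (rvar 6) (rvar 7)) (.setReal 8 (.const 0) (rvar 6))
      (.setReal 8 (.const 0) (rvar 7))) <| .seq (assign 10 (.const 0)) copyLoop) .skip

/-- Treat one candidate allocation. -/
def candidateBody : Program :=
  .seq (assign 10 (.const 0)) <| .seq (.setReal 6 (.const 0) (.const 0)) <|
    .seq (.setReal 7 (.const 0) (.const 0)) <| .seq scoreLoop <| .seq improve (incr 9)

/-- Treat all candidates of one level. -/
def levelBody : Program :=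
  .seq (assign 9 (.const 0)) <| .seq (.loop (.natLt (nvar 9) (nvar 0)) candidateBody) (incr 8)

/-- The program that computes the allocation. -/
def allocateProgram : Program :=
  .seq randomLoop <| .seq sumLoop <|
    .loop (.natLt (nvar 8) (.add (nvar 0) (.const 1))) levelBody

/-- The sum of the answers (in even positions for `o = 0` and odd ones for `o = 1`) for an item. -/
noncomputable def groupSum (f : ℕ → ℕ) (y : ℕ → ℝ) (o n i : ℕ) : ℝ :=
  ∑ p ∈ Finset.range n, if f (2 * p) = i then y (2 * p + o) else 0

/-- The level of the item `i'` in the candidate number `i` of level `k`. -/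
def level (k i i' : ℕ) : ℕ := if i' < i then k + 1 else k

/-- Agent `a` gets the item `i'` in the candidate number `i` of level `k`. -/
def Prefers (m : ℕ) (xa xb : ℕ → ℝ) (k i i' : ℕ) : Prop :=
  ((m - level k i i' : ℕ) : ℝ) * xb i' < (level k i i' : ℕ) * xa i'

open Classical in
/-- The score of a candidate. -/
noncomputable def score (m : ℕ) (xa xb z : ℕ → ℝ) (k i : ℕ) : ℝ :=
  ∑ i' ∈ Finset.range m, if Prefers m xa xb k i i' then z i' else -z i'

/-- The memory of `allocateProgram` after the answers have been read. -/
structure AllocData (m : ℕ) (xa xb za zb : ℕ → ℝ) (qd : ℕ → ℕ) (s : State) : Prop where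
  m : s.nat 0 0 = m
  xa : s.real 2 = xa
  xb : s.real 3 = xb
  za : s.real 4 = za
  zb : s.real 5 = zb
  qd : s.nat 4 = qd

open Classical in
/-- Some candidate attains the best score `s.real 8 0` and has been copied to the output, or none
has a positive score and the output is random. -/
def IsBest (m : ℕ) (xa xb za zb : ℕ → ℝ) (qd coin : ℕ → ℕ) (best : ℝ) (out : ℕ → ℕ)
    (S : ℕ → ℕ → Prop) : Prop :=
  (∀ k i, S k i → min (score m xa xb za k i) (-score m xa xb zb k i) ≤ best) ∧
  ((best = 0 ∧ ∀ i' < m, out i' = coin i') ∨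
    ∃ k i, S k i ∧ best ≤ score m xa xb za k i ∧ best ≤ -score m xa xb zb k i ∧
      ∀ i' < m, out i' =
        if 0 < qd i' then (if Prefers m xa xb k i i' then 1 else 0) else coin i')

/-! ### Loop invariants of the program that computes the allocation. -/

variable {m : ℕ} {xa xb za zb : ℕ → ℝ} {qd coin : ℕ → ℕ} {coins : ℕ → Bool} {s : State}

theorem randomLoop_runs (hm : s.nat 0 0 = m) (h10 : s.nat 10 0 = 0) (hpos : s.pos = 0) :
    Runs coins randomLoop s (m * 3 + 1) fun s' ↦
      s'.nat 0 0 = m ∧ s'.nat 1 = s.nat 1 ∧ s'.nat 2 = s.nat 2 ∧ s'.nat 4 = s.nat 4 ∧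
      s'.nat 6 = s.nat 6 ∧ s'.nat 8 = s.nat 8 ∧ s'.real = s.real ∧
      ∀ i < m, s'.nat 3 i = (coins i).toNat := by
  refine (Runs.loop m (fun n s' ↦ s'.nat 0 0 = m ∧ s'.nat 1 = s.nat 1 ∧ s'.nat 2 = s.nat 2 ∧
      s'.nat 4 = s.nat 4 ∧ s'.nat 6 = s.nat 6 ∧ s'.nat 8 = s.nat 8 ∧ s'.real = s.real ∧
      (∀ i < n, s'.nat 3 i = (coins i).toNat) ∧ s'.nat 10 0 = n ∧ s'.pos = n) (by simp [hm, h10, hpos])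
      ?_ ?_).mono le_rfl (by tauto)
  · rintro n hn s' ⟨h0, h1, h2, h4, h6, h8, hr, h3, h10, hpos⟩
    refine ⟨by simpa [Test.Holds, NExpr.eval, nvar, h0, h10] using hn,
      Runs.toss_seq (Runs.setNat ?_)⟩
    refine ⟨?_, ?_, ?_, ?_, ?_, ?_, ?_, ?_, ?_, ?_⟩ <;>
      try simp [State.writeNat, NExpr.eval, nvar, h0, h1, h2, h4, h6, h8, hr, h10, hpos]
    intro i hi
    rcases Nat.le_iff_lt_or_eq.1 hi with hi | rfl
    · simp [hi.ne, h3 i hi]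
    · simp
  · rintro s' ⟨h0, h1, h2, h4, h6, h8, hr, h3, h10, hpos⟩
    simp [Test.Holds, NExpr.eval, nvar, h0, h10]

/-- A further pair of answers affects the sum of a single item, which is what one array write does.
-/
theorem groupSum_succ (f : ℕ → ℕ) (y : ℕ → ℝ) (o n : ℕ) :
    groupSum f y o (n + 1) = Function.update (groupSum f y o n) (f (2 * n))
      (groupSum f y o n (f (2 * n)) + y (2 * n + o)) := by
  funext i
  rcases eq_or_ne i (f (2 * n)) with rfl | h
  · simp [groupSum, Finset.sum_range_succ]
  · simp [groupSum, Finset.sum_range_succ, h, h.symm]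

theorem sumLoop_runs {N : ℕ} {f : ℕ → ℕ} {ya yb : ℕ → ℝ} (hm : s.nat 0 0 = m)
    (h1 : s.nat 1 0 = 2 * N) (hf : s.nat 2 = f) (hcoin : s.nat 3 = coin)
    (h4 : s.nat 4 = fun _ ↦ 0) (h6 : s.nat 6 0 = 0)
    (h8 : s.nat 8 0 = 0) (ha : s.real 0 = ya) (hb : s.real 1 = yb) (hxa : s.real 2 = fun _ ↦ 0)
    (hxb : s.real 3 = fun _ ↦ 0) (hza : s.real 4 = fun _ ↦ 0) (hzb : s.real 5 = fun _ ↦ 0)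
    (hr8 : s.real 8 0 = 0) :
    Runs coins sumLoop s (N * 9 + 1) fun s ↦
      AllocData m (groupSum f ya 0 N) (groupSum f yb 0 N) (groupSum f ya 1 N) (groupSum f yb 1 N)
        (fun i ↦ if ∃ p < N, f (2 * p) = i then 1 else 0) s ∧ s.nat 3 = coin ∧
      s.nat 8 0 = 0 ∧ s.real 8 0 = 0 := by
  have hg : ∀ f y o, groupSum f y o 0 = fun _ ↦ 0 := fun f y o ↦ by
    funext i
    simp [groupSum]
  refine (Runs.loop N (fun n s ↦ AllocData m (groupSum f ya 0 n) (groupSum f yb 0 n)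
      (groupSum f ya 1 n) (groupSum f yb 1 n)
      (fun i ↦ if ∃ p < n, f (2 * p) = i then 1 else 0) s ∧ s.nat 3 = coin ∧
      s.nat 8 0 = 0 ∧ s.real 8 0 = 0 ∧ s.nat 1 0 = 2 * N ∧ s.nat 2 = f ∧ s.nat 6 0 = 2 * n ∧
      s.real 0 = ya ∧ s.real 1 = yb) ?_ ?_ ?_).mono le_rfl (by tauto)
  · refine ⟨?_, hcoin, h8, hr8, h1, hf, h6, ha, hb⟩
    constructor <;> simp [*]
  · rintro n hn s ⟨h, hcoin, h8, hr8, h1, hf, h6, ha, hb⟩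
    refine ⟨?_, Runs.setNat_seq (Runs.setNat_seq (Runs.setReal_seq (Runs.setReal_seq
      (Runs.setNat_seq (Runs.setReal_seq (Runs.setReal_seq (Runs.setNat ?_)))))))⟩
    · simp only [Test.Holds, NExpr.eval, nvar, h6, h1]
      omega
    refine ⟨?_, ?_, ?_, ?_, ?_, ?_, ?_, ?_, ?_⟩
    · constructor
      · simp [State.writeNat, State.writeReal, NExpr.eval, RExpr.eval, nvar, h.m]
      · simp [State.writeNat, State.writeReal, NExpr.eval, RExpr.eval, nvar, h.xa, h6, hf, ha,
          groupSum_succ]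
      · simp [State.writeNat, State.writeReal, NExpr.eval, RExpr.eval, nvar, h.xb, h6, hf, hb,
          groupSum_succ]
      · simp [State.writeNat, State.writeReal, NExpr.eval, RExpr.eval, nvar, h.za, h6, hf, ha,
          groupSum_succ]
      · simp [State.writeNat, State.writeReal, NExpr.eval, RExpr.eval, nvar, h.zb, h6, hf, hb,
          groupSum_succ]
      · simp only [State.writeNat, State.writeReal, NExpr.eval, nvar]
        funext i
        simp only [h6, hf, Function.update_apply, h.qd, Nat.reduceEqDiff, if_true, if_false,
          Nat.lt_succ_iff_lt_or_eq]
        by_cases hi : i = f (2 * n)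
        · simpa [hi] using ⟨n, le_rfl, rfl⟩
        · have : (∃ p ≤ n, f (2 * p) = i) ↔ ∃ p < n, f (2 * p) = i := by
            refine ⟨?_, fun ⟨p, hp, he⟩ ↦ ⟨p, hp.le, he⟩⟩
            rintro ⟨p, hp, he⟩
            rcases hp.lt_or_eq with hp | rfl
            · exact ⟨p, hp, he⟩
            · exact absurd he.symm hi
          simp [hi, this]
    all_goals simp [State.writeNat, State.writeReal, NExpr.eval, nvar, *]
    ring
  · rintro s ⟨h, hcoin, h8, hr8, h1, hf, h6, ha, hb⟩
    simp [Test.Holds, NExpr.eval, nvar, h1, h6]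

-- The accumulators `real 6` and `real 7` estimate, up to the factor q, the advantages of `a` and of
-- `b`; an item given to `a` counts negatively for `b`, hence the minus sign in the second one.
open Classical in
theorem scoreLoop_runs {k i : ℕ} {best : ℝ} {out : ℕ → ℕ} (h : AllocData m xa xb za zb qd s)
    (h3 : s.nat 3 = out) (h8 : s.nat 8 0 = k) (h9 : s.nat 9 0 = i)
    (h10 : s.nat 10 0 = 0) (hr6 : s.real 6 0 = 0) (hr7 : s.real 7 0 = 0) (hr8 : s.real 8 0 = best) :
    Runs coins scoreLoop s (m * 8 + 1) fun s ↦ AllocData m xa xb za zb qd s ∧ s.nat 3 = out ∧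
      s.nat 8 0 = k ∧ s.nat 9 0 = i ∧ s.real 8 0 = best ∧
      (∀ i' < m, s.nat 5 i' = if Prefers m xa xb k i i' then 1 else 0) ∧
      s.real 6 0 = score m xa xb za k i ∧ s.real 7 0 = -score m xa xb zb k i := by
  refine (Runs.loop m (fun n s ↦ AllocData m xa xb za zb qd s ∧ s.nat 3 = out ∧
      s.nat 8 0 = k ∧ s.nat 9 0 = i ∧ s.real 8 0 = best ∧
      (∀ i' < n, s.nat 5 i' = if Prefers m xa xb k i i' then 1 else 0) ∧
      s.real 6 0 = (∑ i' ∈ Finset.range n, if Prefers m xa xb k i i' then za i' else -za i') ∧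
      s.real 7 0 = -(∑ i' ∈ Finset.range n, if Prefers m xa xb k i i' then zb i' else -zb i') ∧
      s.nat 10 0 = n) ?_ ?_ ?_).mono le_rfl (by tauto)
  · exact ⟨h, h3, h8, h9, hr8, by simp, by simpa using hr6, by simpa using hr7, h10⟩
  · rintro n hn s ⟨h, h3, h8, h9, hr8, h5, hr6, hr7, h10⟩
    refine ⟨by simpa [Test.Holds, NExpr.eval, nvar, h.m, h10] using hn, ?_⟩
    suffices H : Runs coins (.seq (.branch (.natLt (nvar 10) (nvar 9))
        (assign 11 (.add (nvar 8) (.const 1))) (assign 11 (nvar 8))) <|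
        .seq (.branch preferTest
        (.seq (.setNat 5 (nvar 10) (.const 1)) (.seq (accumulate 6 4 true) (accumulate 7 5 false)))
        (.seq (.setNat 5 (nvar 10) (.const 0)) (.seq (accumulate 6 4 false) (accumulate 7 5 true))))
        (incr 10)) s ((1 + 1) + (((1 + (1 + 1)) + 1) + 1)) _ from H
    refine Runs.seq (R := fun s ↦ AllocData m xa xb za zb qd s ∧ s.nat 3 = out ∧
      s.nat 8 0 = k ∧ s.nat 9 0 = i ∧ s.real 8 0 = best ∧
      (∀ i' < n, s.nat 5 i' = if Prefers m xa xb k i i' then 1 else 0) ∧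
      s.real 6 0 = (∑ i' ∈ Finset.range n, if Prefers m xa xb k i i' then za i' else -za i') ∧
      s.real 7 0 = -(∑ i' ∈ Finset.range n, if Prefers m xa xb k i i' then zb i' else -zb i') ∧
      s.nat 10 0 = n ∧ s.nat 11 0 = level k i n) (Runs.branch ?_ ?_) ?_
    · intro hc
      simp only [Test.Holds, NExpr.eval, nvar, h9, h10] at hc
      refine Runs.setNat ⟨?_, ?_⟩
      · constructor <;> simp [State.writeNat, NExpr.eval, nvar, h.m, h.xa, h.xb, h.za, h.zb, h.qd]
      · simp only [State.writeNat, NExpr.eval, nvar]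
        simpa [level, hc, h3, h8, h9, h10, hr6, hr7, hr8] using h5
    · intro hc
      simp only [Test.Holds, NExpr.eval, nvar, h9, h10] at hc
      refine Runs.setNat ⟨?_, ?_⟩
      · constructor <;> simp [State.writeNat, NExpr.eval, nvar, h.m, h.xa, h.xb, h.za, h.zb, h.qd]
      · simp only [State.writeNat, NExpr.eval, nvar]
        simpa [level, hc, h3, h8, h9, h10, hr6, hr7, hr8] using h5
    rintro s ⟨h, h3, h8, h9, hr8, h5, hr6, hr7, h10, h11⟩
    have htest : preferTest.Holds s ↔ Prefers m xa xb k i n := by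
      simp [preferTest, Test.Holds, RExpr.eval, NExpr.eval, nvar, h.m, h10, h11, h.xa, h.xb,
        Prefers]
    refine Runs.seq (R := fun s ↦ AllocData m xa xb za zb qd s ∧ s.nat 3 = out ∧
      s.nat 8 0 = k ∧ s.nat 9 0 = i ∧ s.real 8 0 = best ∧
      (∀ i' < n + 1, s.nat 5 i' = if Prefers m xa xb k i i' then 1 else 0) ∧
      s.real 6 0 = (∑ i' ∈ Finset.range (n + 1), if Prefers m xa xb k i i' then za i' else -za i') ∧
      s.real 7 0 =
        -(∑ i' ∈ Finset.range (n + 1), if Prefers m xa xb k i i' then zb i' else -zb i') ∧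
      s.nat 10 0 = n) (Runs.branch ?_ ?_) ?_
    · intro hc
      rw [htest] at hc
      refine Runs.setNat_seq (Runs.setReal_seq (Runs.setReal ⟨?_, ?_, ?_, ?_, ?_, ?_, ?_, ?_, ?_⟩))
      · constructor <;> simp [State.writeNat, State.writeReal, NExpr.eval, RExpr.eval, nvar, h.m,
          h.xa, h.xb, h.za, h.zb, h.qd]
      · simpa [State.writeNat, State.writeReal] using h3
      · simpa [State.writeNat, State.writeReal] using h8
      · simpa [State.writeNat, State.writeReal] using h9
      · simpa [State.writeNat, State.writeReal, NExpr.eval] using hr8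
      · intro i' hi'
        simp only [State.writeNat, State.writeReal, NExpr.eval, nvar, h10]
        rcases Nat.lt_succ_iff_lt_or_eq.1 hi' with hi' | rfl
        · have hi' : i' < n := hi'
          simp [hi'.ne, h5 i' hi']
        · simp [hc]
      · simp [State.writeNat, State.writeReal, NExpr.eval, RExpr.eval, nvar, rvar, h10, hr6, h.za,
          Finset.sum_range_succ, hc]
      · simp [State.writeNat, State.writeReal, NExpr.eval, RExpr.eval, nvar, rvar, h10, hr7, h.zb,
          Finset.sum_range_succ, hc]
        ring
      · simpa [State.writeNat, State.writeReal] using h10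
    · intro hc
      rw [htest] at hc
      refine Runs.setNat_seq (Runs.setReal_seq (Runs.setReal ⟨?_, ?_, ?_, ?_, ?_, ?_, ?_, ?_, ?_⟩))
      · constructor <;> simp [State.writeNat, State.writeReal, NExpr.eval, RExpr.eval, nvar, h.m,
          h.xa, h.xb, h.za, h.zb, h.qd]
      · simpa [State.writeNat, State.writeReal] using h3
      · simpa [State.writeNat, State.writeReal] using h8
      · simpa [State.writeNat, State.writeReal] using h9
      · simpa [State.writeNat, State.writeReal, NExpr.eval] using hr8
      · intro i' hi'
        simp only [State.writeNat, State.writeReal, NExpr.eval, nvar, h10]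
        rcases Nat.lt_succ_iff_lt_or_eq.1 hi' with hi' | rfl
        · have hi' : i' < n := hi'
          simp [hi'.ne, h5 i' hi']
        · simp [hc]
      · simp [State.writeNat, State.writeReal, NExpr.eval, RExpr.eval, nvar, rvar, h10, hr6, h.za,
          Finset.sum_range_succ, hc]
        ring
      · simp [State.writeNat, State.writeReal, NExpr.eval, RExpr.eval, nvar, rvar, h10, hr7, h.zb,
          Finset.sum_range_succ, hc]
        ring
      · simpa [State.writeNat, State.writeReal] using h10
    rintro s ⟨h, h3, h8, h9, hr8, h5, hr6, hr7, h10⟩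
    refine Runs.setNat ⟨?_, ?_⟩
    · constructor <;> simp [State.writeNat, NExpr.eval, nvar, h.m, h.xa, h.xb, h.za, h.zb, h.qd]
    · simp only [State.writeNat, NExpr.eval, nvar]
      simpa [h3, h8, h9, h10, hr6, hr7, hr8] using h5
  · rintro s ⟨h, -, -, -, -, -, -, -, h10⟩
    simp [Test.Holds, NExpr.eval, nvar, h.m, h10]

theorem copyLoop_runs {k i : ℕ} {best : ℝ} {out cand : ℕ → ℕ} (h : AllocData m xa xb za zb qd s)
    (h3 : s.nat 3 = out) (h5 : s.nat 5 = cand) (h8 : s.nat 8 0 = k) (h9 : s.nat 9 0 = i)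
    (h10 : s.nat 10 0 = 0) (hr8 : s.real 8 0 = best) :
    Runs coins copyLoop s (m * 4 + 1) fun s ↦ AllocData m xa xb za zb qd s ∧
      (∀ i' < m, s.nat 3 i' = if 0 < qd i' then cand i' else out i') ∧
      s.nat 8 0 = k ∧ s.nat 9 0 = i ∧ s.real 8 0 = best := by
  refine (Runs.loop m (fun n s ↦ AllocData m xa xb za zb qd s ∧
      (∀ i', s.nat 3 i' = if 0 < qd i' ∧ i' < n then cand i' else out i') ∧
      s.nat 8 0 = k ∧ s.nat 9 0 = i ∧ s.real 8 0 = best ∧ s.nat 5 = cand ∧ s.nat 10 0 = n)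
      ⟨h, by simp [h3], h8, h9, hr8, h5, h10⟩ ?_ ?_).mono le_rfl ?_
  · rintro n hn s ⟨h, h3, h8, h9, hr8, h5, h10⟩
    refine ⟨by simpa [Test.Holds, NExpr.eval, nvar, h.m, h10] using hn, ?_⟩
    refine Runs.seq (R := fun s ↦ AllocData m xa xb za zb qd s ∧
      (∀ i', s.nat 3 i' = if 0 < qd i' ∧ i' < n + 1 then cand i' else out i') ∧
      s.nat 8 0 = k ∧ s.nat 9 0 = i ∧ s.real 8 0 = best ∧ s.nat 5 = cand ∧ s.nat 10 0 = n)
      (Runs.branch (T := 1) ?_ ?_) (T' := 1) ?_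
    · intro hc
      simp only [Test.Holds, NExpr.eval, nvar, h10, h.qd] at hc
      refine Runs.setNat ⟨?_, ?_, ?_⟩
      · constructor <;> simp [State.writeNat, NExpr.eval, nvar, h.m, h.xa, h.xb, h.za, h.zb, h.qd]
      · intro i'
        simp only [State.writeNat, NExpr.eval, nvar, h10, h5]
        rcases eq_or_ne i' n with rfl | hne
        · simp [hc]
        · simp [hne, h3, Nat.le_iff_lt_or_eq]
      · simp [State.writeNat, *]
    · intro hc
      simp only [Test.Holds, NExpr.eval, nvar, h10, h.qd] at hc
      refine Runs.skip ⟨h, ?_, h8, h9, hr8, h5, h10⟩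
      intro i'
      rcases eq_or_ne i' n with rfl | hne
      · simp [hc, h3]
      · simp [hne, h3, Nat.le_iff_lt_or_eq]
    · rintro s ⟨h, h3, h8, h9, hr8, h5, h10⟩
      refine Runs.setNat ⟨?_, ?_, ?_⟩
      · constructor <;> simp [State.writeNat, NExpr.eval, nvar, h.m, h.xa, h.xb, h.za, h.zb, h.qd]
      · simpa [State.writeNat, NExpr.eval] using h3
      · simp [State.writeNat, NExpr.eval, nvar, *]
  · rintro s ⟨h, -, -, -, -, -, h10⟩
    simp [Test.Holds, NExpr.eval, nvar, h.m, h10]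
  · rintro s ⟨h, h3, h8, h9, hr8, h5, h10⟩
    refine ⟨h, fun i' hi' ↦ by simp [h3, hi'], h8, h9, hr8⟩

/-- Overwriting happens only if both scores exceed the best value, and then the smaller score
becomes the best value; so it always dominates the minimum of the scores of every candidate seen.
Copying rewrites all queried items at once and leaves the coin tosses of the others intact. -/
theorem candidateBody_runs {k i : ℕ} {S : ℕ → ℕ → Prop}
    (h : AllocData m xa xb za zb qd s) (h8 : s.nat 8 0 = k) (h9 : s.nat 9 0 = i)
    (hbest : IsBest m xa xb za zb qd coin (s.real 8 0) (s.nat 3) S) :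
    Runs coins candidateBody s (m * 12 + 10) fun s ↦
      AllocData m xa xb za zb qd s ∧ s.nat 8 0 = k ∧ s.nat 9 0 = i + 1 ∧
      IsBest m xa xb za zb qd coin (s.real 8 0) (s.nat 3)
        (fun k' i' ↦ S k' i' ∨ k' = k ∧ i' = i) := by
  classical
  suffices H : Runs coins candidateBody s (1 + (1 + (1 + ((m * 8 + 1) +
      ((((1 + 1) + (1 + (m * 4 + 1))) + 1) + 1))))) _ from H.mono (le_of_eq (by ring)) fun _ h ↦ h
  refine Runs.setNat_seq (Runs.setReal_seq (Runs.setReal_seq (Runs.seq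
    (scoreLoop_runs (k := k) (i := i) (m := m) (xa := xa) (xb := xb) (za := za) (zb := zb)
      (qd := qd) ?_ rfl ?_ ?_ ?_ ?_ ?_ rfl) ?_)))
  · constructor <;> simp [State.writeNat, State.writeReal, NExpr.eval, h.m, h.xa,
      h.xb, h.za, h.zb, h.qd]
  · simpa [State.writeNat, State.writeReal, NExpr.eval] using h8
  · simpa [State.writeNat, State.writeReal, NExpr.eval] using h9
  · simp [State.writeNat, State.writeReal, NExpr.eval]
  · simp [State.writeNat, State.writeReal, NExpr.eval, RExpr.eval]
  · simp [State.writeNat, State.writeReal, NExpr.eval, RExpr.eval]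
  simp only [State.writeNat, State.writeReal, NExpr.eval]
  rintro s' ⟨h, h3, h8, h9, hr8, h5, hr6, hr7⟩
  simp only [Function.update_apply, Nat.reduceEqDiff, if_false] at h3 hr8
  rw [← h3, ← hr8] at hbest
  clear h3 hr8
  refine Runs.seq (R := fun s ↦ AllocData m xa xb za zb qd s ∧ s.nat 8 0 = k ∧ s.nat 9 0 = i ∧
      IsBest m xa xb za zb qd coin (s.real 8 0) (s.nat 3)
        (fun k' i' ↦ S k' i' ∨ k' = k ∧ i' = i)) (Runs.branch ?_ ?_) ?_
  · intro hc
    simp only [Test.Holds, RExpr.eval, NExpr.eval, rvar, hr6, hr7] at hc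
    refine Runs.seq (R := fun s'' ↦ AllocData m xa xb za zb qd s'' ∧ s''.nat 3 = s'.nat 3 ∧
      s''.nat 5 = s'.nat 5 ∧ s''.nat 8 0 = k ∧ s''.nat 9 0 = i ∧
      s''.real 8 0 = min (score m xa xb za k i) (-score m xa xb zb k i)) (Runs.branch ?_ ?_) ?_
    · intro hc'
      simp only [Test.Holds, RExpr.eval, NExpr.eval, rvar, hr6, hr7] at hc'
      refine Runs.setReal ⟨?_, ?_⟩
      · constructor <;> simp [State.writeReal, h.m, h.xa, h.xb, h.za, h.zb, h.qd]
      · simp [State.writeReal, rvar, RExpr.eval, NExpr.eval, h8, h9, hr6, hc'.le]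
    · intro hc'
      simp only [Test.Holds, RExpr.eval, NExpr.eval, rvar, hr6, hr7, not_lt] at hc'
      refine Runs.setReal ⟨?_, ?_⟩
      · constructor <;> simp [State.writeReal, h.m, h.xa, h.xb, h.za, h.zb, h.qd]
      · simp [State.writeReal, rvar, RExpr.eval, NExpr.eval, h8, h9, hr7, hc']
    rintro s ⟨h, h3, h5', h8, h9, hr8⟩
    refine Runs.setNat_seq ((copyLoop_runs (m := m) (xa := xa) (xb := xb) (za := za) (zb := zb)
      (qd := qd) (k := k) (i := i) ?_ rfl rfl ?_ ?_ ?_ rfl).mono le_rfl ?_)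
    · constructor <;> simp [State.writeNat, NExpr.eval, h.m, h.xa, h.xb, h.za, h.zb, h.qd]
    · simpa [State.writeNat, NExpr.eval] using h8
    · simpa [State.writeNat, NExpr.eval] using h9
    · simp [State.writeNat, NExpr.eval]
    simp only [State.writeNat, NExpr.eval]
    rintro s'' ⟨h, h3'', h8, h9, hr8''⟩
    simp only [Function.update_apply, Nat.reduceEqDiff, if_false, h3, h5'] at h3''
    refine ⟨h, h8, h9, ?_, Or.inr ⟨k, i, Or.inr ⟨rfl, rfl⟩, ?_, ?_, ?_⟩⟩
    · rintro k' i' (hS | ⟨rfl, rfl⟩)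
      · rw [hr8'', hr8]
        exact (hbest.1 k' i' hS).trans (le_min hc.1.le hc.2.le)
      · rw [hr8'', hr8]
    · rw [hr8'', hr8]
      exact min_le_left _ _
    · rw [hr8'', hr8]
      exact min_le_right _ _
    · intro i' hi'
      rw [h3'' i' hi']
      by_cases hq : 0 < qd i'
      · simp [hq, h5 i' hi']
      · simp only [hq, if_false]
        rcases hbest.2 with h' | ⟨_, _, _, _, _, h'⟩
        · exact h'.2 i' hi'
        · simpa [hq] using h' i' hi'
  · intro hc
    simp only [Test.Holds, RExpr.eval, NExpr.eval, rvar, hr6, hr7] at hc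
    refine (Runs.skip (Q := fun t ↦ t = s') rfl).mono (by omega) ?_
    rintro s rfl
    refine ⟨h, h8, h9, ?_, ?_⟩
    · rintro k' i' (hS | ⟨rfl, rfl⟩)
      · exact hbest.1 k' i' hS
      · by_contra hlt
        rw [not_le, lt_min_iff] at hlt
        exact hc hlt
    · rcases hbest.2 with h' | ⟨k', i', hS, h'⟩
      · exact Or.inl h'
      · exact Or.inr ⟨k', i', Or.inl hS, h'⟩
  · rintro s ⟨h, h8, h9, hb⟩
    refine Runs.setNat ⟨?_, ?_, ?_, ?_⟩
    · constructor <;> simp [State.writeNat, NExpr.eval, nvar, h.m, h.xa, h.xb, h.za, h.zb, h.qd]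
    · simpa [State.writeNat, NExpr.eval] using h8
    · simp [State.writeNat, NExpr.eval, nvar, h9]
    · simpa [State.writeNat, NExpr.eval] using hb

theorem IsBest.congr {best : ℝ} {out : ℕ → ℕ} {S S' : ℕ → ℕ → Prop}
    (h : IsBest m xa xb za zb qd coin best out S) (hS : ∀ k i, S k i ↔ S' k i) :
    IsBest m xa xb za zb qd coin best out S' := by
  obtain rfl : S = S' := by
    funext k i
    exact propext (hS k i)
  exact h

theorem levelBody_runs {k : ℕ} (h : AllocData m xa xb za zb qd s) (h8 : s.nat 8 0 = k)
    (hbest : IsBest m xa xb za zb qd coin (s.real 8 0) (s.nat 3) (fun k' i' ↦ k' < k ∧ i' < m)) :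
    Runs coins levelBody s (m * (m * 12 + 11) + 3) fun s ↦
      AllocData m xa xb za zb qd s ∧ s.nat 8 0 = k + 1 ∧
      IsBest m xa xb za zb qd coin (s.real 8 0) (s.nat 3) (fun k' i' ↦ k' < k + 1 ∧ i' < m) := by
  suffices H : Runs coins levelBody s (1 + ((m * ((m * 12 + 10) + 1) + 1) + 1)) _ from
    H.mono (le_of_eq (by ring)) fun _ h ↦ h
  refine Runs.setNat_seq (Runs.seq (Runs.loop m (fun n s ↦
    AllocData m xa xb za zb qd s ∧ s.nat 8 0 = k ∧ s.nat 9 0 = n ∧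
      IsBest m xa xb za zb qd coin (s.real 8 0) (s.nat 3)
        (fun k' i' ↦ (k' < k ∧ i' < m) ∨ k' = k ∧ i' < n)) ⟨?_, ?_, ?_, ?_⟩ ?_ ?_) ?_)
  · constructor <;> simp [State.writeNat, NExpr.eval, h.m, h.xa, h.xb, h.za, h.zb, h.qd]
  · simpa [State.writeNat, NExpr.eval] using h8
  · simp [State.writeNat, NExpr.eval]
  · simpa [State.writeNat, NExpr.eval] using hbest
  · rintro n hn s ⟨h, h8, h9, hb⟩
    refine ⟨by simpa [Test.Holds, NExpr.eval, nvar, h.m, h9] using hn,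
      (candidateBody_runs h h8 h9 hb).mono le_rfl ?_⟩
    rintro s ⟨h, h8, h9, hb⟩
    exact ⟨h, h8, h9, hb.congr fun k' i' ↦ by omega⟩
  · rintro s ⟨h, h8, h9, hb⟩
    simp [Test.Holds, NExpr.eval, nvar, h.m, h9]
  · rintro s ⟨h, h8, h9, hb⟩
    refine Runs.setNat ⟨?_, ?_, ?_⟩
    · constructor <;> simp [State.writeNat, NExpr.eval, nvar, h.m, h.xa, h.xb, h.za, h.zb, h.qd]
    · simp [State.writeNat, NExpr.eval, nvar, h8]
    · have := hb.congr (S' := fun k' i' ↦ k' < k + 1 ∧ i' < m) fun k' i' ↦ by omega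
      simpa [State.writeNat, NExpr.eval] using this

theorem allocateProgram_runs {N : ℕ} {f : ℕ → ℕ} {ya yb : ℕ → ℝ}
    (hm : s.nat 0 0 = m) (h1 : s.nat 1 0 = 2 * N) (hf : s.nat 2 = f)
    (hnat : ∀ k, 3 ≤ k → s.nat k = fun _ ↦ 0) (ha : s.real 0 = ya) (hb : s.real 1 = yb)
    (hreal : ∀ k, 2 ≤ k → s.real k = fun _ ↦ 0) (hpos : s.pos = 0) :
    Runs coins allocateProgram s (m * 3 + N * 9 + (m + 1) * (m * (m * 12 + 11) + 4) + 3) fun s ↦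
      ∃ best, IsBest m (groupSum f ya 0 N) (groupSum f yb 0 N) (groupSum f ya 1 N)
        (groupSum f yb 1 N) (fun i ↦ if ∃ p < N, f (2 * p) = i then 1 else 0)
        (fun i ↦ (coins i).toNat) best (s.nat 3) (fun k i ↦ k < m + 1 ∧ i < m) := by
  suffices H : Runs coins allocateProgram s ((m * 3 + 1) + ((N * 9 + 1) +
      ((m + 1) * ((m * (m * 12 + 11) + 3) + 1) + 1))) _ from
    H.mono (le_of_eq (by ring)) fun _ h ↦ h
  refine Runs.seq (randomLoop_runs hm (by simp [hnat]) hpos) ?_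
  rintro s' ⟨h0, h1', h2', h4', h6', h8', hr, h3⟩
  refine Runs.seq (sumLoop_runs (N := N) (f := f) (ya := ya) (yb := yb) h0 (by rw [h1', h1])
    (by rw [h2', hf]) rfl (by simp [h4', hnat]) (by simp [h6', hnat]) (by simp [h8', hnat])
    (by rw [hr, ha]) (by rw [hr, hb]) (by simp [hr, hreal]) (by simp [hr, hreal])
    (by simp [hr, hreal]) (by simp [hr, hreal]) (by simp [hr, hreal])) ?_
  rintro s'' ⟨h, h3', h8, hr8⟩
  refine (Runs.loop (m + 1) (fun k s ↦ AllocData m (groupSum f ya 0 N) (groupSum f yb 0 N)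
        (groupSum f ya 1 N) (groupSum f yb 1 N)
        (fun i ↦ if ∃ p < N, f (2 * p) = i then 1 else 0) s ∧ s.nat 8 0 = k ∧
      IsBest m (groupSum f ya 0 N) (groupSum f yb 0 N) (groupSum f ya 1 N)
        (groupSum f yb 1 N) (fun i ↦ if ∃ p < N, f (2 * p) = i then 1 else 0)
        (fun i ↦ (coins i).toNat) (s.real 8 0) (s.nat 3) (fun k' i' ↦ k' < k ∧ i' < m))
        ⟨h, h8, ?_⟩ ?_ ?_).mono le_rfl fun s hs ↦ ⟨_, hs.2.2⟩
  · refine ⟨by simp, Or.inl ⟨hr8, ?_⟩⟩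
    rw [h3']
    exact h3
  · rintro n hn s ⟨h, h8, hb⟩
    exact ⟨by simpa [Test.Holds, NExpr.eval, nvar, h.m, h8] using hn, levelBody_runs h h8 hb⟩
  · rintro s ⟨h, h8, hb⟩
    simp [Test.Holds, NExpr.eval, nvar, h.m, h8]

/-! ### The sign of a noisy observation -/

/-- Follows from cosh x = 1 + 2 sinh²(x/2) and |sinh y| ≥ |y|. -/
theorem cosh_ge_one_add_sq_div_two (x : ℝ) : 1 + x ^ 2 / 2 ≤ Real.cosh x := by
  have h : Real.cosh x = 1 + 2 * Real.sinh (x / 2) ^ 2 := by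
    have h1 := Real.cosh_two_mul (x / 2)
    have h2 := Real.cosh_sq (x / 2)
    rw [show 2 * (x / 2) = x by ring] at h1
    linarith
  have h2 : (x / 2) ^ 2 ≤ Real.sinh (x / 2) ^ 2 := by
    rw [sq_le_sq]
    rcases le_total 0 x with hx | hx
    · have := Real.self_le_sinh_iff.2 (show 0 ≤ x / 2 by linarith)
      rw [abs_of_nonneg (by linarith), abs_of_nonneg (by linarith)]
      exact this
    · have := Real.sinh_le_self_iff.2 (show x / 2 ≤ 0 by linarith)
      rw [abs_of_nonpos (by linarith), abs_of_nonpos (by linarith)]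
      linarith
  nlinarith

/-- The natural bound is 1 − x²/4. Replacing x² by its tangent at t makes it linear in x, so that
only the sum of the |θ_i| matters later; with t near the mean this is Cauchy–Schwarz. -/
theorem inv_cosh_le_one_sub {x : ℝ} (t : ℝ) (hx : 0 ≤ x) (hx1 : x ≤ 1) :
    (Real.cosh x)⁻¹ ≤ 1 - (2 * t * x - t ^ 2) / 4 := by
  have h1 : 2 * t * x - t ^ 2 ≤ x ^ 2 := by nlinarith [sq_nonneg (t - x)]
  have h2 : (Real.cosh x)⁻¹ ≤ (1 + x ^ 2 / 2)⁻¹ :=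
    inv_anti₀ (by positivity) (cosh_ge_one_add_sq_div_two x)
  have h3 : (1 + x ^ 2 / 2)⁻¹ ≤ 1 - x ^ 2 / 4 := by
    have hx2 : x ^ 2 ≤ 1 := by nlinarith
    rw [inv_le_iff_one_le_mul₀ (by positivity)]
    nlinarith [sq_nonneg x]
  linarith

/-- For x ≥ 1 the exponential decay of 1/cosh beats the tangent, whose slope is at most 1/2 because
t ≤ 1. This form without an upper bound on x serves blocks of size one, where many repetitions make
c large. -/
theorem inv_cosh_le_exp {x t : ℝ} (hx : 0 ≤ x) (ht : t ≤ 1) :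
    (Real.cosh x)⁻¹ ≤ Real.exp (-((2 * t * x - t ^ 2) / 4)) := by
  rcases le_total x 1 with hx1 | hx1
  · have := Real.add_one_le_exp (-((2 * t * x - t ^ 2) / 4))
    linarith [inv_cosh_le_one_sub t hx hx1]
  · rw [Real.exp_neg]
    refine inv_anti₀ (Real.exp_pos _) ?_
    have h1 : (2 * t * x - t ^ 2) / 4 ≤ x / 2 - 1 / 4 := by nlinarith
    refine (Real.exp_le_exp.2 h1).trans ?_
    rw [Real.cosh_eq]
    have h2 : Real.exp x = Real.exp (x / 2 - 1 / 4) * Real.exp (x / 2 + 1 / 4) := by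
      rw [← Real.exp_add]
      congr 1
      ring
    have h3 : 2 ≤ Real.exp (x / 2 + 1 / 4) := by
      have h4 := Real.add_one_le_exp (x / 2 + 1 / 4 - 2 / 3)
      have h5 : (3 : ℝ) / 2 ≤ Real.exp (2 / 3) := by
        have := Real.add_one_le_exp (2 / 3 : ℝ)
        linarith
      have h6 := Real.quadratic_le_exp_of_nonneg (show (0 : ℝ) ≤ x / 2 + 1 / 4 by linarith)
      nlinarith
    have := Real.exp_pos (-x)
    have := Real.exp_pos (x / 2 - 1 / 4)
    nlinarith

theorem gaussianReal_real_Ici_eq (v : NNReal) (x : ℝ) :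
    (gaussianReal 0 v).real (Set.Ici x) = (gaussianReal 0 v).real (Set.Iic (-x)) := by
  have h := gaussianReal_map_neg (μ := 0) (v := v)
  rw [neg_zero] at h
  conv_lhs => rw [← h]
  rw [map_measureReal_apply (by fun_prop) measurableSet_Ici]
  congr 1
  ext y
  simp only [Set.mem_preimage, Set.mem_Ici, Set.mem_Iic]
  constructor <;> intro h <;> linarith

theorem gaussianReal_real_Iic_le_exp {v : NNReal} (hv : v ≠ 0) {x : ℝ} (hx : 0 ≤ x) :
    (gaussianReal 0 v).real (Set.Iic (-x)) ≤ Real.exp (-(x ^ 2 / (2 * v))) := by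
  rw [← gaussianReal_real_Ici_eq]
  have hv' : (0 : ℝ) < v := by positivity
  have h := measure_ge_le_exp_mul_mgf (μ := gaussianReal 0 v) (X := id) (t := x / v) x
    (by positivity) (integrable_exp_mul_gaussianReal _)
  rw [mgf_id_gaussianReal] at h
  refine h.trans ?_
  rw [← Real.exp_add, Real.exp_le_exp]
  apply le_of_eq
  field_simp
  ring

theorem gaussianReal_real_Iic_le_half_sub {v : NNReal} (hv : v ≠ 0) {x : ℝ} (hx : 0 ≤ x)
    (hxv : x ≤ √v) : (gaussianReal 0 v).real (Set.Iic (-x)) ≤ 1 / 2 - x / (5 * √v) := by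
  have hv' : (0 : ℝ) < v := by positivity
  have hs : 0 < √(v : ℝ) := by positivity
  have hmid : 2 * (x / (5 * √v)) ≤ (gaussianReal 0 v).real (Set.Ioo (-x) x) := by
    rw [measureReal_def, gaussianReal_apply_eq_integral _ hv, ENNReal.toReal_ofReal
      (setIntegral_nonneg measurableSet_Ioo fun y _ ↦ gaussianPDFReal_nonneg _ _ _)]
    have h1 : ∀ y ∈ Set.Ioo (-x) x, 1 / (5 * √(v : ℝ)) ≤ gaussianPDFReal 0 v y := by
      intro y hy
      have hyv : y ^ 2 ≤ v := by
        rw [← Real.sq_sqrt hv'.le]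
        exact sq_le_sq' (by linarith [hy.1]) (by linarith [hy.2])
      rw [gaussianPDFReal, sub_zero]
      have h2 : Real.exp (-(1 / 2)) ≤ Real.exp (-y ^ 2 / (2 * v)) := by
        rw [Real.exp_le_exp, neg_div, neg_le_neg_iff, div_le_div_iff₀ (by positivity) (by norm_num)]
        linarith
      have h3 : √(2 * Real.pi * v) = √(2 * Real.pi) * √v := Real.sqrt_mul (by positivity) _
      -- √(2πe) ≈ 4.13 explains the constant 5: the density within one standard deviation of 0 is at
      -- least 1/(√(2πe) √v).
      have h4 : √(2 * Real.pi) * Real.exp (1 / 2) ≤ 5 := by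
        have h5 : (√(2 * Real.pi) * Real.exp (1 / 2)) ^ 2 = 2 * Real.pi * Real.exp 1 := by
          rw [mul_pow, Real.sq_sqrt (by positivity), ← Real.exp_nat_mul]
          norm_num
        have := Real.pi_lt_d2
        have := Real.exp_one_lt_d9
        have := Real.pi_pos
        refine abs_le_of_sq_le_sq' (by rw [h5]; nlinarith) (by norm_num) |>.2
      calc 1 / (5 * √(v : ℝ)) ≤ 1 / (√(2 * Real.pi) * Real.exp (1 / 2) * √v) := by
            gcongr
        _ = (√(2 * Real.pi * v))⁻¹ * Real.exp (-(1 / 2)) := by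
            rw [h3, Real.exp_neg]
            field_simp
        _ ≤ _ := by gcongr
    have h6 := setIntegral_mono_on (μ := volume) (s := Set.Ioo (-x) x)
      (integrableOn_const (by simp)) ((integrable_gaussianPDFReal 0 v).integrableOn)
      measurableSet_Ioo h1
    refine le_trans (le_of_eq ?_) h6
    rw [setIntegral_const, measureReal_def, Real.volume_Ioo, ENNReal.toReal_ofReal (by linarith),
      smul_eq_mul]
    field_simp
    ring
  -- At x = 0 the two closed half-lines overlap and do not partition the line.
  rcases hx.eq_or_lt with rfl | hx0
  · have h1 : (gaussianReal 0 v).real (Set.Iic 0) + (gaussianReal 0 v).real (Set.Ioi 0) = 1 := by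
      rw [← measureReal_union (by simp [Set.disjoint_left]) measurableSet_Ioi, Set.Iic_union_Ioi,
        probReal_univ]
    have h2 : (gaussianReal 0 v).real (Set.Ioi 0) = (gaussianReal 0 v).real (Set.Ici 0) := by
      have := nullSingletonClass_gaussianReal (μ := 0) hv
      exact measureReal_congr Ioi_ae_eq_Ici
    rw [h2, gaussianReal_real_Ici_eq, neg_zero] at h1
    simp
    linarith
  · have h1 : (gaussianReal 0 v).real (Set.Iic (-x)) + (gaussianReal 0 v).real (Set.Ioo (-x) x) +
        (gaussianReal 0 v).real (Set.Ici x) = 1 := by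
      rw [← measureReal_union _ measurableSet_Ioo, ← measureReal_union _ measurableSet_Ici,
        Set.Iic_union_Ioo_eq_Iio (by linarith), Set.Iio_union_Ici, probReal_univ]
      · rw [Set.Iic_union_Ioo_eq_Iio (by linarith)]
        exact Set.disjoint_left.2 fun y hy hy' ↦ lt_irrefl y ((Set.mem_Iio.1 hy).trans_le hy')
      · exact Set.disjoint_left.2 fun y hy hy' ↦ not_lt.2 hy hy'.1
    rw [gaussianReal_real_Ici_eq] at h1
    linarith

/-- The logistic function is the error probability for which the exponential moment of the guessed
sign is exactly 1/cosh. In units z = x/√v the condition on c gives 2cx ≤ z/4, so the logistic bound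
decays far more slowly than the Gaussian tail. The density estimate covers z ≤ 2 and the Chernoff
bound z ≥ 2. -/
theorem gaussianReal_real_Iic_le_logistic {v : NNReal} (hv : v ≠ 0) {c x : ℝ} (hc : 0 ≤ c)
    (hcv : c * (8 * √v) ≤ 1) (hx : 0 ≤ x) :
    (gaussianReal 0 v).real (Set.Iic (-x)) ≤ (1 + Real.exp (2 * (c * x)))⁻¹ := by
  have hv' : (0 : ℝ) < v := by positivity
  have hs : 0 < √(v : ℝ) := by positivity
  set z := x / √v with hz
  have hz0 : 0 ≤ z := by positivity
  have hxz : x = z * √v := by rw [hz]; field_simp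
  set y := 2 * (c * x) with hy
  have hy0 : 0 ≤ y := by positivity
  have hyz : y ≤ z / 4 := by
    rw [hy, hxz]
    nlinarith
  have hsmall : z ≤ 2 → (2 + y + y ^ 2)⁻¹ ≤ (1 + Real.exp y)⁻¹ := by
    intro h
    refine inv_anti₀ (by positivity) ?_
    have := Real.abs_exp_sub_one_sub_id_le (x := y) (by rw [abs_of_nonneg hy0]; linarith)
    linarith [(abs_le.1 this).2]
  rcases le_total z 1 with h1 | h1
  · have h := gaussianReal_real_Iic_le_half_sub hv hx (by rw [hxz]; nlinarith)
    refine (h.trans ?_).trans (hsmall (by linarith))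
    rw [le_inv_comm₀ (by rw [hxz]; field_simp; linarith) (by positivity), ← one_div,
      le_div_iff₀ (by rw [hxz]; field_simp; linarith)]
    have : x / (5 * √v) = z / 5 := by rw [hz]; field_simp
    rw [this]
    nlinarith [mul_nonneg hy0 hz0, mul_nonneg hy0 hy0, mul_nonneg (mul_nonneg hy0 hy0) hz0]
  rcases le_total z 2 with h2 | h2
  · have h := gaussianReal_real_Iic_le_half_sub hv hs.le le_rfl
    have hmono : (gaussianReal 0 v).real (Set.Iic (-x)) ≤
        (gaussianReal 0 v).real (Set.Iic (-√v)) := by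
      refine measureReal_mono (Set.Iic_subset_Iic.2 ?_)
      rw [hxz]
      nlinarith
    refine ((hmono.trans h).trans ?_).trans (hsmall h2)
    have : √(v : ℝ) / (5 * √v) = 1 / 5 := by field_simp
    rw [this, le_inv_comm₀ (by norm_num) (by positivity)]
    nlinarith
  · refine (gaussianReal_real_Iic_le_exp hv hx).trans ?_
    have h3 : x ^ 2 / (2 * v) = z ^ 2 / 2 := by
      rw [hz, div_pow, Real.sq_sqrt hv'.le]
      field_simp
    rw [h3, Real.exp_neg]
    refine inv_anti₀ (by positivity) ?_
    have h4 : Real.exp z ≤ Real.exp (z ^ 2 / 2) := Real.exp_le_exp.2 (by nlinarith)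
    have h5 : Real.exp y ≤ Real.exp (z / 4) := Real.exp_le_exp.2 hyz
    have h6 : Real.exp z = Real.exp (z / 4) ^ 4 := by
      rw [← Real.exp_nat_mul]
      congr 1
      push_cast
      ring
    have h7 : 3 / 2 ≤ Real.exp (z / 4) := by linarith [Real.add_one_le_exp (z / 4)]
    have h8 : (3 / 2 : ℝ) ^ 3 ≤ Real.exp (z / 4) ^ 3 := by gcongr
    nlinarith

/-- The sign of a noisy observation of `θ`, weighted by `θ`. -/
theorem integral_exp_neg_sign_mul_le {v : NNReal} (hv : v ≠ 0) {c : ℝ} (hc : 0 ≤ c)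
    (hcv : c * (8 * √v) ≤ 1) (θ : ℝ) :
    ∫ y, Real.exp (-c * ((if 0 < θ + y then 1 else -1) * θ)) ∂gaussianReal 0 v ≤
      (Real.cosh (c * |θ|))⁻¹ := by
  classical
  -- W is the set of noise values for which the guessed sign is wrong and the item contributes −|θ|.
  obtain ⟨W, hW, hWm, hWE⟩ : ∃ W : Set ℝ, (gaussianReal 0 v).real W ≤
      (1 + Real.exp (2 * (c * |θ|)))⁻¹ ∧ MeasurableSet W ∧
      ∀ y, (if 0 < θ + y then (1 : ℝ) else -1) * θ = if y ∈ W then -|θ| else |θ| := by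
    rcases le_total 0 θ with h | h
    · refine ⟨Set.Iic (-θ), ?_, measurableSet_Iic, fun y ↦ ?_⟩
      · rw [abs_of_nonneg h]
        exact gaussianReal_real_Iic_le_logistic hv hc hcv h
      · by_cases hy : 0 < θ + y
        · rw [if_pos hy, if_neg (by simp; linarith), abs_of_nonneg h, one_mul]
        · rw [if_neg hy, if_pos (by simp; linarith), abs_of_nonneg h]
          ring
    · refine ⟨Set.Ioi (-θ), ?_, measurableSet_Ioi, fun y ↦ ?_⟩
      · rw [abs_of_nonpos h]
        refine le_trans (measureReal_mono Set.Ioi_subset_Ici_self) ?_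
        rw [gaussianReal_real_Ici_eq]
        exact gaussianReal_real_Iic_le_logistic hv hc hcv (by linarith)
      · by_cases hy : 0 < θ + y
        · rw [if_pos hy, if_pos (by simp; linarith), abs_of_nonpos h]
          ring
        · rw [if_neg hy, if_neg (by simp; linarith), abs_of_nonpos h]
          ring
  set a := c * |θ| with ha
  have ha0 : 0 ≤ a := by positivity
  have hfun : ∀ y, Real.exp (-c * ((if 0 < θ + y then 1 else -1) * θ)) =
      Real.exp (-a) + W.indicator (fun _ ↦ Real.exp a - Real.exp (-a)) y := by
    intro y
    rw [hWE y]
    by_cases hy : y ∈ W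
    · simp [hy, ha]
    · simp [hy, ha]
  simp_rw [hfun]
  rw [integral_add (integrable_const _) ((integrable_const _).indicator hWm), integral_const,
    integral_indicator_const _ hWm, probReal_univ, one_smul, smul_eq_mul]
  have h1 : 0 ≤ Real.exp a - Real.exp (-a) := by
    rw [sub_nonneg, Real.exp_le_exp]
    linarith
  -- With p = 1/(1 + e^{2a}) the moment e^{−a} + p (e^a − e^{−a}) equals 1/cosh a.
  refine (add_le_add_right (mul_le_mul_of_nonneg_right hW h1) _).trans (le_of_eq ?_)
  rw [Real.cosh_eq, show 2 * a = a + a by ring, Real.exp_add, Real.exp_neg]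
  have := Real.exp_pos a
  field_simp
  ring

/-! ### Product measures -/

section Product

variable {ι J K X : Type*} [MeasurableSpace X] {μ : Measure X} [IsProbabilityMeasure μ]

/-- Disjoint blocks of coordinates of an i.i.d. family are i.i.d. -/
theorem map_infinitePi_blocks {φ : ι × J → K} (hφ : Function.Injective φ) :
    (Measure.infinitePi fun _ : K ↦ μ).map (fun ω i j ↦ ω (φ (i, j))) =
      Measure.infinitePi fun _ : ι ↦ Measure.infinitePi fun _ : J ↦ μ := by
  rw [← Measure.infinitePi_map_curry (fun (_ : ι) (_ : J) ↦ μ),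
    ← Measure.map_infinitePi_infinitePi_of_inj (P := fun _ : K ↦ μ) hφ,
    Measure.map_map (by fun_prop) (by fun_prop)]
  rfl

theorem lintegral_infinitePi_eval {f : X → ENNReal} (hf : Measurable f) (i : ι) :
    ∫⁻ y, f (y i) ∂(Measure.infinitePi fun _ : ι ↦ μ) = ∫⁻ x, f x ∂μ :=
  (measurePreserving_eval_infinitePi (fun _ : ι ↦ μ) i).lintegral_comp hf

theorem lintegral_prod_infinitePi (f : ι → X → ENNReal) (hf : ∀ i, Measurable (f i))
    (s : Finset ι) :
    ∫⁻ y, ∏ i ∈ s, f i (y i) ∂(Measure.infinitePi fun _ : ι ↦ μ) =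
      ∏ i ∈ s, ∫⁻ x, f i x ∂μ := by
  refine (lintegral_prod_eq_prod_lintegral_of_indepFun s
    (fun i (y : ι → X) ↦ f i (y i)) (iIndepFun_infinitePi hf)
    (fun i ↦ (hf i).comp (measurable_pi_apply i))).trans ?_
  exact Finset.prod_congr rfl fun i _ ↦ lintegral_infinitePi_eval (hf i) i

/-- An exponential moment bound for the lower tail of a sum of independent terms. -/
theorem infinitePi_sum_le_le (F : ι → X → ℝ) (hF : ∀ i, Measurable (F i)) (s : Finset ι)
    {c : ℝ} (hc : 0 ≤ c) (H : ℝ) :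
    (Measure.infinitePi fun _ : ι ↦ μ) {y | ∑ i ∈ s, F i (y i) ≤ H} ≤
      ENNReal.ofReal (Real.exp (c * H)) *
        ∏ i ∈ s, ∫⁻ x, ENNReal.ofReal (Real.exp (-c * F i x)) ∂μ := by
  rw [← lintegral_prod_infinitePi _ (fun i ↦ by have := hF i; fun_prop),
    ← lintegral_const_mul _ (by
      refine Finset.measurable_fun_prod _ fun i _ ↦ ?_
      have := hF i
      fun_prop)]
  -- Markov's inequality at level 1 for exp(c (H − S)), S being the sum.
  refine le_trans ?_ (meas_ge_le_lintegral_div (ε := 1) ?_ (by simp) (by simp)) |>.trans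
    (by rw [div_one])
  · refine measure_mono fun y hy ↦ ?_
    simp only [Set.mem_ofPred_eq] at hy ⊢
    rw [← ENNReal.ofReal_prod_of_nonneg (fun _ _ ↦ (Real.exp_pos _).le),
      ← ENNReal.ofReal_mul (Real.exp_pos _).le, ← Real.exp_sum, ← Real.exp_add,
      ENNReal.one_le_ofReal, Real.one_le_exp_iff, ← Finset.mul_sum]
    nlinarith
  · refine Measurable.aemeasurable (Measurable.const_mul ?_ _)
    refine Finset.measurable_fun_prod _ fun i _ ↦ ?_
    have := hF i
    fun_prop

theorem prod_measure_le_of_forall {α β : Type*} [MeasurableSpace α] [MeasurableSpace β]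
    {μ : Measure α} {ν : Measure β} [SFinite ν] {S : Set (α × β)} (hS : MeasurableSet S)
    {f : α → ENNReal} (h : ∀ a, ν (Prod.mk a ⁻¹' S) ≤ f a) : μ.prod ν S ≤ ∫⁻ a, f a ∂μ := by
  rw [Measure.prod_apply hS]
  exact lintegral_mono h

end Product

/-! ### Coins -/

instance : IsProbabilityMeasure (PMF.uniformOfFintype Bool).toMeasure := inferInstance

instance : IsProbabilityMeasure fairCoins := by unfold fairCoins; infer_instance

theorem lintegral_fairCoin (f : Bool → ENNReal) :
    ∫⁻ x, f x ∂(PMF.uniformOfFintype Bool).toMeasure = (f true + f false) / 2 := by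
  rw [lintegral_fintype, Fintype.sum_bool,
    PMF.toMeasure_apply_singleton _ _ (measurableSet_singleton _),
    PMF.toMeasure_apply_singleton _ _ (measurableSet_singleton _)]
  simp [PMF.uniformOfFintype_apply, ENNReal.div_eq_inv_mul, mul_comm, add_mul]

theorem coinNum_congr {c c' : ℕ → Bool} {p : ℕ} :
    ∀ {n : ℕ}, (∀ t < n, c (p + t) = c' (p + t)) → coinNum c p n = coinNum c' p n
  | 0, _ => rfl
  | n + 1, h => by
    rw [coinNum, coinNum, coinNum_congr fun t ht ↦ h t (by omega), h n (by omega)]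

theorem coinNum_shift (c : ℕ → Bool) (p n : ℕ) :
    coinNum c p n = coinNum (fun t ↦ c (p + t)) 0 n := by
  induction n with
  | zero => rfl
  | succ n ih => rw [coinNum, coinNum, ih, zero_add]

theorem coinNum_lt (c : ℕ → Bool) (p n : ℕ) : coinNum c p n < 2 ^ n := by
  induction n with
  | zero => simp [coinNum]
  | succ n ih =>
    have := Bool.toNat_le (c (p + n))
    rw [coinNum, pow_succ]
    omega

theorem measurable_coinNum (p n : ℕ) : Measurable fun c ↦ coinNum c p n := by
  induction n with
  | zero => exact measurable_const
  | succ n ih =>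
    refine (ih.add ih).add ?_
    exact (Measurable.of_discrete (f := Bool.toNat)).comp (measurable_pi_apply _)

/-- The number formed by the coins of a finite block. -/
def blockNum (n : ℕ) (d : Fin n → Bool) : ℕ :=
  coinNum (fun t ↦ if h : t < n then d ⟨t, h⟩ else false) 0 n

theorem blockNum_eq (c : ℕ → Bool) (p n : ℕ) :
    blockNum n (fun t ↦ c (p + t)) = coinNum c p n := by
  rw [coinNum_shift, blockNum]
  refine coinNum_congr fun t ht ↦ ?_
  simp [ht]

theorem sum_range_two_mul {M : Type*} [AddCommMonoid M] (f : ℕ → M) (n : ℕ) :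
    ∑ r ∈ Finset.range (2 * n), f r = ∑ r ∈ Finset.range n, (f (r + r) + f (r + r + 1)) := by
  induction n with
  | zero => simp
  | succ n ih =>
    rw [Finset.sum_range_succ, ← ih, show 2 * (n + 1) = 2 * n + 1 + 1 by ring,
      Finset.sum_range_succ, Finset.sum_range_succ, two_mul, add_assoc]

theorem indepFun_coinNum (p n : ℕ) :
    IndepFun (fun c : ℕ → Bool ↦ coinNum c p n) (fun c ↦ c (p + n)) fairCoins := by
  have h : iIndepFun (fun (k : ℕ) (c : ℕ → Bool) ↦ c k) fairCoins :=
    iIndepFun_infinitePi (X := fun _ x ↦ x) (by fun_prop)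
  have hd : Disjoint (Finset.Ico p (p + n)) {p + n} := by simp
  have h' := h.indepFun_finset _ _ hd (fun k ↦ measurable_pi_apply k)
  have h'' := h'.comp
    (φ := fun y : (Finset.Ico p (p + n) → Bool) ↦
      coinNum (fun k ↦ if hk : k ∈ Finset.Ico p (p + n) then y ⟨k, hk⟩ else false) p n)
    (ψ := fun y : (({p + n} : Finset ℕ) → Bool) ↦ y ⟨p + n, by simp⟩)
    Measurable.of_discrete Measurable.of_discrete
  have hfun : (fun c : ℕ → Bool ↦ coinNum c p n) =
      (fun y : (Finset.Ico p (p + n) → Bool) ↦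
        coinNum (fun k ↦ if hk : k ∈ Finset.Ico p (p + n) then y ⟨k, hk⟩ else false) p n) ∘
        fun c i ↦ c i := by
    funext c
    refine coinNum_congr fun t ht ↦ ?_
    simp [ht]
  rw [hfun]
  exact h''

/-- The number formed by `n` fair coins is uniformly distributed. -/
theorem lintegral_coinNum (p n : ℕ) (f : ℕ → ENNReal) :
    ∫⁻ c, f (coinNum c p n) ∂fairCoins = (∑ r ∈ Finset.range (2 ^ n), f r) / 2 ^ n := by
  induction n generalizing f with
  | zero => simp [coinNum]
  | succ n ih =>
    have hcoin : ∀ g : Bool → ENNReal, ∫⁻ c, g (c (p + n)) ∂fairCoins = (g true + g false) / 2 := by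
      intro g
      rw [← lintegral_fairCoin, fairCoins]
      exact lintegral_infinitePi_eval Measurable.of_discrete (p + n)
    -- The last digit decides between r + r and r + r + 1 and is independent of the number r formed
    -- by the digits before it.
    have hsplit : ∀ c : ℕ → Bool, f (coinNum c p (n + 1)) =
        (fun r ↦ f (r + r + 1)) (coinNum c p n) * (fun x ↦ if x then 1 else 0) (c (p + n)) +
        (fun r ↦ f (r + r)) (coinNum c p n) * (fun x ↦ if x then 0 else 1) (c (p + n)) := by
      intro c
      rw [coinNum]
      cases c (p + n) <;> simp
    have hmeas : ∀ g : ℕ → ENNReal, Measurable fun c : ℕ → Bool ↦ g (coinNum c p n) :=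
      fun g ↦ (Measurable.of_discrete (f := g)).comp (measurable_coinNum p n)
    have hmeas' : ∀ g : Bool → ENNReal, Measurable fun c : ℕ → Bool ↦ g (c (p + n)) :=
      fun g ↦ (Measurable.of_discrete (f := g)).comp (measurable_pi_apply _)
    have hind : ∀ (g : ℕ → ENNReal) (g' : Bool → ENNReal),
        ∫⁻ c, g (coinNum c p n) * g' (c (p + n)) ∂fairCoins =
          (∑ r ∈ Finset.range (2 ^ n), g r) / 2 ^ n * ((g' true + g' false) / 2) := by
      intro g g'
      rw [← ih g, ← hcoin g']
      exact lintegral_mul_eq_lintegral_mul_lintegral_of_indepFun (hmeas g) (hmeas' g')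
        ((indepFun_coinNum p n).comp Measurable.of_discrete Measurable.of_discrete)
    have hm : Measurable fun c : ℕ → Bool ↦ (fun r ↦ f (r + r + 1)) (coinNum c p n) *
        (fun x ↦ if x then 1 else 0) (c (p + n)) :=
      (hmeas fun r ↦ f (r + r + 1)).mul (hmeas' fun x ↦ if x then 1 else 0)
    rw [lintegral_congr hsplit, lintegral_add_left hm,
      hind (fun r ↦ f (r + r + 1)) (fun x ↦ if x then 1 else 0),
      hind (fun r ↦ f (r + r)) (fun x ↦ if x then 0 else 1), pow_succ', sum_range_two_mul,
      Finset.sum_add_distrib]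
    simp only [if_true, Bool.false_eq_true, if_false, add_zero, zero_add, one_div]
    rw [← add_mul, ← ENNReal.add_div, add_comm (∑ r ∈ Finset.range (2 ^ n), f (r + r + 1)),
      div_eq_mul_inv, div_eq_mul_inv, pow_succ', ENNReal.mul_inv (by simp) (by simp), mul_assoc,
      mul_comm (2⁻¹ : ENNReal)]

/-- The numbers formed by the coins of disjoint blocks are independent. -/
theorem lintegral_prod_coinNum (j : ℕ) (h : ℕ → ℕ → ENNReal) (s : Finset ℕ) :
    ∫⁻ c, ∏ b ∈ s, h b (coinNum c (b * j) j) ∂fairCoins =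
      ∏ b ∈ s, (∑ r ∈ Finset.range (2 ^ j), h b r) / 2 ^ j := by
  have hφ : Function.Injective fun x : ℕ × Fin j ↦ x.1 * j + x.2 := by
    rintro ⟨b, t⟩ ⟨b', t'⟩ h
    simp only at h
    have ht := t.2
    have ht' := t'.2
    have hb : b = b' := by
      have := congrArg (· / j) h
      simpa [mul_comm _ j, Nat.mul_add_div (show 0 < j by omega), Nat.div_eq_of_lt] using this
    subst hb
    simp only [Prod.mk.injEq, true_and]
    exact Fin.ext (by omega)
  have hlaw : (Measure.infinitePi fun _ : ℕ ↦ (PMF.uniformOfFintype Bool).toMeasure).map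
      (fun c (b : ℕ) (t : Fin j) ↦ c (b * j + t)) = Measure.infinitePi fun _ : ℕ ↦
        Measure.infinitePi fun _ : Fin j ↦ (PMF.uniformOfFintype Bool).toMeasure :=
    map_infinitePi_blocks hφ
  have hm : Measurable fun (c : ℕ → Bool) (b : ℕ) (t : Fin j) ↦ c (b * j + t) := by fun_prop
  have hb : ∀ b, Measurable fun d : Fin j → Bool ↦ h b (blockNum j d) :=
    fun b ↦ Measurable.of_discrete
  have hone : ∀ b, ∫⁻ d, h b (blockNum j d)
      ∂(Measure.infinitePi fun _ : Fin j ↦ (PMF.uniformOfFintype Bool).toMeasure) =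
      (∑ r ∈ Finset.range (2 ^ j), h b r) / 2 ^ j := by
    intro b
    rw [← lintegral_coinNum (b * j), ← lintegral_infinitePi_eval (ι := ℕ) (hb b) b, ← hlaw,
      lintegral_map (f := fun y : ℕ → Fin j → Bool ↦ h b (blockNum j (y b)))
        ((hb b).comp (measurable_pi_apply b)) hm]
    simp_rw [blockNum_eq]
    rfl
  simp_rw [← hone]
  rw [← lintegral_prod_infinitePi _ hb, ← hlaw, lintegral_map ?_ hm]
  · simp_rw [blockNum_eq]
    rfl
  · exact Finset.measurable_fun_prod _ fun b _ ↦ (hb b).comp (measurable_pi_apply b)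

/-! ### The noise of a block of queries -/

theorem map_sum_gaussianReal (v : NNReal) (q : ℕ) :
    (Measure.infinitePi fun _ : Fin q ↦ gaussianReal 0 v).map (fun y ↦ ∑ t, y t) =
      gaussianReal 0 (q * v) := by
  have hind : iIndepFun (fun (t : Fin q) (y : Fin q → ℝ) ↦ y t)
      (Measure.infinitePi fun _ : Fin q ↦ gaussianReal 0 v) :=
    iIndepFun_infinitePi (X := fun _ x ↦ x) (by fun_prop)
  have hs : ∀ s : Finset (Fin q),
      (Measure.infinitePi fun _ : Fin q ↦ gaussianReal 0 v).map (∑ t ∈ s, fun y ↦ y t) =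
        gaussianReal 0 (s.card * v) := by
    intro s
    induction s using Finset.cons_induction with
    | empty =>
      simp only [Finset.sum_empty, Finset.card_empty, Nat.cast_zero, zero_mul,
        gaussianReal_zero_var]
      have : (0 : (Fin q → ℝ) → ℝ) = fun _ ↦ 0 := rfl
      rw [this, Measure.map_const]
      simp
    | cons t s ht ih =>
      rw [Finset.sum_cons]
      have h := gaussianReal_add_gaussianReal_of_indepFun
        (hind.indepFun_finsetSum_of_notMem (fun _ ↦ by fun_prop) ht).symm
        (Measure.infinitePi_map_eval _ t) ih
      rw [h, Finset.card_cons]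
      congr 1
      · simp
      · push_cast
        ring
  have h := hs Finset.univ
  rw [Finset.card_univ, Fintype.card_fin] at h
  rw [← h]
  congr 1
  funext y
  simp

/-- The sum of the noise of the queries in even (`false`) or odd (`true`) positions of the `b`-th
block of `2 * q` queries. -/
noncomputable def noiseSum (q : ℕ) (ξ : ℕ × Agent → ℝ) (b : ℕ) (i : Bool × Agent) : ℝ :=
  ∑ t : Fin q, ξ (2 * (b * q + t) + i.1.toNat, i.2)

/-- The law of the noise of a block: for every agent and parity a Gaussian variable. -/
noncomputable def blockLaw (v : NNReal) : Measure (Bool × Agent → ℝ) :=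
  Measure.infinitePi fun _ ↦ gaussianReal 0 v

instance (v : NNReal) : IsProbabilityMeasure (blockLaw v) := by unfold blockLaw; infer_instance

instance (σ : ℝ) : IsProbabilityMeasure (gaussianNoise σ) := by
  unfold gaussianNoise
  infer_instance

theorem measurable_noiseSum (q : ℕ) : Measurable fun ξ b i ↦ noiseSum q ξ b i := by
  unfold noiseSum
  fun_prop

/-- The noise is indexed by the position of a query, not by its item. The sums over disjoint sets of
positions are therefore independent of each other and of the picked items, each with variance qσ².
-/
theorem map_noiseSum (σ : ℝ) (q : ℕ) :
    (gaussianNoise σ).map (fun ξ b i ↦ noiseSum q ξ b i) =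
      Measure.infinitePi fun _ : ℕ ↦ blockLaw (q * (σ ^ 2).toNNReal) := by
  have hφ : Function.Injective fun x : (ℕ × (Bool × Agent)) × Fin q ↦
      (2 * (x.1.1 * q + x.2) + x.1.2.1.toNat, x.1.2.2) := by
    rintro ⟨⟨b, p, ν⟩, t⟩ ⟨⟨b', p', ν'⟩, t'⟩ h
    simp only [Prod.mk.injEq] at h
    obtain ⟨h, rfl⟩ := h
    have hp : p = p' := by
      cases p <;> cases p' <;> simp at h ⊢ <;> omega
    subst hp
    have h : b * q + t = b' * q + t' := by omega
    have ht := t.2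
    have ht' := t'.2
    have hb : b = b' := by
      have := congrArg (· / q) h
      simpa [mul_comm _ q, Nat.mul_add_div (show 0 < q by omega), Nat.div_eq_of_lt] using this
    subst hb
    simp only [Prod.mk.injEq, true_and]
    exact Fin.ext (by omega)
  have h1 : (gaussianNoise σ).map (fun ξ (x : ℕ × (Bool × Agent)) (t : Fin q) ↦
      ξ (2 * (x.1 * q + t) + x.2.1.toNat, x.2.2)) =
      Measure.infinitePi fun _ : ℕ × (Bool × Agent) ↦
        Measure.infinitePi fun _ : Fin q ↦ gaussianReal 0 (σ ^ 2).toNNReal :=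
    map_infinitePi_blocks hφ
  have h2 := Measure.infinitePi_map_pi (fun _ : ℕ × (Bool × Agent) ↦
        Measure.infinitePi fun _ : Fin q ↦ gaussianReal 0 (σ ^ 2).toNNReal)
        (f := fun _ y ↦ ∑ t, y t) (fun _ ↦ by fun_prop)
  simp_rw [map_sum_gaussianReal] at h2
  have h3 := Measure.infinitePi_map_curry
    (fun (_ : ℕ) (_ : Bool × Agent) ↦ gaussianReal 0 (q * (σ ^ 2).toNNReal))
  rw [← h2, ← h1, Measure.map_map (by fun_prop) (by fun_prop),
    Measure.map_map (by fun_prop) (by fun_prop)] at h3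
  exact h3

theorem lintegral_exp_gaussianReal (v : NNReal) (t : ℝ) :
    ∫⁻ x, ENNReal.ofReal (Real.exp (t * x)) ∂gaussianReal 0 v =
      ENNReal.ofReal (Real.exp (t ^ 2 * v / 2)) := by
  rw [← ofReal_integral_eq_lintegral_ofReal (integrable_exp_mul_gaussianReal t)
    (ae_of_all _ fun _ ↦ (Real.exp_pos _).le)]
  have := congrFun (mgf_id_gaussianReal (μ := 0) (v := v)) t
  simp only [mgf, id] at this
  rw [this]
  congr 2
  ring

theorem iIndepFun_blockLaw (v : NNReal) :
    iIndepFun (fun (i : Bool × Agent) (y : Bool × Agent → ℝ) ↦ y i) (blockLaw v) :=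
  iIndepFun_infinitePi (X := fun _ x ↦ x) (by fun_prop)

theorem map_blockLaw (v : NNReal) (i : Bool × Agent) :
    (blockLaw v).map (fun y ↦ y i) = gaussianReal 0 v := Measure.infinitePi_map_eval _ i

/-- Signs that depend on the even positions only do not change the law of the odd ones. -/
theorem lintegral_exp_sign_mul (v : NNReal) {g : ℝ × ℝ → ℝ} (hg : Measurable g)
    (hg1 : ∀ x, g x = 1 ∨ g x = -1) (c : ℝ) (ν : Agent) :
    ∫⁻ y, ENNReal.ofReal (Real.exp (-c * (g (y (false, .a), y (false, .b)) * y (true, ν))))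
      ∂blockLaw v = ENNReal.ofReal (Real.exp (c ^ 2 * v / 2)) := by
  classical
  have hind : IndepFun (fun y : Bool × Agent → ℝ ↦ (y (false, .a), y (false, .b)))
      (fun y ↦ y (true, ν)) (blockLaw v) :=
    (iIndepFun_blockLaw v).indepFun_prodMk (fun i ↦ by fun_prop) _ _ _ (by simp) (by simp)
  -- Split according to the value of the sign. Both signs give the odd coordinate the same
  -- exponential moment, since c enters it squared, and the indicators A and A' add up to 1.
  set A : ℝ × ℝ → ENNReal := fun x ↦ if g x = 1 then 1 else 0 with hA
  set A' : ℝ × ℝ → ENNReal := fun x ↦ if g x = 1 then 0 else 1 with hA'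
  have hAm : Measurable A := Measurable.ite (hg (measurableSet_singleton 1)) (by fun_prop)
    (by fun_prop)
  have hAm' : Measurable A' := Measurable.ite (hg (measurableSet_singleton 1)) (by fun_prop)
    (by fun_prop)
  have hE : ∀ t : ℝ, Measurable fun z : ℝ ↦ ENNReal.ofReal (Real.exp (t * z)) := by
    intro t
    fun_prop
  have hsplit : ∀ y : Bool × Agent → ℝ,
      ENNReal.ofReal (Real.exp (-c * (g (y (false, .a), y (false, .b)) * y (true, ν)))) =
      A (y (false, .a), y (false, .b)) * ENNReal.ofReal (Real.exp (-c * y (true, ν))) +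
      A' (y (false, .a), y (false, .b)) * ENNReal.ofReal (Real.exp (c * y (true, ν))) := by
    intro y
    rcases hg1 (y (false, .a), y (false, .b)) with h | h
    · simp [hA, hA', h]
    · have : ¬ (-1 : ℝ) = 1 := by norm_num
      simp [hA, hA', h, this]
  have hmul : ∀ (B : ℝ × ℝ → ENNReal) (t : ℝ), Measurable B → t ^ 2 = c ^ 2 →
      ∫⁻ y, B (y (false, .a), y (false, .b)) * ENNReal.ofReal (Real.exp (t * y (true, ν)))
        ∂blockLaw v = (∫⁻ y, B (y (false, .a), y (false, .b)) ∂blockLaw v) *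
          ENNReal.ofReal (Real.exp (c ^ 2 * v / 2)) := by
    intro B t hB ht
    rw [← ht, ← lintegral_exp_gaussianReal, ← map_blockLaw v (true, ν),
      lintegral_map (hE t) (by fun_prop)]
    exact lintegral_mul_eq_lintegral_mul_lintegral_of_indepFun (hB.comp (by fun_prop))
      ((hE t).comp (by fun_prop)) (hind.comp hB (hE t))
  have hm : Measurable fun y : Bool × Agent → ℝ ↦ A (y (false, .a), y (false, .b)) *
      ENNReal.ofReal (Real.exp (-c * y (true, ν))) :=
    (hAm.comp (by fun_prop)).mul (by fun_prop)
  have hm2 : Measurable fun y : Bool × Agent → ℝ ↦ A (y (false, .a), y (false, .b)) :=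
    hAm.comp (by fun_prop)
  rw [lintegral_congr hsplit, lintegral_add_left hm, hmul A (-c) hAm (by ring),
    hmul A' c hAm' rfl, ← add_mul, ← lintegral_add_left hm2]
  have : ∀ x, A x + A' x = 1 := by
    intro x
    by_cases h : g x = 1 <;> simp [hA, hA', h]
  simp [this]

/-- The sign with which an item of utilities `ua`, `ub` is given to agent `a` at the level `κ`, when
the sum of `q` observations deviates from its mean by `x.1` for `a` and by `x.2` for `b`. -/
noncomputable def choiceSign (m q κ : ℕ) (ua ub : ℝ) (x : ℝ × ℝ) : ℝ :=
  if ((m - κ : ℕ) : ℝ) * (q * ub + x.2) < κ * (q * ua + x.1) then 1 else -1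

theorem measurable_choiceSign (m q κ : ℕ) (ua ub : ℝ) : Measurable (choiceSign m q κ ua ub) :=
  Measurable.ite (measurableSet_lt (by fun_prop) (by fun_prop)) (by fun_prop) (by fun_prop)

theorem choiceSign_eq (m q κ : ℕ) (ua ub : ℝ) (x : ℝ × ℝ) :
    choiceSign m q κ ua ub x = 1 ∨ choiceSign m q κ ua ub x = -1 := by
  unfold choiceSign
  split_ifs <;> simp

/-- The weighted difference of the utilities. -/
noncomputable def weighted (m κ : ℕ) (ua ub : ℝ) : ℝ := (κ * ua - ((m - κ : ℕ) : ℝ) * ub) / m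

/-- Divided by mq, the test compares θ plus a centred Gaussian with 0. The variance of this Gaussian
is at most v/q², because κ² + (m − κ)² ≤ m², so the bound for a single noisy sign applies. -/
theorem lintegral_exp_choiceSign_mul_le {m q κ : ℕ} (hm : 0 < m) (hq : 0 < q) (hκ : κ ≤ m)
    {v : NNReal} (hv : v ≠ 0) {c : ℝ} (hc : 0 ≤ c) (hcv : c * (8 * √v) ≤ q) (ua ub : ℝ) :
    ∫⁻ y, ENNReal.ofReal (Real.exp (-c * (choiceSign m q κ ua ub (y (false, .a), y (false, .b)) *
      weighted m κ ua ub))) ∂blockLaw v ≤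
      ENNReal.ofReal (Real.cosh (c * |weighted m κ ua ub|))⁻¹ := by
  set α : ℝ := κ / (m * q) with hα
  set β : ℝ := -(((m - κ : ℕ) : ℝ) / (m * q)) with hβ
  have hm' : (0 : ℝ) < m := by positivity
  have hq' : (0 : ℝ) < q := by positivity
  have hcast : ((m - κ : ℕ) : ℝ) = m - κ := Nat.cast_sub hκ
  have hκ' : (κ : ℝ) ≤ m := by exact_mod_cast hκ
  have hκ0 : (0 : ℝ) ≤ κ := by positivity
  set w : NNReal := NNReal.mk (α ^ 2) (sq_nonneg _) * v + NNReal.mk (β ^ 2) (sq_nonneg _) * v with hw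
  have hlaw : (blockLaw v).map (fun y ↦ α * y (false, .a) + β * y (false, .b)) =
      gaussianReal 0 w := by
    have hind : IndepFun (fun y : Bool × Agent → ℝ ↦ α * y (false, .a))
        (fun y ↦ β * y (false, .b)) (blockLaw v) :=
      ((iIndepFun_blockLaw v).indepFun (i := (false, .a)) (j := (false, .b)) (by simp)).comp
        (φ := fun x ↦ α * x) (ψ := fun x ↦ β * x) (by fun_prop) (by fun_prop)
    have h1 : ∀ (c : ℝ) (i : Bool × Agent), (blockLaw v).map (fun y ↦ c * y i) =
        gaussianReal 0 (NNReal.mk (c ^ 2) (sq_nonneg _) * v) := by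
      intro c i
      have h := gaussianReal_map_const_mul (μ := 0) (v := v) c
      rw [mul_zero, ← map_blockLaw v i, Measure.map_map (by fun_prop) (by fun_prop)] at h
      exact h
    have h := gaussianReal_add_gaussianReal_of_indepFun hind (h1 α _) (h1 β _)
    rw [add_zero] at h
    exact h
  have hwval : (w : ℝ) = (κ ^ 2 + (m - κ) ^ 2) / (m * q) ^ 2 * v := by
    simp only [hw, NNReal.coe_add, NNReal.coe_mul, NNReal.coe_mk, hα, hβ, hcast]
    field_simp
  have hv' : (0 : ℝ) < v := by positivity
  have hw0 : w ≠ 0 := by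
    have h0 : 0 < (κ : ℝ) ^ 2 + (m - κ) ^ 2 := by
      rcases hκ0.eq_or_lt with h | h
      · rw [← h]
        simp only [ne_eq, OfNat.ofNat_ne_zero, not_false_eq_true, zero_pow, sub_zero, zero_add]
        positivity
      · positivity
    have : (0 : ℝ) < w := by rw [hwval]; positivity
    exact_mod_cast this.ne'
  have hcw : c * (8 * √w) ≤ 1 := by
    have h1 : √(w : ℝ) ≤ √v / q := by
      rw [Real.sqrt_le_left (by positivity), hwval, div_pow, Real.sq_sqrt hv'.le,
        div_mul_eq_mul_div, div_le_div_iff₀ (by positivity) (by positivity)]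
      have : (κ : ℝ) ^ 2 + (m - κ) ^ 2 ≤ m ^ 2 := by nlinarith
      calc ((κ : ℝ) ^ 2 + (m - κ) ^ 2) * (v : ℝ) * q ^ 2 ≤ m ^ 2 * (v : ℝ) * q ^ 2 := by gcongr
        _ = (v : ℝ) * (m * q) ^ 2 := by ring
    calc c * (8 * √w) ≤ c * (8 * (√v / q)) := by gcongr
      _ = c * (8 * √v) / q := by ring
      _ ≤ 1 := by rwa [div_le_one hq']
  set θ := weighted m κ ua ub with hθ
  have hsign : ∀ y : Bool × Agent → ℝ, choiceSign m q κ ua ub (y (false, .a), y (false, .b)) =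
      if 0 < θ + (α * y (false, .a) + β * y (false, .b)) then 1 else -1 := by
    intro y
    unfold choiceSign
    refine if_congr ?_ rfl rfl
    have : θ + (α * y (false, .a) + β * y (false, .b)) =
        (κ * (q * ua + y (false, .a)) - ((m - κ : ℕ) : ℝ) * (q * ub + y (false, .b))) /
          (m * q) := by
      rw [hθ, hα, hβ, weighted]
      field_simp
      ring
    rw [this, lt_div_iff₀ (by positivity), zero_mul, sub_pos]
  have hmeas : Measurable fun x : ℝ ↦
      Real.exp (-c * ((if 0 < θ + x then 1 else -1) * θ)) := by
    refine Real.measurable_exp.comp (Measurable.const_mul (Measurable.mul_const ?_ _) _)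
    exact Measurable.ite (measurableSet_lt (by fun_prop) (by fun_prop)) (by fun_prop) (by fun_prop)
  simp_rw [hsign]
  have hmap := lintegral_map (μ := blockLaw v)
    (f := fun x ↦ ENNReal.ofReal (Real.exp (-c * ((if 0 < θ + x then 1 else -1) * θ))))
    (g := fun y : Bool × Agent → ℝ ↦ α * y (false, .a) + β * y (false, .b))
    hmeas.ennreal_ofReal (by fun_prop)
  rw [hlaw] at hmap
  rw [← hmap, ← ofReal_integral_eq_lintegral_ofReal ?_ (ae_of_all _ fun _ ↦ (Real.exp_pos _).le)]
  · exact ENNReal.ofReal_le_ofReal (integral_exp_neg_sign_mul_le hw0 hc hcw θ)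
  · refine Integrable.of_bound hmeas.aestronglyMeasurable (Real.exp (c * |θ|)) (ae_of_all _ ?_)
    intro x
    rw [Real.norm_of_nonneg (Real.exp_pos _).le, Real.exp_le_exp]
    have h1 := neg_abs_le θ
    have h2 := le_abs_self θ
    split_ifs <;> nlinarith

/-- A lower tail bound for a sum over the blocks, whose terms depend on the picked items and on the
noise. -/
theorem randomness_sum_le_le {σ : ℝ} {q j n : ℕ} {F : ℕ → ℕ → (Bool × Agent → ℝ) → ℝ}
    (hF : ∀ b r, Measurable (F b r)) {c H : ℝ} (hc : 0 ≤ c) {h : ℕ → ℕ → ENNReal}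
    (hh : ∀ b r, b < n → r < 2 ^ j → ∫⁻ y, ENNReal.ofReal (Real.exp (-c * F b r y))
      ∂blockLaw (q * (σ ^ 2).toNNReal) ≤ h b r) :
    randomness σ {ω | ∑ b ∈ Finset.range n,
        F b (coinNum ω.1 (b * j) j) (noiseSum q ω.2.2 b) ≤ H} ≤
      ENNReal.ofReal (Real.exp (c * H)) *
        ∏ b ∈ Finset.range n, (∑ r ∈ Finset.range (2 ^ j), h b r) / 2 ^ j := by
  have hmF : ∀ b, Measurable fun p : (ℕ → Bool) × (ℕ × Agent → ℝ) ↦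
      F b (coinNum p.1 (b * j) j) (noiseSum q p.2 b) := by
    intro b
    have h1 : Measurable fun p : ℕ × (Bool × Agent → ℝ) ↦ F b p.1 p.2 :=
      measurable_from_prod_countable_right fun r ↦ hF b r
    refine h1.comp (Measurable.prodMk ((measurable_coinNum _ _).comp measurable_fst) ?_)
    exact ((measurable_pi_iff.1 (measurable_noiseSum q) b)).comp measurable_snd
  have hS : MeasurableSet {ω : Randomness | ∑ b ∈ Finset.range n,
      F b (coinNum ω.1 (b * j) j) (noiseSum q ω.2.2 b) ≤ H} := by
    refine measurableSet_le (Finset.measurable_fun_sum _ fun b _ ↦ ?_) measurable_const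
    exact (hmF b).comp (measurable_fst.prodMk (measurable_snd.comp measurable_snd))
  have hmh : Measurable fun c : ℕ → Bool ↦ ∏ b ∈ Finset.range n, h b (coinNum c (b * j) j) :=
    Finset.measurable_fun_prod _ fun b _ ↦
      (Measurable.of_discrete (f := h b)).comp (measurable_coinNum _ _)
  -- Fubini: for fixed coins the terms depend on independent noise blocks and the Chernoff bound
  -- applies; averaging over the coins then factorises over the blocks.
  rw [← lintegral_prod_coinNum, ← lintegral_const_mul _ hmh]
  refine prod_measure_le_of_forall hS fun c₁ ↦ ?_
  set N : Set (ℕ → Bool × Agent → ℝ) := {y | ∑ b ∈ Finset.range n,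
    F b (coinNum c₁ (b * j) j) (y b) ≤ H} with hN
  have hNm : MeasurableSet N := measurableSet_le (Finset.measurable_fun_sum _ fun b _ ↦
    (hF b _).comp (measurable_pi_apply b)) measurable_const
  have hset : Prod.mk c₁ ⁻¹' {ω : Randomness | ∑ b ∈ Finset.range n,
      F b (coinNum ω.1 (b * j) j) (noiseSum q ω.2.2 b) ≤ H} =
      Set.univ ×ˢ ((fun ξ b i ↦ noiseSum q ξ b i) ⁻¹' N) := by
    ext p
    simp [hN]
  rw [hset, Measure.prod_prod, measure_univ, one_mul,
    ← Measure.map_apply (measurable_noiseSum q) hNm, map_noiseSum]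
  refine (infinitePi_sum_le_le _ (fun b ↦ hF b _) _ hc H).trans ?_
  gcongr with b hb
  exact hh b _ (Finset.mem_range.1 hb) (coinNum_lt _ _ _)

/-! ### Tail bounds -/

theorem sum_range_mul {M : Type*} [AddCommMonoid M] (f : ℕ → M) (n q : ℕ) :
    ∑ p ∈ Finset.range (n * q), f p =
      ∑ b ∈ Finset.range n, ∑ t ∈ Finset.range q, f (b * q + t) := by
  induction n with
  | zero => simp
  | succ n ih => rw [Nat.succ_mul, Finset.sum_range_add, Finset.sum_range_succ, ih]

theorem abs_weighted_le {m κ : ℕ} (hκ : κ ≤ m) {ua ub : ℝ}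
    (ha : ua ∈ Set.Icc (0 : ℝ) 1) (hb : ub ∈ Set.Icc (0 : ℝ) 1) : |weighted m κ ua ub| ≤ 1 := by
  rcases Nat.eq_zero_or_pos m with rfl | hm
  · simp [weighted]
  have hm' : (0 : ℝ) < m := by positivity
  have hκ' : (κ : ℝ) ≤ m := by exact_mod_cast hκ
  have hκ0 : (0 : ℝ) ≤ κ := by positivity
  rw [weighted, Nat.cast_sub hκ, abs_div, abs_of_pos hm', div_le_one hm', abs_le]
  constructor <;> nlinarith [ha.1, ha.2, hb.1, hb.2]

/-- A random pick averages the exponential moments inside a block. Jensen's inequality goes the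
wrong way for terms exp(−g r), so bounds of the form 1 − g r are needed unless the block is a single
item. -/
theorem average_le_exp {j : ℕ} {h g : ℕ → ℝ}
    (hg : (j = 0 ∧ h 0 ≤ Real.exp (-g 0)) ∨ ∀ r < 2 ^ j, h r ≤ 1 - g r) :
    (∑ r ∈ Finset.range (2 ^ j), h r) / 2 ^ j ≤
      Real.exp (-((∑ r ∈ Finset.range (2 ^ j), g r) / 2 ^ j)) := by
  rcases hg with ⟨rfl, h0⟩ | hg
  · simpa using h0
  · have h1 : (∑ r ∈ Finset.range (2 ^ j), h r) ≤ 2 ^ j - ∑ r ∈ Finset.range (2 ^ j), g r := by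
      calc _ ≤ ∑ r ∈ Finset.range (2 ^ j), (1 - g r) :=
            Finset.sum_le_sum fun r hr ↦ hg r (Finset.mem_range.1 hr)
        _ = _ := by simp
    have h2 := Real.add_one_le_exp (-((∑ r ∈ Finset.range (2 ^ j), g r) / 2 ^ j))
    have hpos : (0 : ℝ) < 2 ^ j := by positivity
    calc (∑ r ∈ Finset.range (2 ^ j), h r) / 2 ^ j
        ≤ (2 ^ j - ∑ r ∈ Finset.range (2 ^ j), g r) / 2 ^ j := by gcongr
      _ = -((∑ r ∈ Finset.range (2 ^ j), g r) / 2 ^ j) + 1 := by field_simp; ring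
      _ ≤ _ := h2

theorem blockItem_lt {m j b r : ℕ} (hb : b < numBlocks m j) : blockItem m j b r < m := by
  have := lt_numBlocks.1 hb
  unfold blockItem
  split_ifs <;> assumption

theorem le_numBlocks_mul (m j : ℕ) : m ≤ numBlocks m j * 2 ^ j :=
  not_lt.1 fun h ↦ lt_irrefl _ (lt_numBlocks.2 h)

/-- The sign of the item `p` if it is picked from the `b`-th block with the noise `y`. -/
noncomputable def itemSign (m q : ℕ) (U : Agent → ℕ → ℝ) (k i p : ℕ) (y : Bool × Agent → ℝ) : ℝ :=
  choiceSign m q (level k i p) (U .a p) (U .b p) (y (false, .a), y (false, .b))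

theorem measurable_itemSign (m q : ℕ) (U : Agent → ℕ → ℝ) (k i p : ℕ) :
    Measurable (itemSign m q U k i p) :=
  (measurable_choiceSign _ _ _ _ _).comp (by fun_prop)

theorem itemSign_eq (m q : ℕ) (U : Agent → ℕ → ℝ) (k i p : ℕ) (y : Bool × Agent → ℝ) :
    itemSign m q U k i p y = 1 ∨ itemSign m q U k i p y = -1 := choiceSign_eq _ _ _ _ _ _

/-- The weighted difference of the utilities of an item at its level. -/
noncomputable def itemWeight (m : ℕ) (U : Agent → ℕ → ℝ) (k i p : ℕ) : ℝ :=
  weighted m (level k i p) (U .a p) (U .b p)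

/-! ### Lower tails of the gain, of the scoring noise and of the coin-tossed items. -/

section Bounds

variable {σ : ℝ} {m q j : ℕ} {U : Agent → ℕ → ℝ}

/-- A Chernoff bound for the gain of one candidate. Thanks to the tangent at t, the weights enter
only through their sum of absolute values, and the random pick divides the exponent by the block
size. The alternative c ≤ 1 keeps c|θ| in the range of `inv_cosh_le_one_sub`. -/
theorem randomness_sum_sign_mul_weight_le (hσ : σ ≠ 0) (hm : 0 < m) (hq : 0 < q)
    (hU : ∀ ν, ∀ p < m, U ν p ∈ Set.Icc (0 : ℝ) 1) {k i : ℕ} (hki : ∀ p < m, level k i p ≤ m)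
    {c t H : ℝ} (hc : 0 ≤ c) (hcv : c * (8 * √((q * (σ ^ 2).toNNReal : NNReal) : ℝ)) ≤ q)
    (hcj : j = 0 ∨ c ≤ 1) (ht : t ≤ 1) :
    randomness σ {ω | ∑ b ∈ Finset.range (numBlocks m j),
        itemSign m q U k i (pick m j ω.1 b) (noiseSum q ω.2.2 b) *
          itemWeight m U k i (pick m j ω.1 b) ≤ H} ≤
      ENNReal.ofReal (Real.exp (c * H -
        (2 * t * (c * ∑ p ∈ Finset.range m, |itemWeight m U k i p|) - m * t ^ 2) / 4 / 2 ^ j)) := by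
  have hv : (q * (σ ^ 2).toNNReal : NNReal) ≠ 0 := by
    have : 0 < (σ ^ 2).toNNReal := by
      rw [Real.toNNReal_pos]
      positivity
    positivity
  set h : ℕ → ℕ → ℝ := fun b r ↦ (Real.cosh (c * |itemWeight m U k i (blockItem m j b r)|))⁻¹
  -- Positions of the last block beyond m fall back on its first item; they are credited with g = 0,
  -- which suffices as 1/cosh ≤ 1.
  set g : ℕ → ℝ := fun p ↦
    if p < m then (2 * t * (c * |itemWeight m U k i p|) - t ^ 2) / 4 else 0 with hg
  have hh0 : ∀ b r, 0 ≤ h b r := fun b r ↦ inv_nonneg.2 (Real.cosh_pos _).le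
  have hx0 : ∀ p, 0 ≤ c * |itemWeight m U k i p| := fun p ↦ by positivity
  refine (randomness_sum_le_le (F := fun b r y ↦ itemSign m q U k i (blockItem m j b r) y *
    itemWeight m U k i (blockItem m j b r)) (h := fun b r ↦ ENNReal.ofReal (h b r))
    (fun b r ↦ (measurable_itemSign _ _ _ _ _ _).mul_const _) hc ?_).trans ?_
  · intro b r hb hr
    exact lintegral_exp_choiceSign_mul_le hm hq (hki _ (blockItem_lt hb)) hv hc hcv _ _
  · have havg : ∀ b ∈ Finset.range (numBlocks m j),
        (∑ r ∈ Finset.range (2 ^ j), ENNReal.ofReal (h b r)) / 2 ^ j ≤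
        ENNReal.ofReal (Real.exp (-((∑ r ∈ Finset.range (2 ^ j), g (b * 2 ^ j + r)) / 2 ^ j))) := by
      intro b hb
      rw [Finset.mem_range] at hb
      have hb' := lt_numBlocks.1 hb
      rw [← ENNReal.ofReal_sum_of_nonneg (fun r _ ↦ hh0 b r),
        show (2 ^ j : ENNReal) = ENNReal.ofReal (2 ^ j) by
          rw [ENNReal.ofReal_pow (by norm_num), ENNReal.ofReal_ofNat],
        ← ENNReal.ofReal_div_of_pos (by positivity)]
      refine ENNReal.ofReal_le_ofReal (average_le_exp ?_)
      rcases hcj with rfl | hc1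
      · left
        refine ⟨rfl, ?_⟩
        have : blockItem m 0 b 0 = b := by simp [blockItem]
        simp only [h, hg, this]
        simp only [pow_zero, mul_one] at hb'
        simp only [pow_zero, mul_one, add_zero, hb', if_true]
        exact inv_cosh_le_exp (hx0 b) ht
      · right
        intro r hr
        simp only [h, hg, blockItem]
        split_ifs with hlt
        · refine inv_cosh_le_one_sub t (hx0 _) ?_
          have := abs_weighted_le (hki _ hlt) (hU .a _ hlt) (hU .b _ hlt)
          calc c * |itemWeight m U k i (b * 2 ^ j + r)| ≤ 1 * 1 := by gcongr; exact this
            _ = 1 := one_mul 1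
        · rw [sub_zero]
          exact inv_le_one_of_one_le₀ (Real.one_le_cosh _)
    refine (mul_le_mul_right (Finset.prod_le_prod' havg) _).trans (le_of_eq ?_)
    rw [← ENNReal.ofReal_prod_of_nonneg (fun _ _ ↦ (Real.exp_pos _).le), ← Real.exp_sum,
      ← ENNReal.ofReal_mul (Real.exp_pos _).le, ← Real.exp_add, sub_eq_add_neg,
      Finset.sum_neg_distrib, ← Finset.sum_div, ← sum_range_mul]
    congr 4
    have hsum : ∑ p ∈ Finset.range (numBlocks m j * 2 ^ j), g p = ∑ p ∈ Finset.range m, g p := by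
      refine (Finset.sum_subset (Finset.range_subset_range.2 (le_numBlocks_mul m j)) ?_).symm
      intro p _ hp
      rw [Finset.mem_range] at hp
      simp [hg, hp]
    rw [hsum, Finset.sum_congr rfl fun p hp ↦ if_pos (Finset.mem_range.1 hp), ← Finset.sum_div,
      Finset.sum_sub_distrib, ← Finset.mul_sum, ← Finset.mul_sum]
    simp

/-- The signs are computed from the even positions and the scores from the odd ones, so the noise in
the score stays Gaussian whatever candidate is scored. The factor e yields both tails. -/
theorem randomness_sum_sign_mul_noise_le {k i : ℕ} (ν : Agent) {e : ℝ} (he : e = 1 ∨ e = -1)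
    {c H : ℝ} (hc : 0 ≤ c) :
    randomness σ {ω | ∑ b ∈ Finset.range (numBlocks m j),
        e * itemSign m q U k i (pick m j ω.1 b) (noiseSum q ω.2.2 b) *
          noiseSum q ω.2.2 b (true, ν) ≤ H} ≤
      ENNReal.ofReal (Real.exp (c * H + numBlocks m j * (c ^ 2 * (q * σ ^ 2) / 2))) := by
  have hv : ((q * (σ ^ 2).toNNReal : NNReal) : ℝ) = q * σ ^ 2 := by
    simp [Real.coe_toNNReal _ (sq_nonneg σ)]
  refine (randomness_sum_le_le (F := fun b r y ↦
    e * itemSign m q U k i (blockItem m j b r) y * y (true, ν))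
    (h := fun b r ↦ ENNReal.ofReal (Real.exp (c ^ 2 * (q * σ ^ 2) / 2)))
    (fun b r ↦ ((measurable_itemSign _ _ _ _ _ _).const_mul _).mul (by fun_prop)) hc ?_).trans ?_
  · intro b r _ _
    rw [← hv]
    refine (lintegral_exp_sign_mul _ (g := fun x ↦ e * choiceSign m q
      (level k i (blockItem m j b r)) (U .a (blockItem m j b r)) (U .b (blockItem m j b r)) x)
      ((measurable_choiceSign _ _ _ _ _).const_mul _) ?_ c ν).le
    intro x
    rcases he with rfl | rfl <;> rcases choiceSign_eq m q
      (level k i (blockItem m j b r)) (U .a (blockItem m j b r)) (U .b (blockItem m j b r)) x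
      with h | h <;> simp [h]
  · have : ∀ x : ENNReal, (∑ r ∈ Finset.range (2 ^ j), x) / 2 ^ j = x := by
      intro x
      rw [Finset.sum_const, Finset.card_range, nsmul_eq_mul]
      push_cast
      rw [mul_comm, ENNReal.mul_div_cancel_right (by simp) (by simp)]
    simp only [this]
    rw [Finset.prod_const, Finset.card_range, ← ENNReal.ofReal_pow (Real.exp_pos _).le,
      ← ENNReal.ofReal_mul (Real.exp_pos _).le, ← Real.exp_nat_mul, ← Real.exp_add]

/-- The item `p` is picked from one of the blocks. -/
def Picked (m j : ℕ) (c : ℕ → Bool) (p : ℕ) : Prop := ∃ b < numBlocks m j, pick m j c b = p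

/-- The sign of an item that is allocated by a coin toss. -/
def coinSign (x : Bool) : ℝ := if x then 1 else -1

-- Once the design coins fix the set of picked items, this is Hoeffding's bound: an unpicked item
-- has the moment cosh(c U) ≤ exp(c²/2), a picked one has moment 1.
open Classical in
theorem randomness_sum_coinSign_le (hU : ∀ ν, ∀ p < m, U ν p ∈ Set.Icc (0 : ℝ) 1) (ν : Agent)
    {e : ℝ} (he : e = 1 ∨ e = -1) {c H : ℝ} (hc : 0 ≤ c) :
    randomness σ {ω | ∑ p ∈ Finset.range m,
        (if Picked m j ω.1 p then 0 else e * coinSign (ω.2.1 p) * U ν p) ≤ H} ≤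
      ENNReal.ofReal (Real.exp (c * H + m * (c ^ 2 / 2))) := by
  have hP : ∀ p, MeasurableSet {c : ℕ → Bool | Picked m j c p} := by
    intro p
    have : {c : ℕ → Bool | Picked m j c p} = ⋃ b ∈ Finset.range (numBlocks m j),
        (fun c ↦ coinNum c (b * j) j) ⁻¹' {r | blockItem m j b r = p} := by
      ext c
      simp [Picked, pick]
    rw [this]
    exact Finset.measurableSet_biUnion _ fun b _ ↦ measurable_coinNum _ _ (MeasurableSet.of_discrete)
  have hcs : Measurable coinSign := Measurable.of_discrete
  have hS : MeasurableSet {ω : Randomness | ∑ p ∈ Finset.range m,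
        (if Picked m j ω.1 p then 0 else e * coinSign (ω.2.1 p) * U ν p) ≤ H} := by
    refine measurableSet_le (Finset.measurable_fun_sum _ fun p _ ↦ ?_) measurable_const
    refine Measurable.ite (measurable_fst (hP p)) measurable_const ?_
    exact ((hcs.comp (by fun_prop)).const_mul _).mul_const _
  refine (prod_measure_le_of_forall hS (f := fun _ ↦
    ENNReal.ofReal (Real.exp (c * H + m * (c ^ 2 / 2)))) fun c₁ ↦ ?_).trans (by simp)
  set F : ℕ → Bool → ℝ := fun p x ↦ if Picked m j c₁ p then 0 else e * coinSign x * U ν p with hF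
  have hset : Prod.mk c₁ ⁻¹' {ω : Randomness | ∑ p ∈ Finset.range m,
        (if Picked m j ω.1 p then 0 else e * coinSign (ω.2.1 p) * U ν p) ≤ H} =
      {d | ∑ p ∈ Finset.range m, F p (d p) ≤ H} ×ˢ Set.univ := by
    ext p
    simp [hF]
  rw [hset, Measure.prod_prod, measure_univ, mul_one, fairCoins]
  refine (infinitePi_sum_le_le F (fun _ ↦ Measurable.of_discrete) _ hc H).trans ?_
  have hone : ∀ p ∈ Finset.range m, ∫⁻ x, ENNReal.ofReal (Real.exp (-c * F p x))
      ∂(PMF.uniformOfFintype Bool).toMeasure ≤ ENNReal.ofReal (Real.exp (c ^ 2 / 2)) := by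
    intro p hp
    rw [lintegral_fairCoin, ← ENNReal.ofReal_add (Real.exp_pos _).le (Real.exp_pos _).le,
      show (2 : ENNReal) = ENNReal.ofReal 2 by simp, ← ENNReal.ofReal_div_of_pos (by norm_num)]
    refine ENNReal.ofReal_le_ofReal ?_
    by_cases hpk : Picked m j c₁ p
    · simp only [hF, hpk, if_true, mul_zero, Real.exp_zero]
      have := Real.add_one_le_exp (c ^ 2 / 2)
      nlinarith [sq_nonneg c]
    · have h1 := hU ν p (Finset.mem_range.1 hp)
      have h2 : (Real.exp (-c * F p true) + Real.exp (-c * F p false)) / 2 =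
          Real.cosh (c * U ν p) := by
        rw [Real.cosh_eq]
        rcases he with rfl | rfl <;> simp [hF, hpk, coinSign, add_comm]
      rw [h2]
      refine (Real.cosh_le_exp_half_sq _).trans (Real.exp_le_exp.2 ?_)
      have : (U ν p) ^ 2 ≤ 1 := by nlinarith [h1.1, h1.2]
      nlinarith [sq_nonneg c]
  refine (mul_le_mul_right (Finset.prod_le_prod' hone) _).trans (le_of_eq ?_)
  rw [Finset.prod_const, Finset.card_range, ← ENNReal.ofReal_pow (Real.exp_pos _).le,
      ← ENNReal.ofReal_mul (Real.exp_pos _).le, ← Real.exp_nat_mul, ← Real.exp_add]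

end Bounds

/-! ### The allocation computed from typical observations -/

theorem sum_comp_eq_sum_range {m n : ℕ} {pk : ℕ → ℕ}
    (hinj : ∀ b < n, ∀ b' < n, pk b = pk b' → b = b') (hlt : ∀ b < n, pk b < m) (φ : ℕ → ℝ)
    [DecidablePred fun p ↦ ∃ b < n, pk b = p] :
    ∑ b ∈ Finset.range n, φ (pk b) =
      ∑ p ∈ Finset.range m, if ∃ b < n, pk b = p then φ p else 0 := by
  rw [← Finset.sum_filter, ← Finset.sum_image (f := φ) (s := Finset.range n) (g := pk)]
  · refine Finset.sum_congr ?_ fun _ _ ↦ rfl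
    ext p
    simp only [Finset.mem_image, Finset.mem_range, Finset.mem_filter]
    constructor
    · rintro ⟨b, hb, rfl⟩
      exact ⟨hlt b hb, b, hb, rfl⟩
    · exact fun h ↦ h.2
  · intro b hb b' hb' h
    exact hinj b (by simpa using hb) b' (by simpa using hb') h

theorem pick_div {m j : ℕ} (c : ℕ → Bool) (b : ℕ) : pick m j c b / 2 ^ j = b := by
  have h := coinNum_lt c (b * j) j
  have hpos : 0 < 2 ^ j := by positivity
  unfold pick blockItem
  split_ifs
  · rw [mul_comm, Nat.mul_add_div hpos, Nat.div_eq_of_lt h, add_zero]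
  · exact Nat.mul_div_cancel _ hpos

theorem pick_injective {m j : ℕ} (c : ℕ → Bool) : Function.Injective (pick m j c) := by
  intro b b' h
  rw [← pick_div (m := m) (j := j) c b, h, pick_div]

theorem numBlocks_le {m j : ℕ} : numBlocks m j ≤ m := by
  by_contra h
  have h1 := lt_numBlocks.1 (not_le.1 h)
  have : 0 < 2 ^ j := by positivity
  nlinarith

/-- A discrete intermediate value theorem. -/
theorem exists_le_and_le {f g : ℕ → ℝ} {K : ℝ} {M : ℕ} (h : ∀ τ ≤ M, K ≤ f τ ∨ K ≤ g τ)
    (hf : K ≤ f M) (hg : K ≤ g 0) (hstep : ∀ τ < M, g τ - 2 ≤ g (τ + 1)) :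
    ∃ τ ≤ M, K - 2 ≤ f τ ∧ K - 2 ≤ g τ := by
  classical
  -- At the first time when f reaches K, g was still at least K one step earlier and has lost at
  -- most 2 since.
  have hex : ∃ τ, K ≤ f τ := ⟨M, hf⟩
  have hM : Nat.find hex ≤ M := Nat.find_min' hex hf
  refine ⟨Nat.find hex, hM, by linarith [Nat.find_spec hex], ?_⟩
  rcases Nat.eq_zero_or_pos (Nat.find hex) with h0 | h0
  · rw [h0]
    linarith
  · obtain ⟨τ, hτ⟩ := Nat.exists_eq_add_of_lt h0
    rw [zero_add] at hτ
    have hn := Nat.find_min hex (show τ < Nat.find hex by omega)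
    have h1 := (h τ (by omega)).resolve_left hn
    have h2 := hstep τ (by omega)
    rw [hτ]
    linarith

/-! ### The path of candidates from weight 0 to weight 1. -/

section Path

variable {m q j : ℕ} {U : Agent → ℕ → ℝ} {pk : ℕ → ℕ} {y : ℕ → Bool × Agent → ℝ} {n : ℕ}

/-- The sum of the utilities of the picked items, with the signs of a candidate. -/
noncomputable def candidateSum (m q : ℕ) (U : Agent → ℕ → ℝ) (pk : ℕ → ℕ)
    (y : ℕ → Bool × Agent → ℝ) (n : ℕ) (ν : Agent) (k i : ℕ) : ℝ :=
  ∑ b ∈ Finset.range n, itemSign m q U k i (pk b) (y b) * U ν (pk b)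

theorem weighted_succ_sub {k : ℕ} (hk : k + 1 ≤ m) (ua ub : ℝ) :
    weighted m (k + 1) ua ub - weighted m k ua ub = (ua + ub) / m := by
  rw [weighted, weighted, Nat.cast_sub hk, Nat.cast_sub (by omega)]
  push_cast
  ring

/-- A candidate mixes the levels k and k + 1. Treating all items at level k costs at most 2/m per
item, hence at most 2 in total. -/
theorem abs_itemWeight_sub_le {k i p : ℕ} (hU : ∀ ν, U ν p ∈ Set.Icc (0 : ℝ) 1)
    (hl : level k i p ≤ m) : |itemWeight m U k i p - weighted m k (U .a p) (U .b p)| ≤ 2 / m := by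
  have ha := hU .a
  have hb := hU .b
  unfold itemWeight
  unfold level at hl ⊢
  split_ifs at hl ⊢
  · rw [weighted_succ_sub hl, abs_of_nonneg (div_nonneg (by linarith [ha.1, hb.1]) (by positivity))]
    gcongr
    linarith [ha.2, hb.2]
  · simp only [sub_self, abs_zero]
    positivity

/-- The candidates are numbered by τ = k m + i. A step of τ raises the level of the item τ % m
alone, also when i wraps from m − 1 to 0 and k increases. -/
theorem level_div_mod_succ {τ p : ℕ} (hp : p < m) (hne : p ≠ τ % m) :
    level ((τ + 1) / m) ((τ + 1) % m) p = level (τ / m) (τ % m) p := by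
  have hm : 0 < m := by omega
  have h1 := Nat.div_add_mod τ m
  have h2 := Nat.mod_lt τ hm
  by_cases h : τ % m + 1 < m
  · have h3 : (τ + 1) / m = τ / m := by
      conv_lhs => rw [← h1, add_assoc]
      rw [Nat.mul_add_div hm, Nat.div_eq_of_lt h, add_zero]
    have h4 : (τ + 1) % m = τ % m + 1 := by
      conv_lhs => rw [← h1, add_assoc]
      rw [Nat.mul_add_mod, Nat.mod_eq_of_lt h]
    rw [h3, h4]
    unfold level
    split_ifs <;> omega
  · have h5 : τ + 1 = m * (τ / m + 1) := by
      rw [mul_add, mul_one]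
      omega
    have h3 : (τ + 1) / m = τ / m + 1 := by
      rw [h5, Nat.mul_div_cancel_left _ hm]
    have h4 : (τ + 1) % m = 0 := by
      rw [h5, Nat.mul_mod_right]
    rw [h3, h4]
    unfold level
    split_ifs <;> omega

/-- The two advantages averaged with weights k/m and 1 − k/m are at least H − 2, so one of them is.
At k = 0 it is that of `b`, at k = m that of `a`, and the intermediate value argument makes both at
least H − 4. -/
theorem exists_balanced_candidate (hm : 0 < m) (hinj : Function.Injective pk)
    (hlt : ∀ b < n, pk b < m) (hn : n ≤ m) (hU : ∀ ν, ∀ p < m, U ν p ∈ Set.Icc (0 : ℝ) 1) {H : ℝ}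
    (hH : ∀ k ≤ m, ∀ i < m, (∀ p < m, level k i p ≤ m) →
      H ≤ ∑ b ∈ Finset.range n, itemSign m q U k i (pk b) (y b) * itemWeight m U k i (pk b)) :
    ∃ k ≤ m, ∃ i < m, H - 4 ≤ candidateSum m q U pk y n .a k i ∧
      H - 4 ≤ -candidateSum m q U pk y n .b k i := by
  classical
  have hm' : (0 : ℝ) < m := by positivity
  -- The path stops at τ = m·m, that is k = m and i = 0. The program also tries k = m with i > 0,
  -- where some level is m + 1; those candidates need no lower bound on the gain.
  have hlevel : ∀ τ ≤ m * m, τ / m ≤ m ∧ τ % m < m ∧ ∀ p < m, level (τ / m) (τ % m) p ≤ m := by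
    intro τ hτ
    have h1 : τ / m ≤ m := Nat.div_le_of_le_mul hτ
    refine ⟨h1, Nat.mod_lt _ hm, fun p hp ↦ ?_⟩
    unfold level
    split_ifs with h
    · rcases hτ.lt_or_eq with h2 | rfl
      · exact Nat.div_lt_of_lt_mul h2
      · simp at h
    · exact h1
  have hsum : ∀ k ≤ m, ∀ i < m, (∀ p < m, level k i p ≤ m) →
      H - 2 ≤ (k / m) * candidateSum m q U pk y n .a k i +
        (1 - k / m) * -candidateSum m q U pk y n .b k i := by
    intro k hk i hi hl
    have h1 := hH k hk i hi hl
    have h2 : ∑ b ∈ Finset.range n, itemSign m q U k i (pk b) (y b) * itemWeight m U k i (pk b) ≤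
        ∑ b ∈ Finset.range n, (itemSign m q U k i (pk b) (y b) *
          weighted m k (U .a (pk b)) (U .b (pk b)) + 2 / m) := by
      refine Finset.sum_le_sum fun b hb ↦ ?_
      have hb := hlt b (Finset.mem_range.1 hb)
      have h3 := abs_le.1 (abs_itemWeight_sub_le (i := i) (fun ν ↦ hU ν _ hb) (hl _ hb))
      rcases itemSign_eq m q U k i (pk b) (y b) with h | h <;> rw [h] <;> linarith [h3.1, h3.2]
    rw [Finset.sum_add_distrib, Finset.sum_const, Finset.card_range, nsmul_eq_mul] at h2
    have h4 : (n : ℝ) * (2 / m) ≤ 2 := by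
      rw [← mul_div_assoc, div_le_iff₀ hm', mul_comm]
      have : (n : ℝ) ≤ m := by exact_mod_cast hn
      linarith
    have h5 : ∑ b ∈ Finset.range n, itemSign m q U k i (pk b) (y b) *
          weighted m k (U .a (pk b)) (U .b (pk b)) =
        (k / m) * candidateSum m q U pk y n .a k i +
          (1 - k / m) * -candidateSum m q U pk y n .b k i := by
      rw [candidateSum, candidateSum, ← Finset.sum_neg_distrib, Finset.mul_sum, Finset.mul_sum,
        ← Finset.sum_add_distrib]
      refine Finset.sum_congr rfl fun b _ ↦ ?_
      rw [weighted, Nat.cast_sub hk]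
      field_simp
      ring
    linarith
  suffices h : ∃ τ ≤ m * m, H - 2 - 2 ≤ candidateSum m q U pk y n .a (τ / m) (τ % m) ∧
      H - 2 - 2 ≤ -candidateSum m q U pk y n .b (τ / m) (τ % m) by
    obtain ⟨τ, hτ, ha, hb⟩ := h
    exact ⟨τ / m, (hlevel τ hτ).1, τ % m, (hlevel τ hτ).2.1, by linarith, by linarith⟩
  refine exists_le_and_le (f := fun τ ↦ candidateSum m q U pk y n .a (τ / m) (τ % m))
    (g := fun τ ↦ -candidateSum m q U pk y n .b (τ / m) (τ % m)) ?_ ?_ ?_ ?_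
  · intro τ hτ
    obtain ⟨h1, h2, h3⟩ := hlevel τ hτ
    have h := hsum _ h1 _ h2 h3
    by_contra hcon
    rw [not_or, not_le, not_le] at hcon
    have hk : ((τ / m : ℕ) : ℝ) / m ≤ 1 := by
      rw [div_le_one hm']
      exact_mod_cast h1
    have hk0 : 0 ≤ ((τ / m : ℕ) : ℝ) / m := by positivity
    rcases hk0.eq_or_lt with h0 | h0
    · rw [← h0] at h
      linarith [hcon.2]
    · nlinarith [hcon.1, hcon.2]
  · obtain ⟨h1, h2, h3⟩ := hlevel (m * m) le_rfl
    have h := hsum _ h1 _ h2 h3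
    rw [Nat.mul_div_cancel _ hm] at h
    simp only [Nat.mul_div_cancel _ hm]
    rw [div_self hm'.ne'] at h
    linarith
  · obtain ⟨h1, h2, h3⟩ := hlevel 0 (by positivity)
    have h := hsum _ h1 _ h2 h3
    simpa using h
  · intro τ hτ
    -- Only the sign of the item τ % m can change. At most one block picks this item and its utility
    -- is at most 1, so the sum moves by at most 2.
    have h : candidateSum m q U pk y n .b ((τ + 1) / m) ((τ + 1) % m) ≤
        candidateSum m q U pk y n .b (τ / m) (τ % m) +
        ∑ b ∈ Finset.range n, if pk b = τ % m then (2 : ℝ) else 0 := by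
      rw [candidateSum, candidateSum, ← Finset.sum_add_distrib]
      refine Finset.sum_le_sum fun b hb ↦ ?_
      have hb := hlt b (Finset.mem_range.1 hb)
      have hUb := hU .b _ hb
      split_ifs with hpb
      · rcases itemSign_eq m q U ((τ + 1) / m) ((τ + 1) % m) (pk b) (y b) with h | h <;>
        rcases itemSign_eq m q U (τ / m) (τ % m) (pk b) (y b) with h' | h' <;>
        rw [h, h'] <;> linarith [hUb.1, hUb.2]
      · rw [itemSign, itemSign, level_div_mod_succ hb hpb, add_zero]
    have h2 : ∑ b ∈ Finset.range n, (if pk b = τ % m then (2 : ℝ) else 0) ≤ 2 := by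
      rw [sum_comp_eq_sum_range (m := m) (n := n) (fun b _ b' _ h ↦ hinj h) hlt
        (fun p ↦ if p = τ % m then (2 : ℝ) else 0)]
      calc _ ≤ ∑ p ∈ Finset.range m, if p = τ % m then (2 : ℝ) else 0 := by
            refine Finset.sum_le_sum fun p _ ↦ ?_
            split_ifs <;> norm_num
        _ ≤ 2 := by
            rw [Finset.sum_ite_eq']
            split_ifs <;> norm_num
    linarith

end Path

/-! ### From typical noise and coins to an envy-free output. -/

section Run

variable {m q j : ℕ} {U : Agent → ℕ → ℝ} {c : ℕ → Bool} {ξ : ℕ × Agent → ℝ}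

theorem groupSum_eq {f : ℕ → ℕ} {y : ℕ → ℝ} {ν : Agent} (o : Bool)
    (hf : ∀ l < 2 * (numBlocks m j * q), f l = pick m j c (l / (2 * q)))
    (hy : ∀ l < 2 * (numBlocks m j * q), y l = U ν (f l) + ξ (l, ν)) (i : ℕ) :
    groupSum f y o.toNat (numBlocks m j * q) i =
      ∑ b ∈ Finset.range (numBlocks m j), if pick m j c b = i then
        q * U ν (pick m j c b) + noiseSum q ξ b (o, ν) else 0 := by
  have ho := Bool.toNat_le o
  rw [groupSum, sum_range_mul]
  refine Finset.sum_congr rfl fun b hb ↦ ?_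
  rw [Finset.mem_range] at hb
  have hlt : ∀ t < q, b * q + t < numBlocks m j * q := by
    intro t ht
    calc b * q + t < (b + 1) * q := by rw [add_mul, one_mul]; omega
      _ ≤ _ := Nat.mul_le_mul_right q hb
  have hpick : ∀ t < q, ∀ o' ≤ 1, f (2 * (b * q + t) + o') = pick m j c b := by
    intro t ht o' ho'
    have := hlt t ht
    rw [hf _ (by omega), ← Nat.div_div_eq_div_mul,
      show (2 * (b * q + t) + o') / 2 = b * q + t by omega, mul_comm b,
      Nat.mul_add_div (by omega), Nat.div_eq_of_lt ht, add_zero]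
  have h0 : ∀ t ∈ Finset.range q, (if f (2 * (b * q + t)) = i then
      y (2 * (b * q + t) + o.toNat) else 0) =
      if pick m j c b = i then U ν (pick m j c b) + ξ (2 * (b * q + t) + o.toNat, ν) else 0 := by
    intro t ht
    rw [Finset.mem_range] at ht
    have := hlt t ht
    have h1 := hpick t ht 0 (by omega)
    rw [add_zero] at h1
    rw [h1, hy _ (by omega), hpick t ht _ ho]
  rw [Finset.sum_congr rfl h0]
  split_ifs
  · rw [Finset.sum_add_distrib, noiseSum, ← Fin.sum_univ_eq_sum_range (fun t ↦
      ξ (2 * (b * q + t) + o.toNat, ν))]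
    simp
  · simp

theorem groupSum_pick {f : ℕ → ℕ} {y : ℕ → ℝ} {ν : Agent} (o : Bool)
    (hf : ∀ l < 2 * (numBlocks m j * q), f l = pick m j c (l / (2 * q)))
    (hy : ∀ l < 2 * (numBlocks m j * q), y l = U ν (f l) + ξ (l, ν)) {b : ℕ}
    (hb : b < numBlocks m j) :
    groupSum f y o.toNat (numBlocks m j * q) (pick m j c b) =
      q * U ν (pick m j c b) + noiseSum q ξ b (o, ν) := by
  rw [groupSum_eq o hf hy, Finset.sum_eq_single b]
  · simp
  · intro b' _ hne
    rw [if_neg]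
    exact fun h ↦ hne (pick_injective c h)
  · simp [hb]

/-- The noise and the coins are typical. -/
structure Typical (m q j : ℕ) (U : Agent → ℕ → ℝ) (H : ℝ) (ω : Randomness) : Prop where
  weight : ∀ k ≤ m, ∀ i < m, (∀ p < m, level k i p ≤ m) →
    H < ∑ b ∈ Finset.range (numBlocks m j), itemSign m q U k i (pick m j ω.1 b)
      (noiseSum q ω.2.2 b) * itemWeight m U k i (pick m j ω.1 b)
  noise : ∀ k ≤ m, ∀ i < m, ∀ ν : Agent, ∀ e : ℝ, e = 1 ∨ e = -1 →
    -(q * H / 8) < ∑ b ∈ Finset.range (numBlocks m j),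
      e * itemSign m q U k i (pick m j ω.1 b) (noiseSum q ω.2.2 b) * noiseSum q ω.2.2 b (true, ν)
  coin : ∀ ν : Agent, ∀ e : ℝ, e = 1 ∨ e = -1 → ∀ _ : DecidablePred (Picked m j ω.1),
    -(H / 4) < ∑ p ∈ Finset.range m,
      if Picked m j ω.1 p then 0 else e * coinSign (ω.2.1 p) * U ν p

/-- The balanced candidate guarantees a large best score. The candidate actually chosen then has
advantages of at least H/4 for both agents on the queried items, and the coin-tossed items lose less
than H/4. -/
theorem Typical.sum_nonneg {H : ℝ} {ω : Randomness} (h : Typical m q j U H ω) (hm : 0 < m)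
    (hq : 0 < q) (hH : 16 ≤ H) (hU : ∀ ν, ∀ p < m, U ν p ∈ Set.Icc (0 : ℝ) 1)
    {f : ℕ → ℕ} {y : Agent → ℕ → ℝ}
    (hf : ∀ l < 2 * (numBlocks m j * q), f l = pick m j ω.1 (l / (2 * q)))
    (hy : ∀ ν, ∀ l < 2 * (numBlocks m j * q), y ν l = U ν (f l) + ω.2.2 (l, ν))
    {best : ℝ} {out : ℕ → ℕ} {qd : ℕ → ℕ} (hqd : ∀ p, 0 < qd p ↔ Picked m j ω.1 p)
    (hbest : IsBest m (groupSum f (y .a) 0 (numBlocks m j * q))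
      (groupSum f (y .b) 0 (numBlocks m j * q)) (groupSum f (y .a) 1 (numBlocks m j * q))
      (groupSum f (y .b) 1 (numBlocks m j * q)) qd (fun i ↦ (ω.2.1 i).toNat) best out
      (fun k i ↦ k < m + 1 ∧ i < m)) :
    0 ≤ ∑ p ∈ Finset.range m, (if out p = 0 then -1 else 1) * U .a p ∧
      ∑ p ∈ Finset.range m, (if out p = 0 then -1 else 1) * U .b p ≤ 0 := by
  classical
  set n := numBlocks m j with hn
  set pk := pick m j ω.1 with hpk
  have hq' : (0 : ℝ) < q := by positivity
  have hlt : ∀ b < n, pk b < m := fun b hb ↦ pick_lt _ hb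
  have hinj : Function.Injective pk := pick_injective _
  have hsign : ∀ k i, ∀ b < n,
      itemSign m q U k i (pk b) (noiseSum q ω.2.2 b) =
        if Prefers m (groupSum f (y .a) 0 (n * q)) (groupSum f (y .b) 0 (n * q)) k i (pk b)
        then 1 else -1 := by
    intro k i b hb
    have ha := groupSum_pick false hf (hy .a) hb
    have hb := groupSum_pick false hf (hy .b) hb
    simp only [Bool.toNat_false] at ha hb
    unfold itemSign choiceSign Prefers
    rw [ha, hb]
  -- A score is q times the true signed sum plus a sum of fresh noise, because the odd answers for a
  -- picked item have mean q U.
  have hscore : ∀ ν k i, score m (groupSum f (y .a) 0 (n * q)) (groupSum f (y .b) 0 (n * q))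
      (groupSum f (y ν) 1 (n * q)) k i = q * candidateSum m q U pk (noiseSum q ω.2.2) n ν k i +
        ∑ b ∈ Finset.range n, itemSign m q U k i (pk b) (noiseSum q ω.2.2 b) *
          noiseSum q ω.2.2 b (true, ν) := by
    intro ν k i
    have hz : ∀ p, groupSum f (y ν) 1 (n * q) p = ∑ b ∈ Finset.range n, if pk b = p then
        q * U ν (pk b) + noiseSum q ω.2.2 b (true, ν) else 0 := fun p ↦ groupSum_eq true hf (hy ν) p
    have h1 : ∀ p ∈ Finset.range m, (if Prefers m (groupSum f (y .a) 0 (n * q))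
        (groupSum f (y .b) 0 (n * q)) k i p then groupSum f (y ν) 1 (n * q) p
        else -groupSum f (y ν) 1 (n * q) p) = ∑ b ∈ Finset.range n, if pk b = p then
          (if Prefers m (groupSum f (y .a) 0 (n * q)) (groupSum f (y .b) 0 (n * q)) k i (pk b)
            then 1 else -1) * (q * U ν (pk b) + noiseSum q ω.2.2 b (true, ν)) else 0 := by
      intro p _
      rw [hz]
      split_ifs with hp
      · refine Finset.sum_congr rfl fun b _ ↦ ?_
        by_cases h : pk b = p
        · simp [h, hp]
        · simp [h]
      · rw [← Finset.sum_neg_distrib]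
        refine Finset.sum_congr rfl fun b _ ↦ ?_
        by_cases h : pk b = p
        · simp [h, hp]
        · simp [h]
    rw [score, Finset.sum_congr rfl h1, Finset.sum_comm, candidateSum, Finset.mul_sum,
      ← Finset.sum_add_distrib]
    refine Finset.sum_congr rfl fun b hb ↦ ?_
    rw [Finset.mem_range] at hb
    rw [Finset.sum_ite_eq, if_pos (Finset.mem_range.2 (hlt b hb)), hsign k i b hb]
    ring
  have hnoise : ∀ k ≤ m, ∀ i < m, ∀ ν, |∑ b ∈ Finset.range n,
      itemSign m q U k i (pk b) (noiseSum q ω.2.2 b) * noiseSum q ω.2.2 b (true, ν)| ≤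
        q * H / 8 := by
    intro k hk i hi ν
    have h1 := h.noise k hk i hi ν 1 (Or.inl rfl)
    have h2 := h.noise k hk i hi ν (-1) (Or.inr rfl)
    simp only [one_mul] at h1
    simp only [neg_mul, one_mul, Finset.sum_neg_distrib] at h2
    rw [abs_le]
    exact ⟨h1.le, by linarith⟩
  obtain ⟨k₀, hk₀, i₀, hi₀, ha₀, hb₀⟩ := exists_balanced_candidate (n := n)
    (y := noiseSum q ω.2.2) (q := q) hm hinj hlt
    numBlocks_le hU (fun k hk i hi hl ↦ (h.weight k hk i hi hl).le)
  have hlow : q * (H - 4) - q * H / 8 ≤ best := by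
    refine le_trans (le_min ?_ ?_) (hbest.1 k₀ i₀ ⟨by omega, hi₀⟩)
    · rw [hscore .a]
      have h1 := abs_le.1 (hnoise k₀ hk₀ i₀ hi₀ .a)
      have := mul_le_mul_of_nonneg_left ha₀ hq'.le
      linarith [h1.1]
    · rw [hscore .b]
      have h1 := abs_le.1 (hnoise k₀ hk₀ i₀ hi₀ .b)
      have := mul_le_mul_of_nonneg_left hb₀ hq'.le
      linarith [h1.2]
  -- Positive because H ≥ 16; this excludes that the initial value 0 was never improved and the
  -- output is entirely random.
  have hpos : 0 < best := by nlinarith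
  rcases hbest.2 with ⟨h0, -⟩ | ⟨k, i, ⟨hk, hi⟩, hsa, hsb, hout⟩
  · exact absurd h0 hpos.ne'
  have hk : k ≤ m := by omega
  -- Two scoring errors of H/8 each are lost, one for the balanced candidate and one for the chosen
  -- one: H − 4 − H/8 − H/8 ≥ H/4.
  have hVa : H / 4 ≤ candidateSum m q U pk (noiseSum q ω.2.2) n .a k i := by
    rw [hscore .a] at hsa
    have h1 := abs_le.1 (hnoise k hk i hi .a)
    refine le_of_mul_le_mul_left (a := (q : ℝ)) ?_ hq'
    nlinarith [h1.2]
  have hVb : H / 4 ≤ -candidateSum m q U pk (noiseSum q ω.2.2) n .b k i := by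
    rw [hscore .b] at hsb
    have h1 := abs_le.1 (hnoise k hk i hi .b)
    refine le_of_mul_le_mul_left (a := (q : ℝ)) ?_ hq'
    nlinarith [h1.1]
  have htotal : ∀ ν, ∑ p ∈ Finset.range m, (if out p = 0 then -1 else 1) * U ν p =
      candidateSum m q U pk (noiseSum q ω.2.2) n ν k i + ∑ p ∈ Finset.range m,
        if Picked m j ω.1 p then 0 else coinSign (ω.2.1 p) * U ν p := by
    intro ν
    have h1 : candidateSum m q U pk (noiseSum q ω.2.2) n ν k i =
        ∑ b ∈ Finset.range n, (fun p ↦ (if out p = 0 then -1 else 1) * U ν p) (pk b) := by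
      refine Finset.sum_congr rfl fun b hb ↦ ?_
      rw [Finset.mem_range] at hb
      have h2 : 0 < qd (pk b) := (hqd _).2 ⟨b, hb, rfl⟩
      have h3 := hout _ (hlt b hb)
      rw [if_pos h2] at h3
      rw [hsign k i b hb]
      simp only [h3]
      split_ifs <;> simp_all
    have h4 := sum_comp_eq_sum_range (fun b _ b' _ h ↦ hinj h) hlt
      (fun p ↦ (if out p = 0 then -1 else 1) * U ν p)
    rw [h1, h4, ← Finset.sum_add_distrib]
    refine Finset.sum_congr rfl fun p hp ↦ ?_
    rw [Finset.mem_range] at hp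
    by_cases hpp : Picked m j ω.1 p
    · have : ∃ b < n, pk b = p := hpp
      simp [hpp, this]
    · have h2 : ¬ ∃ b < n, pk b = p := hpp
      have h3 : ¬ 0 < qd p := fun h ↦ hpp ((hqd p).1 h)
      rw [hout p hp, if_neg h2, if_neg h3, if_neg hpp, zero_add, coinSign]
      rcases hx : ω.2.1 p with _ | _ <;> simp [hx]
  rw [htotal, htotal]
  have hca := h.coin .a 1 (Or.inl rfl) inferInstance
  have hcb := h.coin .b (-1) (Or.inr rfl) inferInstance
  simp only [one_mul] at hca
  have hcb' : -(H / 4) < -∑ p ∈ Finset.range m,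
      if Picked m j ω.1 p then 0 else coinSign (ω.2.1 p) * U .b p := by
    refine hcb.trans_le (le_of_eq ?_)
    rw [← Finset.sum_neg_distrib]
    refine Finset.sum_congr rfl fun p _ ↦ ?_
    split_ifs <;> ring
  exact ⟨by linarith, by linarith⟩

end Run

/-! ### The runs of the algorithm -/

/-- The algorithm. -/
def algorithm : NonadaptiveAlgorithm := ⟨designProgram, allocateProgram⟩

theorem div_lt_numBlocks {m j q l : ℕ} (h : l < 2 * (numBlocks m j * q)) :
    l / (2 * q) < numBlocks m j :=
  Nat.div_lt_of_lt_mul (by linarith [mul_comm (numBlocks m j) q, mul_assoc 2 q (numBlocks m j)])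

/-- The list of the queries. -/
def queryList (m q j : ℕ) (c : ℕ → Bool) : List (Fin m) :=
  List.ofFn fun l : Fin (2 * (numBlocks m j * q)) ↦
    ⟨pick m j c (l / (2 * q)), pick_lt c (div_lt_numBlocks l.2)⟩

theorem length_queryList (m q j : ℕ) (c : ℕ → Bool) :
    (queryList m q j c).length = 2 * (numBlocks m j * q) := List.length_ofFn

theorem queryList_get {m q j : ℕ} {c : ℕ → Bool} {l : ℕ} (h : l < (queryList m q j c).length) :
    ((queryList m q j c).get ⟨l, h⟩ : ℕ) = pick m j c (l / (2 * q)) := by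
  simp [queryList]

/-- The conditions under which the loops of `designProgram` end with `q` repetitions and blocks of
size `2 ^ j`. -/
structure IsDesign (m : ℕ) (Δ : ℝ) (q j : ℕ) : Prop where
  pos : 0 < q
  lt : ∀ n < q, ((n : ℝ) * n) * ((Δ * Δ) * (Δ * Δ)) < (m * (m * m)) * (m.size * m.size)
  ge : ¬ ((q : ℝ) * q) * ((Δ * Δ) * (Δ * Δ)) < (m * (m * m)) * (m.size * m.size)
  le : ∀ n < j, (2 ^ n + 2 ^ n) * ((2 : ℝ) ^ n + 2 ^ n) * ((m * (m * m)) * (m.size * m.size)) ≤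
      (Δ * Δ) * (Δ * Δ)
  gt : (Δ * Δ) * (Δ * Δ) <
      (2 ^ j + 2 ^ j) * ((2 : ℝ) ^ j + 2 ^ j) * ((m * (m * m)) * (m.size * m.size))

theorem IsDesign.designs {m : ℕ} {Δ : ℝ} {q j T : ℕ} (h : IsDesign m Δ q j)
    (hT : m.size * 3 + q * 2 + j * 3 + 6 + numBlocks m j * (4 * j + 8 * q + 10) ≤ T)
    (c : ℕ → Bool) : algorithm.Designs Δ c T (queryList m q j c) := by
  obtain ⟨t, ht, s, he, hlen, hs⟩ :=
    designProgram_runs (coins := c) q j h.pos h.lt h.ge h.le h.gt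
  have heq : 2 * q * numBlocks m j = 2 * (numBlocks m j * q) := by ring
  rw [heq] at hlen hs
  refine ⟨t, ht.trans hT, s, he, by rw [hlen, length_queryList], fun l ↦ ?_⟩
  rw [queryList_get, hs l (by rw [← length_queryList (c := c)]; exact l.2)]

/-- The answers are arbitrary here, so halting in time does not depend on typical noise. -/
theorem allocates {m q j T : ℕ}
    (hT : m * 3 + numBlocks m j * q * 9 + (m + 1) * (m * (m * 12 + 11) + 4) + 3 ≤ T)
    (c c' : ℕ → Bool) (y : Fin (queryList m q j c).length → Agent → ℝ) :
    ∃ (A : Allocation m) (out : ℕ → ℕ) (best : ℝ),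
      algorithm.Allocates (queryList m q j c) y c' T A ∧
      (∀ i : Fin m, A i = if out i = 0 then .b else .a) ∧
      IsBest m
        (groupSum ((allocateInput (queryList m q j c) y).nat 2)
          ((allocateInput (queryList m q j c) y).real 0) 0 (numBlocks m j * q))
        (groupSum ((allocateInput (queryList m q j c) y).nat 2)
          ((allocateInput (queryList m q j c) y).real 1) 0 (numBlocks m j * q))
        (groupSum ((allocateInput (queryList m q j c) y).nat 2)
          ((allocateInput (queryList m q j c) y).real 0) 1 (numBlocks m j * q))
        (groupSum ((allocateInput (queryList m q j c) y).nat 2)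
          ((allocateInput (queryList m q j c) y).real 1) 1 (numBlocks m j * q))
        (fun i ↦ if ∃ p < numBlocks m j * q,
          (allocateInput (queryList m q j c) y).nat 2 (2 * p) = i then 1 else 0)
        (fun i ↦ (c' i).toNat) best out (fun k i ↦ k < m + 1 ∧ i < m) := by
  have hnat : ∀ k, 3 ≤ k → (allocateInput (queryList m q j c) y).nat k = fun _ ↦ 0 := by
    intro k hk
    obtain ⟨k, rfl⟩ := Nat.exists_eq_add_of_le' hk
    rfl
  have hreal : ∀ k, 2 ≤ k → (allocateInput (queryList m q j c) y).real k = fun _ ↦ 0 := by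
    intro k hk
    obtain ⟨k, rfl⟩ := Nat.exists_eq_add_of_le' hk
    rfl
  obtain ⟨t, ht, s, he, best, hb⟩ := allocateProgram_runs (m := m) (coins := c')
    (s := allocateInput (queryList m q j c) y) (N := numBlocks m j * q)
    rfl (length_queryList m q j c) rfl hnat rfl rfl hreal rfl
  exact ⟨fun i ↦ if s.nat 3 i = 0 then .b else .a, s.nat 3, best,
    ⟨t, ht.trans hT, s, he, fun i ↦ rfl⟩, fun i ↦ rfl, hb⟩

/-- The utilities, extended by zero. -/
noncomputable def extend {m : ℕ} (u : Agent → Fin m → ℝ) (ν : Agent) (p : ℕ) : ℝ :=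
  if h : p < m then u ν ⟨p, h⟩ else 0

theorem extend_mem {m : ℕ} {u : Agent → Fin m → ℝ} (hu : ∀ ν i, u ν i ∈ Set.Icc (0 : ℝ) 1) :
    ∀ ν, ∀ p < m, extend u ν p ∈ Set.Icc (0 : ℝ) 1 := by
  intro ν p hp
  rw [extend, dif_pos hp]
  exact hu ν _

/-- The sign of an item in an allocation. -/
def agentSign : Agent → ℝ
  | .a => 1
  | .b => -1

theorem envyOf_a {m : ℕ} (u : Agent → Fin m → ℝ) (A : Allocation m) :
    envyOf u A .a = -∑ i, agentSign (A i) * u .a i := by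
  rw [envyOf, Finset.sum_filter, Finset.sum_filter, ← Finset.sum_sub_distrib,
    ← Finset.sum_neg_distrib]
  refine Finset.sum_congr rfl fun i _ ↦ ?_
  cases A i <;> simp [Agent.other, agentSign]

theorem envyOf_b {m : ℕ} (u : Agent → Fin m → ℝ) (A : Allocation m) :
    envyOf u A .b = ∑ i, agentSign (A i) * u .b i := by
  rw [envyOf, Finset.sum_filter, Finset.sum_filter, ← Finset.sum_sub_distrib]
  refine Finset.sum_congr rfl fun i _ ↦ ?_
  cases A i <;> simp [Agent.other, agentSign]

theorem Typical.succeeds {m q j T : ℕ} {Δ H : ℝ} {ω : Randomness} {u : Agent → Fin m → ℝ}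
    (h : Typical m q j (extend u) H ω) (hd : IsDesign m Δ q j) (hm : 0 < m)
    (hu : ∀ ν i, u ν i ∈ Set.Icc (0 : ℝ) 1) (hH : 16 ≤ H)
    (hT : m.size * 3 + q * 2 + j * 3 + 6 + numBlocks m j * (4 * j + 8 * q + 10) ≤ T)
    (hT' : m * 3 + numBlocks m j * q * 9 + (m + 1) * (m * (m * 12 + 11) + 4) + 3 ≤ T) :
    algorithm.Succeeds u Δ T ω := by
  set Q := queryList m q j ω.1 with hQ
  obtain ⟨A, out, best, hA, hout, hb⟩ := allocates hT' ω.1 ω.2.1 (answers u Q ω.2.2)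
  refine ⟨Q, A, hd.designs hT ω.1, hA, ?_⟩
  have hlen : Q.length = 2 * (numBlocks m j * q) := length_queryList m q j ω.1
  have hf : ∀ l < 2 * (numBlocks m j * q), (allocateInput Q (answers u Q ω.2.2)).nat 2 l =
      pick m j ω.1 (l / (2 * q)) := by
    intro l hl
    have : (allocateInput Q (answers u Q ω.2.2)).nat 2 l =
      if h : l < Q.length then (Q.get ⟨l, h⟩ : ℕ) else 0 := rfl
    rw [this, dif_pos (by omega), queryList_get]
  set y : Agent → ℕ → ℝ := fun ν l ↦
    if h : l < Q.length then answers u Q ω.2.2 ⟨l, h⟩ ν else 0 with hy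
  have hyl : ∀ ν, ∀ l < 2 * (numBlocks m j * q), y ν l =
      extend u ν ((allocateInput Q (answers u Q ω.2.2)).nat 2 l) + ω.2.2 (l, ν) := by
    intro ν l hl
    have : (allocateInput Q (answers u Q ω.2.2)).nat 2 l =
      if h : l < Q.length then (Q.get ⟨l, h⟩ : ℕ) else 0 := rfl
    rw [this, dif_pos (by omega), hy]
    simp only
    rw [dif_pos (by omega), answers, extend, dif_pos (Fin.is_lt _)]
  have hqd : ∀ p, 0 < (if ∃ p' < numBlocks m j * q,
      (allocateInput Q (answers u Q ω.2.2)).nat 2 (2 * p') = p then 1 else 0) ↔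
      Picked m j ω.1 p := by
    intro p
    have hq := hd.pos
    split_ifs with hp
    · obtain ⟨p', hp', rfl⟩ := hp
      rw [hf _ (by omega)]
      exact iff_of_true one_pos ⟨_, div_lt_numBlocks (by omega), rfl⟩
    · refine iff_of_false (lt_irrefl _) ?_
      rintro ⟨b, hb, rfl⟩
      have hlt : b * q < numBlocks m j * q := Nat.mul_lt_mul_of_pos_right hb hq
      refine hp ⟨b * q, hlt, ?_⟩
      rw [hf _ (by omega), show 2 * (b * q) = b * (2 * q) by ring,
        Nat.mul_div_cancel _ (by omega)]
  have hsum := h.sum_nonneg (y := y) hm hd.pos hH (extend_mem hu) hf hyl hqd hb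
  have hval : ∀ ν, ∑ i, agentSign (A i) * u ν i =
      ∑ p ∈ Finset.range m, (if out p = 0 then -1 else 1) * extend u ν p := by
    intro ν
    rw [← Fin.sum_univ_eq_sum_range (fun p ↦ (if out p = 0 then -1 else 1) * extend u ν p)]
    refine Finset.sum_congr rfl fun i _ ↦ ?_
    rw [hout i, extend, dif_pos i.2]
    split_ifs <;> simp [agentSign]
  rw [IsEnvyFree, envy, envyOf_a, envyOf_b, hval, hval]
  exact max_le (by linarith [hsum.1]) hsum.2

instance : Finite Agent :=
  Finite.of_injective (fun ν : Agent ↦ (match ν with | .a => true | .b => false : Bool)) (by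
    intro ν ν' h
    cases ν <;> cases ν' <;> simp at h ⊢)

instance : Nonempty Agent := ⟨.a⟩

/-- Weak duality: in an optimal allocation both advantages are at least Δ, hence so is their average
with weights k/m and 1 − k/m, which is a signed sum of the weighted differences. -/
theorem le_sum_abs_weighted {m k : ℕ} {u : Agent → Fin m → ℝ} {Δ : ℝ} (hm : 0 < m)
    (hopt : optEnvy u ≤ -Δ) (hk : k ≤ m) :
    Δ ≤ ∑ p ∈ Finset.range m, |weighted m k (extend u .a p) (extend u .b p)| := by
  obtain ⟨A, hA⟩ := exists_eq_ciInf_of_finite (f := fun A : Allocation m ↦ envy u A)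
  have hA' : envy u A ≤ -Δ := hA.le.trans hopt
  have ha := (le_max_left _ _).trans hA'
  have hb := (le_max_right _ _).trans hA'
  rw [envyOf_a] at ha
  rw [envyOf_b] at hb
  have hm' : (0 : ℝ) < m := by positivity
  rw [← Fin.sum_univ_eq_sum_range (fun p ↦ |weighted m k (extend u .a p) (extend u .b p)|)]
  have h1 : ∑ i : Fin m, agentSign (A i) * weighted m k (u .a i) (u .b i) ≤
      ∑ i : Fin m, |weighted m k (extend u .a i) (extend u .b i)| := by
    refine Finset.sum_le_sum fun i _ ↦ ?_
    rw [extend, extend, dif_pos i.2, dif_pos i.2]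
    have h2 := le_abs_self (weighted m k (u .a i) (u .b i))
    have h3 := neg_abs_le (weighted m k (u .a i) (u .b i))
    cases A i <;> simp only [agentSign, Fin.eta] <;> linarith
  refine le_trans ?_ h1
  have h4 : ∑ i : Fin m, agentSign (A i) * weighted m k (u .a i) (u .b i) =
      (k / m) * ∑ i, agentSign (A i) * u .a i + (1 - k / m) * -∑ i, agentSign (A i) * u .b i := by
    rw [← Finset.sum_neg_distrib, Finset.mul_sum, Finset.mul_sum, ← Finset.sum_add_distrib]
    refine Finset.sum_congr rfl fun i _ ↦ ?_
    rw [weighted, Nat.cast_sub hk]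
    field_simp
    ring
  rw [h4]
  have hk0 : (0 : ℝ) ≤ k / m := by positivity
  have hk1 : (k : ℝ) / m ≤ 1 := by
    rw [div_le_one hm']
    exact_mod_cast hk
  nlinarith

theorem sub_two_le_sum_abs_itemWeight {m k i : ℕ} {u : Agent → Fin m → ℝ} {Δ : ℝ} (hm : 0 < m)
    (hu : ∀ ν i, u ν i ∈ Set.Icc (0 : ℝ) 1) (hopt : optEnvy u ≤ -Δ) (hk : k ≤ m)
    (hl : ∀ p < m, level k i p ≤ m) :
    Δ - 2 ≤ ∑ p ∈ Finset.range m, |itemWeight m (extend u) k i p| := by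
  have hm' : (0 : ℝ) < m := by positivity
  have h1 : ∑ p ∈ Finset.range m, |weighted m k (extend u .a p) (extend u .b p)| ≤
      ∑ p ∈ Finset.range m, (|itemWeight m (extend u) k i p| + 2 / m) := by
    refine Finset.sum_le_sum fun p hp ↦ ?_
    rw [Finset.mem_range] at hp
    have h2 := abs_itemWeight_sub_le (i := i) (k := k) (fun ν ↦ extend_mem hu ν p hp) (hl p hp)
    have h3 := abs_sub_abs_le_abs_sub (weighted m k (extend u .a p) (extend u .b p))
      (itemWeight m (extend u) k i p)
    rw [abs_sub_comm] at h3
    linarith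
  rw [Finset.sum_add_distrib, Finset.sum_const, Finset.card_range, nsmul_eq_mul,
    mul_div_cancel₀ _ hm'.ne'] at h1
  linarith [le_sum_abs_weighted hm hopt hk]

/-! ### The choice of the parameters -/

/-- Conditions on the number of items that hold eventually. -/
structure IsLarge (σ : ℝ) (m : ℕ) : Prop where
  two_le_log : 2 ≤ Real.log m
  log_pow_le : Real.log m ^ 3 ≤ m
  log_le_sqrt : Real.log m ≤ √m
  le_log_pow : 2 ^ 26 * max σ 1 ^ 2 ≤ Real.log m ^ 5

theorem tendsto_log_natCast : Tendsto (fun m : ℕ ↦ Real.log m) atTop atTop :=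
  Real.tendsto_log_atTop.comp tendsto_natCast_atTop_atTop

theorem eventually_isLarge (σ : ℝ) : ∀ᶠ m : ℕ in atTop, IsLarge σ m := by
  have h1 := tendsto_log_natCast.eventually_ge_atTop 2
  have h2 := tendsto_log_natCast.eventually_ge_atTop (2 ^ 26 * max σ 1 ^ 2)
  have h3 := tendsto_natCast_atTop_atTop (R := ℝ).eventually
    ((isLittleO_log_rpow_rpow_atTop 3 (zero_lt_one)).bound one_pos)
  have h4 := tendsto_natCast_atTop_atTop (R := ℝ).eventually
    ((isLittleO_log_rpow_atTop (r := 1 / 2) (by norm_num)).bound one_pos)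
  filter_upwards [h1, h2, h3, h4] with m h1 h2 h3 h4
  refine ⟨h1, ?_, ?_, h2.trans (le_self_pow₀ (by linarith) (by norm_num))⟩
  · rw [Real.rpow_one, one_mul, Real.norm_eq_abs, Real.norm_eq_abs, Nat.abs_cast] at h3
    have := (le_abs_self _).trans h3
    exact_mod_cast this
  · rw [one_mul, ← Real.sqrt_eq_rpow, Real.norm_eq_abs, Real.norm_eq_abs,
      abs_of_nonneg (Real.sqrt_nonneg _)] at h4
    exact (le_abs_self _).trans h4

/-- The program uses the binary length in place of the logarithm, which it cannot compute. This
bound and the next one translate between the two. -/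
theorem log_le_size {m : ℕ} (hm : 0 < m) : Real.log m ≤ m.size := by
  have h1 : (m : ℝ) ≤ 2 ^ m.size := by exact_mod_cast (Nat.lt_size_self m).le
  have h2 := Real.log_le_log (by positivity) h1
  rw [Real.log_pow] at h2
  have := Real.log_two_lt_d9
  have : (m.size : ℝ) * Real.log 2 ≤ m.size * 1 := by gcongr; linarith
  linarith

theorem size_le_log {m : ℕ} (h : 2 ≤ Real.log m) : (m.size : ℝ) ≤ 3 * Real.log m := by
  rcases Nat.eq_zero_or_pos m.size with h0 | h0
  · rw [h0]
    push_cast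
    linarith
  have h1 : 2 ^ (m.size - 1) ≤ m := Nat.lt_size.1 (by omega)
  have h1' : (2 : ℝ) ^ (m.size - 1) ≤ m := by exact_mod_cast h1
  have h2 := Real.log_le_log (by positivity) h1'
  rw [Real.log_pow, Nat.cast_sub h0] at h2
  have := Real.log_two_gt_d9
  push_cast at h2
  have h3 : (1 : ℝ) ≤ m.size := by exact_mod_cast h0
  nlinarith

/-- D is the ideal average number of repetitions per item. If D > 1/2, blocks have size one and q =
⌈D⌉; otherwise q = 1 and D·2^j lies in (1/2, 1]. In both cases q/2^j is D up to a factor of 3. -/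
theorem exists_isDesign {m : ℕ} {Δ D : ℝ} (hD : 0 < D) (hΔ : 0 < Δ)
    (h : D ^ 2 * Δ ^ 4 = (m : ℝ) ^ 3 * (m.size : ℝ) ^ 2) :
    ∃ q j, IsDesign m Δ q j ∧ D * 2 ^ j ≤ q ∧ q ≤ 3 * (D * 2 ^ j) ∧ q ≤ D + 1 ∧
      (j = 0 ∨ q = 1 ∧ D * 2 ^ j ≤ 1) := by
  have hq : ∀ n : ℕ, ((n : ℝ) * n) * ((Δ * Δ) * (Δ * Δ)) < (m * (m * m)) * (m.size * m.size) ↔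
      (n : ℝ) < D := by
    intro n
    have e1 : ((n : ℝ) * n) * ((Δ * Δ) * (Δ * Δ)) = (n : ℝ) ^ 2 * Δ ^ 4 := by ring
    have e2 : ((m : ℝ) * (m * m)) * (m.size * m.size) = D ^ 2 * Δ ^ 4 := by rw [h]; ring
    rw [e1, e2, mul_lt_mul_iff_left₀ (by positivity),
      pow_lt_pow_iff_left₀ (by positivity) hD.le two_ne_zero]
  have hj : ∀ n : ℕ, (2 ^ n + 2 ^ n) * ((2 : ℝ) ^ n + 2 ^ n) *
      ((m * (m * m)) * (m.size * m.size)) ≤ (Δ * Δ) * (Δ * Δ) ↔ 2 * (D * 2 ^ n) ≤ 1 := by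
    intro n
    have e1 : (2 ^ n + 2 ^ n) * ((2 : ℝ) ^ n + 2 ^ n) * ((m * (m * m)) * (m.size * m.size)) =
        (2 * (D * 2 ^ n)) ^ 2 * Δ ^ 4 := by
      have : ((m : ℝ) * (m * m)) * (m.size * m.size) = D ^ 2 * Δ ^ 4 := by rw [h]; ring
      rw [this]
      ring
    have e2 : (Δ * Δ) * (Δ * Δ) = 1 ^ 2 * Δ ^ 4 := by ring
    rw [e1, e2, mul_le_mul_iff_left₀ (by positivity),
      pow_le_pow_iff_left₀ (by positivity) zero_le_one two_ne_zero]
  have hex : ∃ j : ℕ, 1 < 2 * (D * 2 ^ j) := by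
    obtain ⟨n, hn⟩ := pow_unbounded_of_one_lt (1 / D) (one_lt_two (α := ℝ))
    refine ⟨n, ?_⟩
    rw [div_lt_iff₀ hD] at hn
    linarith
  classical
  set j := Nat.find hex with hjdef
  have hj1 : 1 < 2 * (D * 2 ^ j) := Nat.find_spec hex
  have hj2 : ∀ n < j, 2 * (D * 2 ^ n) ≤ 1 := fun n hn ↦ not_lt.1 (Nat.find_min hex hn)
  have hq1 : ⌈D⌉₊ ≤ D + 1 := (Nat.ceil_lt_add_one hD.le).le
  have hq2 : D ≤ ⌈D⌉₊ := Nat.le_ceil D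
  refine ⟨⌈D⌉₊, j, ⟨Nat.ceil_pos.2 hD, fun n hn ↦ (hq n).2 (Nat.lt_ceil.1 hn),
    fun hn ↦ ?_, fun n hn ↦ (hj n).2 (hj2 n hn), ?_⟩, ?_⟩
  · exact hq2.not_gt ((hq _).1 hn)
  · exact not_le.1 fun hn ↦ hj1.not_ge ((hj j).1 hn)
  · rcases Nat.eq_zero_or_pos j with h0 | h0
    · rw [h0, pow_zero, mul_one] at hj1 ⊢
      -- Here D > 1/2, so ⌈D⌉ ≤ D + 1 ≤ 3D.
      exact ⟨hq2, by linarith, hq1, Or.inl rfl⟩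
    · have h1 := hj2 (j - 1) (by omega)
      have h2 : 2 * (D * 2 ^ (j - 1)) = D * 2 ^ j := by
        conv_rhs => rw [show j = (j - 1) + 1 by omega, pow_succ]
        ring
      rw [h2] at h1
      have h3 : D * 1 ≤ D * 2 ^ j := by
        gcongr
        exact one_le_pow₀ one_le_two
      have h4 : ⌈D⌉₊ = 1 := by
        refine le_antisymm (Nat.ceil_le.2 ?_) (Nat.ceil_pos.2 hD)
        push_cast
        linarith
      rw [h4, Nat.cast_one]
      exact ⟨h1, by linarith, by linarith, Or.inr ⟨rfl, h1⟩⟩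

/-- The parameters of the algorithm satisfy the estimates needed in the analysis. -/
structure IsGoodDesign (m : ℕ) (Δ : ℝ) (q j : ℕ) : Prop extends IsDesign m Δ q j where
  le_mul : m * √m * m.size * 2 ^ j ≤ q * Δ ^ 2
  mul_le : q * Δ ^ 2 ≤ 3 * (m * √m * m.size * 2 ^ j)
  eq_or_eq : j = 0 ∨ q = 1
  mul_log_le : q * Real.log m ^ 3 ≤ 4 * m
  pow_le : 2 ^ j ≤ m

section Estimates

variable {σ Δ : ℝ} {m q j : ℕ}

theorem IsLarge.pos (h : IsLarge σ m) : 0 < m := by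
  rcases Nat.eq_zero_or_pos m with rfl | h0
  · have := h.two_le_log
    norm_num at this
  · exact h0

theorem IsLarge.gap (h : IsLarge σ m) (hΔ : (m : ℝ) ^ (1 / 4 : ℝ) * Real.log m ^ 2 ≤ Δ) :
    4 ≤ Δ ∧ √m * Real.log m ^ 4 ≤ Δ ^ 2 := by
  have hm : (1 : ℝ) ≤ m := by exact_mod_cast h.pos
  have hL := h.two_le_log
  have h1 : 1 ≤ (m : ℝ) ^ (1 / 4 : ℝ) := Real.one_le_rpow hm (by norm_num)
  have h2 : ((m : ℝ) ^ (1 / 4 : ℝ)) ^ 2 = √m := by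
    rw [← Real.rpow_natCast, ← Real.rpow_mul (by positivity), Real.sqrt_eq_rpow]
    norm_num
  constructor
  · nlinarith
  · calc √m * Real.log m ^ 4 = ((m : ℝ) ^ (1 / 4 : ℝ) * Real.log m ^ 2) ^ 2 := by
          rw [← h2]; ring
      _ ≤ Δ ^ 2 := by gcongr

/-- The lower bound on Δ enters through √m log⁴ m ≤ Δ², which makes q at most 4m / log³ m; the upper
bound makes blocks no larger than m. -/
theorem IsLarge.exists_isGoodDesign (h : IsLarge σ m)
    (hΔ : (m : ℝ) ^ (1 / 4 : ℝ) * Real.log m ^ 2 ≤ Δ) (hΔm : Δ ≤ m) :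
    ∃ q j, IsGoodDesign m Δ q j := by
  obtain ⟨hΔ4, hgap⟩ := h.gap hΔ
  have hL := h.two_le_log
  have hm0 := h.pos
  have hm : (1 : ℝ) ≤ m := by exact_mod_cast hm0
  have hs0 : 0 < √(m : ℝ) := Real.sqrt_pos.2 (by positivity)
  have hs1 : 1 ≤ √(m : ℝ) := Real.one_le_sqrt.2 hm
  have hs : √(m : ℝ) ^ 2 = m := Real.sq_sqrt (by positivity)
  have hl1 := log_le_size hm0
  have hl2 := size_le_log hL
  have hl0 : 0 < (m.size : ℝ) := by linarith
  have hΔ0 : 0 < Δ ^ 2 := by positivity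
  set D := m * √m * m.size / Δ ^ 2 with hD
  have hD0 : 0 < D := by positivity
  have hDΔ : D * Δ ^ 2 = m * √m * m.size := div_mul_cancel₀ _ hΔ0.ne'
  obtain ⟨q, j, hd, h1, h2, h3, h4⟩ := exists_isDesign (m := m) (Δ := Δ) hD0 (by linarith) (by
    calc D ^ 2 * Δ ^ 4 = (D * Δ ^ 2) ^ 2 := by ring
      _ = (m : ℝ) ^ 2 * √m ^ 2 * (m.size : ℝ) ^ 2 := by rw [hDΔ]; ring
      _ = _ := by rw [hs]; ring)
  refine ⟨q, j, ⟨hd, ?_, ?_, h4.imp_right And.left, ?_, ?_⟩⟩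
  · calc m * √m * m.size * 2 ^ j = (D * 2 ^ j) * Δ ^ 2 := by rw [← hDΔ]; ring
      _ ≤ _ := by gcongr
  · calc q * Δ ^ 2 ≤ (3 * (D * 2 ^ j)) * Δ ^ 2 := by gcongr
      _ = _ := by rw [← hDΔ]; ring
  · have h5 : D * Real.log m ^ 3 ≤ 3 * m := by
      rw [hD, div_mul_eq_mul_div, div_le_iff₀ hΔ0]
      calc m * √m * m.size * Real.log m ^ 3 ≤ m * √m * (3 * Real.log m) * Real.log m ^ 3 := by
            gcongr
        _ = 3 * m * (√m * Real.log m ^ 4) := by ring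
        _ ≤ _ := by gcongr
    have h6 := h.log_pow_le
    calc q * Real.log m ^ 3 ≤ (D + 1) * Real.log m ^ 3 := by gcongr
      _ ≤ _ := by linarith
  · rcases h4 with h4 | ⟨-, h4⟩
    · rw [h4]
      exact hm0
    · have h5 : 1 ≤ D * m := by
        rw [hD, div_mul_eq_mul_div, le_div_iff₀ hΔ0, one_mul]
        calc Δ ^ 2 ≤ (m : ℝ) ^ 2 := by gcongr
          _ = (m : ℝ) * 1 * 1 * m := by ring
          _ ≤ (m : ℝ) * √m * m.size * m := by gcongr; linarith
      have h6 : D * 2 ^ j ≤ D * m := h4.trans h5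
      exact_mod_cast le_of_mul_le_mul_left h6 hD0

theorem numBlocks_mul_pow_le (h : 2 ^ j ≤ m) : numBlocks m j * 2 ^ j ≤ 2 * m := by
  rcases Nat.eq_zero_or_pos (numBlocks m j) with h0 | h0
  · simp [h0]
  · have h1 := (lt_numBlocks (m := m) (j := j) (b := numBlocks m j - 1)).1 (by omega)
    have h2 : numBlocks m j * 2 ^ j = (numBlocks m j - 1) * 2 ^ j + 2 ^ j := by
      conv_lhs => rw [show numBlocks m j = numBlocks m j - 1 + 1 by omega]
      ring
    omega

/-- The block size cancels between the number of blocks, at most 2m/2^j, and q Δ² ≤ 3 m^{3/2} ℓ 2^j.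
With ℓ ≤ 3 log m and two groups of q answers, 36 = 2·3·3·2. -/
theorem IsGoodDesign.queries_le (hd : IsGoodDesign m Δ q j) (h : IsLarge σ m) (hΔ : 0 < Δ) :
    ((2 * (numBlocks m j * q) : ℕ) : ℝ) ≤
      36 * ((m : ℝ) ^ (5 / 2 : ℝ) / Δ ^ 2) * Real.log m ^ 1 := by
  have hm : (0 : ℝ) < m := by exact_mod_cast h.pos
  have hpow : (m : ℝ) ^ (5 / 2 : ℝ) = m * m * √m := by
    rw [Real.sqrt_eq_rpow, show (5 / 2 : ℝ) = 1 + 1 + 1 / 2 by norm_num, Real.rpow_add hm,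
      Real.rpow_add hm, Real.rpow_one]
  have h1 : (numBlocks m j : ℝ) * 2 ^ j ≤ 2 * m := by exact_mod_cast numBlocks_mul_pow_le hd.pow_le
  have h2 := hd.mul_le
  have h3 := size_le_log h.two_le_log
  rw [hpow, mul_div_assoc', pow_one, div_mul_eq_mul_div, le_div_iff₀ (by positivity)]
  push_cast
  calc 2 * ((numBlocks m j : ℝ) * q) * Δ ^ 2 = 2 * (numBlocks m j * (q * Δ ^ 2)) := by ring
    _ ≤ 2 * (numBlocks m j * (3 * (m * √m * m.size * 2 ^ j))) := by gcongr
    _ = 6 * (m * √m * m.size) * (numBlocks m j * 2 ^ j) := by ring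
    _ ≤ 6 * (m * √m * (3 * Real.log m)) * (2 * m) := by gcongr
    _ = _ := by ring

/-- A bound for the running time. -/
noncomputable def runningTime : Polynomial ℕ := 100 * (Polynomial.X + 1) ^ 3

theorem eval_runningTime (m : ℕ) : runningTime.eval m = 100 * (m + 1) ^ 3 := by
  rw [runningTime, Polynomial.eval_mul, Polynomial.eval_pow, Polynomial.eval_add,
    Polynomial.eval_X, Polynomial.eval_one, Polynomial.eval_ofNat]

theorem IsGoodDesign.repetitions_le (hd : IsGoodDesign m Δ q j) (h : IsLarge σ m) : q ≤ 4 * m := by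
  have h1 := hd.mul_log_le
  have h2 : 1 ≤ Real.log m ^ 3 := one_le_pow₀ (by linarith [h.two_le_log])
  have : (q : ℝ) ≤ 4 * m := by
    calc (q : ℝ) = q * 1 := by ring
      _ ≤ q * Real.log m ^ 3 := by gcongr
      _ ≤ _ := h1
  exact_mod_cast this

theorem IsGoodDesign.design_time_le (hd : IsGoodDesign m Δ q j) (h : IsLarge σ m) :
    m.size * 3 + q * 2 + j * 3 + 6 + numBlocks m j * (4 * j + 8 * q + 10) ≤
      runningTime.eval m := by
  have h1 := hd.repetitions_le h
  have h2 : m.size ≤ m := Nat.size_le.2 Nat.lt_two_pow_self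
  have h3 : j ≤ m := Nat.lt_two_pow_self.le.trans hd.pow_le
  have h4 : numBlocks m j ≤ m := numBlocks_le
  rw [eval_runningTime]
  calc _ ≤ m * 3 + (4 * m) * 2 + m * 3 + 6 + m * (4 * m + 8 * (4 * m) + 10) := by gcongr
    _ ≤ _ := by nlinarith [sq_nonneg m, Nat.zero_le (m ^ 3)]

theorem IsGoodDesign.allocate_time_le (hd : IsGoodDesign m Δ q j) (h : IsLarge σ m) :
    m * 3 + numBlocks m j * q * 9 + (m + 1) * (m * (m * 12 + 11) + 4) + 3 ≤
      runningTime.eval m := by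
  have h1 := hd.repetitions_le h
  have h4 : numBlocks m j ≤ m := numBlocks_le
  rw [eval_runningTime]
  calc _ ≤ m * 3 + m * (4 * m) * 9 + (m + 1) * (m * (m * 12 + 11) + 4) + 3 := by gcongr
    _ ≤ _ := by nlinarith [sq_nonneg m, Nat.zero_le (m ^ 3)]

end Estimates

/-! ### The failure probability -/

theorem measure_biUnion_le_card {α ι : Type*} [MeasurableSpace α] {μ : Measure α} {s : Finset ι}
    {E : ι → Set α} {ε : ℝ} (h : ∀ i ∈ s, μ (E i) ≤ ENNReal.ofReal ε) {n : ℕ} (hn : s.card ≤ n) :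
    μ (⋃ i ∈ s, E i) ≤ n * ENNReal.ofReal ε := by
  refine (measure_biUnion_finset_le s E).trans ((Finset.sum_le_card_nsmul s _ _ h).trans ?_)
  rw [nsmul_eq_mul]
  gcongr

section Failure

variable {σ Δ H ε : ℝ} {m q j : ℕ} {U : Agent → ℕ → ℝ}

/-- Union bound over (m+1)m gain events, four times as many noise events (two agents, two tails) and
four coin events. -/
theorem randomness_not_typical_le
    (hweight : ∀ k ≤ m, ∀ i < m, (∀ p < m, level k i p ≤ m) →
      randomness σ {ω | ∑ b ∈ Finset.range (numBlocks m j),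
        itemSign m q U k i (pick m j ω.1 b) (noiseSum q ω.2.2 b) *
          itemWeight m U k i (pick m j ω.1 b) ≤ H} ≤ ENNReal.ofReal ε)
    (hnoise : ∀ k ≤ m, ∀ i < m, ∀ ν : Agent, ∀ e : ℝ, e = 1 ∨ e = -1 →
      randomness σ {ω | ∑ b ∈ Finset.range (numBlocks m j),
        e * itemSign m q U k i (pick m j ω.1 b) (noiseSum q ω.2.2 b) *
          noiseSum q ω.2.2 b (true, ν) ≤ -(q * H / 8)} ≤ ENNReal.ofReal ε)
    (hcoin : ∀ ν : Agent, ∀ e : ℝ, e = 1 ∨ e = -1 → ∃ E : Set Randomness,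
      randomness σ E ≤ ENNReal.ofReal ε ∧ ∀ ω ∉ E, ∀ _ : DecidablePred (Picked m j ω.1),
        -(H / 4) < ∑ p ∈ Finset.range m,
          if Picked m j ω.1 p then 0 else e * coinSign (ω.2.1 p) * U ν p) :
    randomness σ {ω | ¬ Typical m q j U H ω} ≤ ENNReal.ofReal (9 * (m + 1) ^ 2 * ε) := by
  classical
  choose! E hE hE' using hcoin
  set S := Finset.range (m + 1) ×ˢ Finset.range m with hS
  set R := ({.a, .b} : Finset Agent) ×ˢ ({1, -1} : Finset ℝ) with hR
  have hScard : S.card = (m + 1) * m := by simp [hS]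
  have hRcard : R.card ≤ 4 := by
    rw [hR, Finset.card_product]
    exact Nat.mul_le_mul Finset.card_le_two Finset.card_le_two
  have hSmem : ∀ k i, (k, i) ∈ S ↔ k ≤ m ∧ i < m := by simp [hS]
  have hRmem : ∀ ν e, (ν, e) ∈ R ↔ e = 1 ∨ e = -1 := by
    intro ν e
    cases ν <;> simp [hR]
  set W : ℕ × ℕ → Set Randomness := fun x ↦ {ω | (∀ p < m, level x.1 x.2 p ≤ m) ∧
    ∑ b ∈ Finset.range (numBlocks m j),
      itemSign m q U x.1 x.2 (pick m j ω.1 b) (noiseSum q ω.2.2 b) *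
        itemWeight m U x.1 x.2 (pick m j ω.1 b) ≤ H} with hW
  set N : (ℕ × ℕ) × (Agent × ℝ) → Set Randomness := fun x ↦
    {ω | ∑ b ∈ Finset.range (numBlocks m j),
      x.2.2 * itemSign m q U x.1.1 x.1.2 (pick m j ω.1 b) (noiseSum q ω.2.2 b) *
        noiseSum q ω.2.2 b (true, x.2.1) ≤ -(q * H / 8)} with hN
  have hsub : {ω | ¬ Typical m q j U H ω} ⊆
      (⋃ x ∈ S, W x) ∪ ((⋃ x ∈ S ×ˢ R, N x) ∪ ⋃ x ∈ R, E x.1 x.2) := by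
    intro ω hω
    by_contra hcon
    simp only [Set.mem_union, Set.mem_iUnion, not_or, not_exists] at hcon
    obtain ⟨h1, h2, h3⟩ := hcon
    refine hω ⟨fun k hk i hi hl ↦ ?_, fun k hk i hi ν e he ↦ ?_, fun ν e he ↦ ?_⟩
    · exact not_le.1 fun h ↦ h1 (k, i) ((hSmem k i).2 ⟨hk, hi⟩) ⟨hl, h⟩
    · exact not_le.1 fun h ↦ h2 ((k, i), (ν, e))
        (Finset.mem_product.2 ⟨(hSmem k i).2 ⟨hk, hi⟩, (hRmem ν e).2 he⟩) h
    · exact hE' ν e he ω (h3 (ν, e) ((hRmem ν e).2 he))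
  have hWle : randomness σ (⋃ x ∈ S, W x) ≤ ((m + 1) * m : ℕ) * ENNReal.ofReal ε := by
    refine measure_biUnion_le_card ?_ hScard.le
    rintro ⟨k, i⟩ hx
    obtain ⟨hk, hi⟩ := (hSmem k i).1 hx
    by_cases hl : ∀ p < m, level k i p ≤ m
    · exact (measure_mono fun ω hω ↦ hω.2).trans (hweight k hk i hi hl)
    · rw [show W (k, i) = ∅ from Set.eq_empty_of_forall_notMem fun ω hω ↦ hl hω.1, measure_empty]
      exact zero_le
  have hNle : randomness σ (⋃ x ∈ S ×ˢ R, N x) ≤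
      ((m + 1) * m * 4 : ℕ) * ENNReal.ofReal ε := by
    refine measure_biUnion_le_card ?_ ?_
    · rintro ⟨⟨k, i⟩, ν, e⟩ hx
      obtain ⟨hx, hx'⟩ := Finset.mem_product.1 hx
      obtain ⟨hk, hi⟩ := (hSmem k i).1 hx
      exact hnoise k hk i hi ν e ((hRmem ν e).1 hx')
    · rw [Finset.card_product, hScard]
      gcongr
  have hEle : randomness σ (⋃ x ∈ R, E x.1 x.2) ≤ (4 : ℕ) * ENNReal.ofReal ε := by
    refine measure_biUnion_le_card ?_ hRcard
    rintro ⟨ν, e⟩ hx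
    exact hE ν e ((hRmem ν e).1 hx)
  calc randomness σ {ω | ¬ Typical m q j U H ω}
      ≤ ((m + 1) * m : ℕ) * ENNReal.ofReal ε + (((m + 1) * m * 4 : ℕ) * ENNReal.ofReal ε +
          (4 : ℕ) * ENNReal.ofReal ε) := by
        refine (measure_mono hsub).trans ((measure_union_le _ _).trans ?_)
        gcongr
        exact (measure_union_le _ _).trans (add_le_add hNle hEle)
    _ = ((m + 1) * m + (m + 1) * m * 4 + 4 : ℕ) * ENNReal.ofReal ε := by
        push_cast
        ring
    _ ≤ ((9 * (m + 1) ^ 2 : ℕ) : ENNReal) * ENNReal.ofReal ε := by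
        gcongr
        nlinarith
    _ = _ := by
        rw [← ENNReal.ofReal_natCast, ← ENNReal.ofReal_mul (by positivity)]
        push_cast
        rfl

/-- The gap guaranteed on the queried items. -/
noncomputable def margin (σ : ℝ) (m q : ℕ) : ℝ := √m * m.size / (256 * max σ 1 * √q)

theorem margin_sq (hq : 0 < q) :
    q * margin σ m q ^ 2 = m * (m.size : ℝ) ^ 2 / (2 ^ 16 * max σ 1 ^ 2) := by
  have h1 : √(q : ℝ) ^ 2 = q := Real.sq_sqrt (by positivity)
  have h2 : √(m : ℝ) ^ 2 = m := Real.sq_sqrt (by positivity)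
  have h3 : 0 < √(q : ℝ) := Real.sqrt_pos.2 (by positivity)
  have h4 : 0 < max σ 1 := lt_max_of_lt_right one_pos
  rw [margin, div_pow, mul_pow, mul_pow, mul_pow, h1, h2]
  field_simp
  norm_num

/-- By `margin_sq` the claim is m ℓ² ≥ 2^24 max(σ,1)² q. As q ≤ 4m / log³ m, it suffices that log⁵ m
≥ 2^26 max(σ,1)²; this is the point of `le_log_pow` in `IsLarge`. -/
theorem IsGoodDesign.le_margin (hd : IsGoodDesign m Δ q j) (h : IsLarge σ m) :
    16 ≤ margin σ m q := by
  have hq : (0 : ℝ) < q := by exact_mod_cast hd.pos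
  have hm : (0 : ℝ) < m := by exact_mod_cast h.pos
  have h4 : 0 < max σ 1 := lt_max_of_lt_right one_pos
  have hL := h.two_le_log
  have hL5 := h.le_log_pow
  have h0 : 0 ≤ margin σ m q := by
    unfold margin
    positivity
  refine le_of_sq_le_sq ?_ h0
  refine le_of_mul_le_mul_left (a := (q : ℝ)) ?_ hq
  rw [margin_sq hd.pos, le_div_iff₀ (by positivity)]
  refine le_of_mul_le_mul_right (a := Real.log m ^ 3) ?_ (by positivity)
  calc q * 16 ^ 2 * (2 ^ 16 * max σ 1 ^ 2) * Real.log m ^ 3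
      = (2 ^ 24 * max σ 1 ^ 2) * (q * Real.log m ^ 3) := by ring
    _ ≤ (2 ^ 24 * max σ 1 ^ 2) * (4 * m) :=
      mul_le_mul_of_nonneg_left hd.mul_log_le (by positivity)
    _ = (2 ^ 26 * max σ 1 ^ 2) * m := by ring
    _ ≤ Real.log m ^ 5 * m := by gcongr
    _ = m * Real.log m ^ 2 * Real.log m ^ 3 := by ring
    _ ≤ _ := by
      gcongr
      exact log_le_size h.pos

/-- The bound for the probability of a single bad event. -/
noncomputable def eventBound (σ : ℝ) (m : ℕ) : ℝ :=
  Real.exp (-(Real.log m ^ 2 / (2 ^ 23 * max σ 1 ^ 4)))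

theorem exp_le_eventBound (h : IsLarge σ m) {x : ℝ}
    (hx : x ≤ -((m.size : ℝ) ^ 2 / (2 ^ 23 * max σ 1 ^ 4))) :
    ENNReal.ofReal (Real.exp x) ≤ ENNReal.ofReal (eventBound σ m) := by
  refine ENNReal.ofReal_le_ofReal (Real.exp_le_exp.2 (hx.trans (neg_le_neg ?_)))
  have := log_le_size h.pos
  have := h.two_le_log
  gcongr

/-- With the choices of c and t below, the Chernoff exponent is at least twice c times the margin,
and the surplus bounds the probability. -/
theorem IsGoodDesign.randomness_weight_le (hd : IsGoodDesign m Δ q j) (h : IsLarge σ m)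
    (hσ : 0 < σ) (hU : ∀ ν, ∀ p < m, U ν p ∈ Set.Icc (0 : ℝ) 1) {k i : ℕ}
    (hki : ∀ p < m, level k i p ≤ m) (hΔ : 4 ≤ Δ) (hΔm : Δ ≤ m)
    (hweight : Δ - 2 ≤ ∑ p ∈ Finset.range m, |itemWeight m U k i p|) :
    randomness σ {ω | ∑ b ∈ Finset.range (numBlocks m j),
        itemSign m q U k i (pick m j ω.1 b) (noiseSum q ω.2.2 b) *
          itemWeight m U k i (pick m j ω.1 b) ≤ margin σ m q} ≤
      ENNReal.ofReal (eventBound σ m) := by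
  have hq : (0 : ℝ) < q := by exact_mod_cast hd.pos
  have hm : (0 : ℝ) < m := by exact_mod_cast h.pos
  set τ := max σ 1 with hτ
  have hτ1 : 1 ≤ τ := le_max_right _ _
  have hτσ : σ ≤ τ := le_max_left _ _
  have hr0 : 0 < √(q : ℝ) := Real.sqrt_pos.2 hq
  have hr : √(q : ℝ) ^ 2 = q := Real.sq_sqrt hq.le
  have hs0 : 0 < √(m : ℝ) := Real.sqrt_pos.2 hm
  have hs : √(m : ℝ) ^ 2 = m := Real.sq_sqrt hm.le
  have hL := h.two_le_log
  have hl1 := log_le_size h.pos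
  have hl2 := size_le_log hL
  have hls : (m.size : ℝ) ≤ 3 * √m := hl2.trans (by linarith [h.log_le_sqrt])
  have hl0 : (0 : ℝ) < m.size := by linarith
  -- With σ replaced by τ, this is the largest c admitted by the logistic comparison; τ ≥ 1 also
  -- gives c ≤ 1 when q = 1.
  set c := √(q : ℝ) / (8 * τ) with hc
  have hc0 : 0 < c := by positivity
  have hc2 : c ^ 2 * (64 * τ ^ 2) = q := by
    rw [hc, div_pow, mul_pow, hr]
    field_simp
    norm_num
  have hcH : c * margin σ m q = √m * m.size / (2048 * τ ^ 2) := by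
    rw [hc, margin, ← hτ]
    field_simp
    norm_num
  -- A lower bound for the mean of c|θ_p|. As tangent point it leaves at least m t² in the exponent.
  set t := c * (Δ - 2) / m with ht
  have ht1 : t ≤ 1 := by
    rw [ht, div_le_one hm]
    refine le_of_sq_le_sq ?_ hm.le
    have h1 : (c * (Δ - 2)) ^ 2 ≤ c ^ 2 * Δ ^ 2 := by
      rw [mul_pow]
      gcongr
      · linarith
      · linarith
    refine h1.trans ?_
    have h2 : c ^ 2 * 64 ≤ q := by
      calc c ^ 2 * 64 = c ^ 2 * (64 * 1 ^ 2) := by ring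
        _ ≤ c ^ 2 * (64 * τ ^ 2) := by gcongr
        _ = q := hc2
    have h3 : q * Δ ^ 2 ≤ 64 * (m : ℝ) ^ 2 := by
      rcases hd.eq_or_eq with h0 | h0
      · have h4 := hd.mul_le
        rw [h0, pow_zero, mul_one] at h4
        calc q * Δ ^ 2 ≤ 3 * (m * √m * m.size) := h4
          _ ≤ 3 * (m * √m * (3 * √m)) := by gcongr
          _ = 9 * m * √m ^ 2 := by ring
          _ ≤ 64 * (m : ℝ) ^ 2 := by rw [hs]; nlinarith
      · rw [h0, Nat.cast_one, one_mul]
        have : Δ ^ 2 ≤ (m : ℝ) ^ 2 := by gcongr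
        nlinarith [sq_nonneg (m : ℝ)]
    have h5 : c ^ 2 * 64 * Δ ^ 2 ≤ q * Δ ^ 2 := by gcongr
    linarith
  have hcv : c * (8 * √((q * (σ ^ 2).toNNReal : NNReal) : ℝ)) ≤ q := by
    have h1 : ((q * (σ ^ 2).toNNReal : NNReal) : ℝ) = q * σ ^ 2 := by
      simp [Real.coe_toNNReal _ (sq_nonneg σ)]
    rw [h1, Real.sqrt_mul hq.le, Real.sqrt_sq hσ.le]
    have h2 : c * (8 * (√q * σ)) = q * (σ / τ) := by
      rw [hc]
      field_simp
      exact hr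
    rw [h2]
    exact mul_le_of_le_one_right hq.le (div_le_one_of_le₀ hτσ (by linarith))
  have hcj : j = 0 ∨ c ≤ 1 := by
    refine hd.eq_or_eq.imp_right fun h0 ↦ ?_
    rw [hc, h0, Nat.cast_one, Real.sqrt_one]
    exact div_le_one_of_le₀ (by linarith) (by linarith)
  refine (randomness_sum_sign_mul_weight_le hσ.ne' h.pos hd.pos hU hki hc0.le hcv hcj ht1).trans
    (exp_le_eventBound h ?_)
  have ht0 : 0 ≤ t := by
    have : 0 ≤ Δ - 2 := by linarith
    positivity
  have h1 : m * t ^ 2 ≤ 2 * t * (c * ∑ p ∈ Finset.range m, |itemWeight m U k i p|) - m * t ^ 2 := by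
    have h2 : m * t = c * (Δ - 2) := mul_div_cancel₀ _ hm.ne'
    have h3 : t * (c * (Δ - 2)) ≤ t * (c * ∑ p ∈ Finset.range m, |itemWeight m U k i p|) := by
      gcongr
    rw [← h2] at h3
    nlinarith
  have h2 : √m * m.size / (256 * τ ^ 2) * 2 ^ j ≤ m * t ^ 2 := by
    have h3 : m * t ^ 2 * m = c ^ 2 * (Δ - 2) ^ 2 := by
      rw [ht]
      field_simp
    refine le_of_mul_le_mul_right (a := (m : ℝ)) ?_ hm
    rw [h3]
    have h4 : Δ ^ 2 / 4 ≤ (Δ - 2) ^ 2 := by nlinarith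
    have h5 : c ^ 2 = q / (64 * τ ^ 2) := by
      rw [eq_div_iff (by positivity)]
      exact hc2
    calc √m * m.size / (256 * τ ^ 2) * 2 ^ j * m
        = (m * √m * m.size * 2 ^ j) / (256 * τ ^ 2) := by ring
      _ ≤ (q * Δ ^ 2) / (256 * τ ^ 2) :=
        div_le_div_of_nonneg_right hd.le_mul (by positivity)
      _ = q / (64 * τ ^ 2) * (Δ ^ 2 / 4) := by
        field_simp
        norm_num
      _ ≤ c ^ 2 * (Δ - 2) ^ 2 := by rw [h5]; gcongr
  have h3 : √m * m.size / (1024 * τ ^ 2) ≤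
      (2 * t * (c * ∑ p ∈ Finset.range m, |itemWeight m U k i p|) - m * t ^ 2) / 4 / 2 ^ j := by
    rw [le_div_iff₀ (by positivity), le_div_iff₀ (by norm_num)]
    calc √m * m.size / (1024 * τ ^ 2) * 2 ^ j * 4 = √m * m.size / (256 * τ ^ 2) * 2 ^ j := by
          field_simp
          norm_num
      _ ≤ _ := h2.trans h1
  rw [hcH]
  have h4 : (m.size : ℝ) ^ 2 / (2 ^ 23 * τ ^ 4) ≤ √m * m.size / (2048 * τ ^ 2) := by
    rw [div_le_div_iff₀ (by positivity) (by positivity)]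
    calc (m.size : ℝ) ^ 2 * (2048 * τ ^ 2) = m.size * m.size * (2048 * τ ^ 2) := by ring
      _ ≤ (3 * √m) * m.size * (2048 * τ ^ 4) := by
        gcongr
        · norm_num
      _ ≤ √m * m.size * (2 ^ 23 * τ ^ 4) := by
        have : 0 ≤ √m * m.size * τ ^ 4 := by positivity
        nlinarith
  have h5 : √m * m.size / (1024 * τ ^ 2) = 2 * (√m * m.size / (2048 * τ ^ 2)) := by
    field_simp
    norm_num
  linarith

theorem IsGoodDesign.randomness_noise_le (hd : IsGoodDesign m Δ q j) (h : IsLarge σ m)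
    {k i : ℕ} (ν : Agent) {e : ℝ} (he : e = 1 ∨ e = -1) (hσ : 0 < σ) :
    randomness σ {ω | ∑ b ∈ Finset.range (numBlocks m j),
        e * itemSign m q U k i (pick m j ω.1 b) (noiseSum q ω.2.2 b) *
          noiseSum q ω.2.2 b (true, ν) ≤ -(q * margin σ m q / 8)} ≤
      ENNReal.ofReal (eventBound σ m) := by
  have hq : (0 : ℝ) < q := by exact_mod_cast hd.pos
  have hm : (0 : ℝ) < m := by exact_mod_cast h.pos
  have hH0 := hd.le_margin h
  have hH := margin_sq (σ := σ) (m := m) hd.pos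
  set τ := max σ 1 with hτ
  have hτ1 : 1 ≤ τ := le_max_right _ _
  have hτσ : σ ≤ τ := le_max_left _ _
  set H := margin σ m q
  -- This c minimises −c q H/8 + m c² q τ²/2, the exponent after bounding the number of blocks by m
  -- and σ by τ.
  refine (randomness_sum_sign_mul_noise_le (c := H / (8 * m * τ ^ 2)) ν he (by positivity)).trans
    (exp_le_eventBound h ?_)
  have hn : (numBlocks m j : ℝ) ≤ m := by exact_mod_cast numBlocks_le
  calc H / (8 * m * τ ^ 2) * -(q * H / 8) +
        numBlocks m j * ((H / (8 * m * τ ^ 2)) ^ 2 * (q * σ ^ 2) / 2)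
      ≤ H / (8 * m * τ ^ 2) * -(q * H / 8) +
        m * ((H / (8 * m * τ ^ 2)) ^ 2 * (q * τ ^ 2) / 2) := by gcongr
    _ = -(q * H ^ 2 / (128 * m * τ ^ 2)) := by
      field_simp
      ring
    _ = -((m.size : ℝ) ^ 2 / (2 ^ 23 * τ ^ 4)) := by
      rw [hH]
      field_simp
      norm_num
    _ ≤ _ := le_rfl

theorem IsGoodDesign.exists_coin_event (hd : IsGoodDesign m Δ q j) (h : IsLarge σ m)
    (hU : ∀ ν, ∀ p < m, U ν p ∈ Set.Icc (0 : ℝ) 1) (ν : Agent) {e : ℝ} (he : e = 1 ∨ e = -1) :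
    ∃ E : Set Randomness, randomness σ E ≤ ENNReal.ofReal (eventBound σ m) ∧
      ∀ ω ∉ E, ∀ _ : DecidablePred (Picked m j ω.1),
        -(margin σ m q / 4) < ∑ p ∈ Finset.range m,
          if Picked m j ω.1 p then 0 else e * coinSign (ω.2.1 p) * U ν p := by
  classical
  have hm : (0 : ℝ) < m := by exact_mod_cast h.pos
  have hH0 := hd.le_margin h
  have hH := margin_sq (σ := σ) (m := m) hd.pos
  rcases hd.eq_or_eq with rfl | rfl
  -- With blocks of size one every item is picked and no item is left to the coins.
  · refine ⟨∅, by simp, fun ω _ _ ↦ ?_⟩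
    rw [Finset.sum_eq_zero]
    · linarith
    · intro p hp
      rw [if_pos]
      exact ⟨p, lt_numBlocks.2 (by simpa using hp), by simp [pick, blockItem, coinNum]⟩
  set τ := max σ 1 with hτ
  have hτ1 : 1 ≤ τ := le_max_right _ _
  set H := margin σ m 1
  -- The minimiser of −c H/4 + m c²/2.
  refine ⟨_, (randomness_sum_coinSign_le (σ := σ) (j := j) (H := -(H / 4)) (c := H / (4 * m))
    hU ν he (by positivity)).trans (exp_le_eventBound h ?_), fun ω hω _ ↦ ?_⟩
  · rw [Nat.cast_one, one_mul] at hH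
    calc H / (4 * m) * -(H / 4) + m * ((H / (4 * m)) ^ 2 / 2) = -(H ^ 2 / (32 * m)) := by
          field_simp
          ring
      _ = -((m.size : ℝ) ^ 2 / (2 ^ 21 * τ ^ 2)) := by
          rw [hH]
          field_simp
          norm_num
      _ ≤ _ := by
          gcongr <;> norm_num
  · refine (not_le.1 hω).trans_eq (Finset.sum_congr rfl fun p _ ↦ ?_)
    congr

theorem IsGoodDesign.randomness_not_succeeds_le (hd : IsGoodDesign m Δ q j) (h : IsLarge σ m)
    (hσ : 0 < σ) (hΔ : 4 ≤ Δ) (hΔm : Δ ≤ m) {u : Agent → Fin m → ℝ}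
    (hu : ∀ ν i, u ν i ∈ Set.Icc (0 : ℝ) 1) (hopt : optEnvy u ≤ -Δ) :
    randomness σ {ω | ¬ algorithm.Succeeds u Δ (runningTime.eval m) ω} ≤
      ENNReal.ofReal (9 * (m + 1) ^ 2 * eventBound σ m) := by
  have hsub : {ω | ¬ algorithm.Succeeds u Δ (runningTime.eval m) ω} ⊆
      {ω | ¬ Typical m q j (extend u) (margin σ m q) ω} := fun ω hω hT ↦
    hω (hT.succeeds hd.toIsDesign h.pos hu (hd.le_margin h) (hd.design_time_le h)
      (hd.allocate_time_le h))
  exact (measure_mono hsub).trans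
    (randomness_not_typical_le (U := extend u) (H := margin σ m q)
      (fun k hk i _ hl ↦ hd.randomness_weight_le h hσ (extend_mem hu) hl hΔ hΔm
        (sub_two_le_sum_abs_itemWeight h.pos hu hopt hk hl))
      (fun k _ i _ ν e he ↦ hd.randomness_noise_le h ν he hσ)
      (fun ν e he ↦ hd.exists_coin_event h (extend_mem hu) ν he))

end Failure

/-- The bound for a single event is exp(−const · log² m), which beats every power of m and in
particular the number of events. -/
theorem tendsto_eventBound (σ : ℝ) :
    Tendsto (fun m : ℕ ↦ 9 * ((m : ℝ) + 1) ^ 2 * eventBound σ m) atTop (𝓝 0) := by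
  have hτ : 0 < max σ 1 := lt_max_of_lt_right one_pos
  have h1 : Tendsto (fun x : ℝ ↦ 36 * Real.exp (-(x * (x / (2 ^ 23 * max σ 1 ^ 4) - 2))))
      atTop (𝓝 (36 * 0)) := by
    refine Tendsto.const_mul _ (Real.tendsto_exp_neg_atTop_nhds_zero.comp ?_)
    refine tendsto_id.atTop_mul_atTop₀ (tendsto_atTop_add_const_right _ _ ?_)
    exact tendsto_id.atTop_div_const (by positivity)
  rw [mul_zero] at h1
  refine squeeze_zero' (Eventually.of_forall fun m ↦ ?_) ?_ (h1.comp tendsto_log_natCast)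
  · have := Real.exp_pos (-(Real.log m ^ 2 / (2 ^ 23 * max σ 1 ^ 4)))
    unfold eventBound
    positivity
  · filter_upwards [eventually_ge_atTop 1] with m hm
    have hm' : (1 : ℝ) ≤ m := by exact_mod_cast hm
    have h2 : (m : ℝ) ^ 2 = Real.exp (2 * Real.log m) := by
      rw [mul_comm, Real.exp_mul, Real.exp_log (by positivity)]
      norm_cast
    calc 9 * ((m : ℝ) + 1) ^ 2 * eventBound σ m ≤ 9 * ((m : ℝ) + m) ^ 2 * eventBound σ m := by
          have := (Real.exp_pos (-(Real.log m ^ 2 / (2 ^ 23 * max σ 1 ^ 4)))).le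
          unfold eventBound
          gcongr
      _ = 36 * ((m : ℝ) ^ 2 * eventBound σ m) := by ring
      _ = _ := by
          rw [h2, eventBound, ← Real.exp_add, Function.comp_apply]
          congr 2
          ring

end EnvyFree

theorem theorem2 (σ : ℝ) (hσ : 0 < σ) :
    ∃ C : ℝ, 0 < C ∧
    ∃ (P : EnvyFree.NonadaptiveAlgorithm) (T : Polynomial ℕ) (K : ℝ) (k : ℕ) (δ : ℕ → ℝ),
      Tendsto δ atTop (𝓝 0) ∧
      ∀ᶠ m : ℕ in atTop, ∀ Δ : ℝ,
        (m : ℝ) ^ (1 / 4 : ℝ) * Real.log m ^ 2 ≤ Δ → Δ ≤ C * m →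
        -- for all outcomes of the coin tosses and all answers: number of queries, running time
        (∀ coins : ℕ → Bool, ∃ Q : List (Fin m), P.Designs Δ coins (T.eval m) Q ∧
          (Q.length : ℝ) ≤ K * ((m : ℝ) ^ (5 / 2 : ℝ) / Δ ^ 2) * Real.log m ^ k ∧
          ∀ (y : Fin Q.length → EnvyFree.Agent → ℝ) (coins' : ℕ → Bool),
            ∃ A : EnvyFree.Allocation m, P.Allocates Q y coins' (T.eval m) A) ∧
        -- the failure probability, uniformly over all instances with gap `Δ`
        ∀ u : EnvyFree.Agent → Fin m → ℝ, (∀ ν i, u ν i ∈ Set.Icc (0 : ℝ) 1) →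
          EnvyFree.optEnvy u ≤ -Δ →
          EnvyFree.randomness σ {ω | ¬ P.Succeeds u Δ (T.eval m) ω} ≤ ENNReal.ofReal (δ m) := by
  -- C = 1 loses nothing, since utilities in [0,1] never give an envy below −m.
  refine ⟨1, one_pos, EnvyFree.algorithm, EnvyFree.runningTime, 36, 1, _,
    EnvyFree.tendsto_eventBound σ, ?_⟩
  filter_upwards [EnvyFree.eventually_isLarge σ] with m h Δ hΔ hΔm
  rw [one_mul] at hΔm
  obtain ⟨q, j, hd⟩ := h.exists_isGoodDesign hΔ hΔm
  have hΔ4 : 4 ≤ Δ := (h.gap hΔ).1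
  refine ⟨fun coins ↦ ⟨EnvyFree.queryList m q j coins,
    hd.toIsDesign.designs (hd.design_time_le h) coins, ?_, fun y coins' ↦ ?_⟩,
    fun u hu hopt ↦ hd.randomness_not_succeeds_le h hσ hΔ4 hΔm hu hopt⟩
  · rw [EnvyFree.length_queryList]
    exact hd.queries_le h (by linarith)
  · obtain ⟨A, _, _, hA, -⟩ := EnvyFree.allocates (hd.allocate_time_le h) coins coins' y
    exact ⟨A, hA⟩
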